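/- Let $M$ be a closed (compact, without boundary) connected smooth manifold of dimension $n-1\ge 0$, equipped with a smooth volume form $\omega'$ and with the distance $d'$ induced by a Riemannian metric, and let $d$ be the product distance on $M\times[-1,1]$, $d\big((x,z),(x',z')\big)=\sqrt{d'(x,x')^2+|z-z'|^2}$. Let $z$ be the coordinate on $[-1,1]$ and put $\omega=\omega'\wedge dz$, a volume form on $M\times[-1,1]$; orient $M\times[-1,1]$ by $\omega$. Let $C\in\mathbb R$. Then there is a constant $D\in\mathbb R$, depending only on $M$, $\omega'$, $d'$ and $C$, with the following property. Let $\delta>0$, let $\Omega$ be a smooth volume form on $M\times[-1,1]$ and let $\chi\colon M\times[-1,1]\to\mathbb R$ be a function such that - either $\Omega=(1+\chi)\,\omega$, or $C<1$ and $\omega=(1+\chi)\,\Omega$; - $\int_{M\times[-1,1]}\omega=\int_{M\times[-1,1]}\Omega$; - $|\chi|\le C$ everywhere on $M\times[-1,1]$; - $\operatorname{supp}\chi\subset M\times[0,\delta]$. Then there is a smooth diffeomorphism $f$ of $M\times[-1,1]$ onto itself such that $f=\mathrm{id}$ on $M\times[-1,0]$, $f^*\Omega=\omega$, and $\|f\|_{C^0}:=\max_{p}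 d(p,f(p))\le D\delta$. -/

import Mathlib

open scoped Manifold ContDiff Bundle

noncomputable section

namespace VolumeAdjust

/-! ### Differential forms on a manifold (possibly with boundary) -/

section Forms

variable {E : Type*} [NormedAddCommGroup E] [NormedSpace ℝ E]
  {H : Type*} [TopologicalSpace H] (I : ModelWithCorners ℝ E H)
  (N : Type*) [TopologicalSpace N] [ChartedSpace H N]

/-- A (not necessarily smooth) differential form of degree `n` on `N`. -/
abbrev Form (n : ℕ) : Type _ :=
  (x : N) → (TangentSpace I x) [⋀^Fin n]→L[ℝ] ℝ

variable {I N} {n : ℕ}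

/-- The expression at `x` of the form `α` in the chart `chartAt H c`: the alternating form on the
model space obtained by feeding `α x` with the coordinate vector fields of that chart. It is
meaningful for `x` in the source of the chart. -/
def Form.inChart [IsManifold I 1 N] (α : Form I N n) (c x : N) : E [⋀^Fin n]→L[ℝ] ℝ :=
  (α x).compContinuousLinearMap ((trivializationAt E (TangentSpace I : N → Type _) c).symmL ℝ x)

/-- A form is smooth if its expressions in the charts of `N` are smooth. -/
def Form.IsSmooth [IsManifold I 1 N] (α : Form I N n) : Prop :=
  ∀ c : N, ContMDiffOn I 𝓘(ℝ, E [⋀^Fin n]→L[ℝ] ℝ) ∞ (α.inChart c) (chartAt H c).source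

/-- A volume form: a smooth form of degree `n = dim N` that vanishes at no point. -/
structure Form.IsVolumeForm [IsManifold I 1 N] (α : Form I N n) : Prop where
  degree_eq : n = Module.finrank ℝ E
  smooth : α.IsSmooth
  ne_zero : ∀ x, α x ≠ 0

/-- The pullback `f^*α` of a form under a map `f : N → N`. -/
def Form.pullback (f : N → N) (α : Form I N n) : Form I N n :=
  fun x => (α (f x)).compContinuousLinearMap (mfderiv I I f x)

/-- A smooth partition of unity on `N`, indexed by the points of `N`, such that the function with
index `c` is supported in the domain of the chart at `c`. -/
def chartPartition (I : ModelWithCorners ℝ E H) (N : Type*) [TopologicalSpace N]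
    [ChartedSpace H N] [IsManifold I ∞ N] [FiniteDimensional ℝ E] [T2Space N]
    [SigmaCompactSpace N] : SmoothPartitionOfUnity N I N Set.univ :=
  (SmoothPartitionOfUnity.exists_isSubordinate_chartAt_source I N).choose

/-- The integral over `N` of a form `α` of top degree, where `N` is oriented by the volume form
`o` (a frame is positive iff `o` is positive on it): cut `α` into pieces supported in charts by a
smooth partition of unity, and integrate the coefficient of each piece over the image of the chart,
with the sign `+` if the chart is positively oriented and `-` if it is negatively oriented. The
coefficient is taken with respect to a basis `b` of the model space and integrated against the
Lebesgue measure which gives volume one to the parallelepiped spanned by `b`. -/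
def Form.integral [IsManifold I ∞ N] [FiniteDimensional ℝ E] [T2Space N] [SigmaCompactSpace N]
    [MeasurableSpace E] [BorelSpace E] (b : Module.Basis (Fin n) ℝ E) (o α : Form I N n) : ℝ :=
  ∑ᶠ c : N, ∫ y in (extChartAt I c).target,
    chartPartition I N c ((extChartAt I c).symm y) *
      (Real.sign (o.inChart c ((extChartAt I c).symm y) b) *
        α.inChart c ((extChartAt I c).symm y) b) ∂b.addHaar

end Forms

/-- The wedge product `α ∧ β` of an `m`-form and a `1`-form on a vector space:
`(α ∧ β)(v₀, …, vₘ) = ∑ i, (-1) ^ (m + i) * β vᵢ * α (v₀, …, v̂ᵢ, …, vₘ)`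
(the convention in which `dx₁ ∧ ⋯ ∧ dxₙ` is the determinant). -/
def wedgeOne {E : Type*} [NormedAddCommGroup E] [NormedSpace ℝ E] {m : ℕ}
    (α : E [⋀^Fin m]→L[ℝ] ℝ) (β : E →L[ℝ] ℝ) : E [⋀^Fin (m + 1)]→L[ℝ] ℝ :=
  (-1 : ℝ) ^ m • ContinuousAlternatingMap.alternatizeUncurryFin (β.smulRight α)

/-! ### The cylinder `M × [-1, 1]` -/

instance : Fact ((-1 : ℝ) < 1) := ⟨by norm_num⟩

/-- The model of `M × [-1, 1]` for an `m`-dimensional manifold `M` without boundary. -/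
abbrev cylModel (m : ℕ) := (𝓡 m).prod (𝓡∂ 1)

/-- The manifold with boundary `M × [-1, 1]`. -/
abbrev Cyl (M : Type*) := M × Set.Icc (-1 : ℝ) 1

/-- The standard basis of the model vector space of `M × [-1, 1]`. -/
def cylBasis (m : ℕ) :
    Module.Basis (Fin (m + 1)) ℝ (EuclideanSpace ℝ (Fin m) × EuclideanSpace ℝ (Fin 1)) :=
  ((EuclideanSpace.basisFun (Fin m) ℝ).toBasis.prod
    (EuclideanSpace.basisFun (Fin 1) ℝ).toBasis).reindex finSumFinEquiv

section Cylinder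

variable {m : ℕ} {M : Type*} [TopologicalSpace M] [ChartedSpace (EuclideanSpace ℝ (Fin m)) M]

/-- The form `ω' ∧ dz` on `M × [-1, 1]`, where `ω'` is pulled back by the first projection and `z`
is the coordinate on `[-1, 1]`. -/
def wedgeDz (ω' : Form (𝓡 m) M m) : Form (cylModel m) (Cyl M) (m + 1) := fun p =>
  wedgeOne (E := EuclideanSpace ℝ (Fin m) × EuclideanSpace ℝ (Fin 1))
    ((ω' p.1).compContinuousLinearMap
      (mfderiv (cylModel m) (𝓡 m) (Prod.fst : Cyl M → M) p))
    (mfderiv (cylModel m) 𝓘(ℝ, ℝ) (fun q : Cyl M => (q.2 : ℝ)) p)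

end Cylinder

/-- The product distance on `M × [-1, 1]` (the distance of the product Riemannian metric). -/
def cylDist {M : Type*} [MetricSpace M] (p q : Cyl M) : ℝ :=
  Real.sqrt (dist p.1 q.1 ^ 2 + dist p.2 q.2 ^ 2)

end VolumeAdjust

end

open scoped Manifold ContDiff Bundle

noncomputable section

namespace VolumeAdjust

/-! Write Ω = a ω. The density `a` is smooth and positive, equals 1 at heights outside [0, δ],
differs from 1 by at most a constant depending on C, and `a - 1` has integral zero. Let h(x) be the
integral of `a - 1` over the fibre of x. By the support condition sup |h| = O(δ), and by Fubini h
has integral zero on M.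

Fix a profile ρ of integral 1 on [-1, 1], vanishing for z ≤ 0, and interpose the density b = 1 +
ρ(z) h(x). The densities b and a have the same integral over every fibre, and their partial fibre
integrals differ by O(δ). Hence monotone rearrangement along the fibres carries one to the other and
moves points by O(δ) (`transports_vertical`). It remains to carry 1 to b by height-preserving maps
with displacement O(sup |h|).

For this, h is a finite sum of functions which in some chart are ∂ₖu divided by the density of ω',
with u compactly supported and sup |u| = O(sup |h|) (`exists_isDec`). In a cube this comes from
averaging over one coordinate after another. Connectedness of M lets the remaining mean values be
moved onto one fixed bump, where they cancel because h has integral zero. Adding ρ ∂ₖu to a density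
is a rearrangement along the lines parallel to the k-th axis: the primitives of the two densities
differ by ρu, so the displacement is governed by sup |u| and not by derivatives of u
(`exists_coordinate_transport`, `transports_elemFun`). Partial sums of the decomposition could make
the density negative, so h is added in N small rounds. Their displacements add up to a bound
independent of N (`IsDec.transports`).

Positivity of b is clear for small δ, with ρ ≤ 2. For large δ one uses h > -1 and a profile bounded
by a number close to 1; the displacement is then bounded by the diameter
(`exists_diffeomorph_of_density`). Every map fixes the heights z ≤ 0, where ρ = 0 and a = 1. -/

open Set Filter Topology MeasureTheory

/-! ### Parameter integrals and implicit functions on sets with boundary. -/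

section Analysis

universe u

variable {X G : Type*} [NormedAddCommGroup X] [NormedSpace ℝ X]
  [NormedAddCommGroup G] [NormedSpace ℝ G]

/-- Differentiation under the integral sign within a convex set. -/
theorem hasFDerivWithinAt_integral_of_continuousOn {S : Set X} (hS : Convex ℝ S)
    {F : X × ℝ → G} {F' : X × ℝ → X →L[ℝ] G}
    (hF : ContinuousOn F (S ×ˢ Icc 0 1)) (hF' : ContinuousOn F' (S ×ˢ Icc 0 1))
    (hd : ∀ x ∈ S, ∀ θ ∈ Icc (0 : ℝ) 1,
      HasFDerivWithinAt (fun y => F (y, θ)) (F' (x, θ)) S x) {x : X} (hx : x ∈ S) :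
    HasFDerivWithinAt (fun y => ∫ θ in (0 : ℝ)..1, F (y, θ)) (∫ θ in (0 : ℝ)..1, F' (x, θ)) S x := by
  have hline : ∀ y ∈ S, ContinuousOn (fun θ : ℝ => (y, θ)) (Icc (0 : ℝ) 1) := fun y _ => by fun_prop
  have hint : ∀ y ∈ S, IntervalIntegrable (fun θ => F (y, θ)) volume 0 1 := fun y hy =>
    (hF.comp (hline y hy) fun θ hθ => ⟨hy, hθ⟩).intervalIntegrable_of_Icc zero_le_one
  have hint' : IntervalIntegrable (fun θ => F' (x, θ)) volume 0 1 :=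
    (hF'.comp (hline x hx) fun θ hθ => ⟨hx, hθ⟩).intervalIntegrable_of_Icc zero_le_one
  rw [hasFDerivWithinAt_iff_isLittleO, Asymptotics.isLittleO_iff]
  intro ε hε
  -- Compactness of [0, 1] makes the derivative continuous in y uniformly in θ. The mean value
  -- inequality on the convex set S ∩ ball then gives an o(‖y - x‖) remainder that can be integrated
  -- over θ.
  have hunif : ∀ᶠ y in 𝓝[S] x, ∀ θ ∈ Icc (0 : ℝ) 1, dist (F' (y, θ)) (F' (x, θ)) < ε := by
    have := (isCompact_Icc (a := (0 : ℝ)) (b := 1)).mem_uniformity_of_prod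
      (f := fun y θ => F' (y, θ)) (s := S) (q := x) hF' hx (Metric.dist_mem_uniformity hε)
    obtain ⟨v, hv, h⟩ := this
    filter_upwards [hv] with y hy θ hθ
    exact h y hy θ hθ
  obtain ⟨r, hr, hball⟩ := Metric.mem_nhdsWithin_iff.1 hunif
  filter_upwards [inter_mem self_mem_nhdsWithin
    (mem_nhdsWithin_of_mem_nhds (Metric.ball_mem_nhds x hr))] with y hy
  have hyS : y ∈ S := hy.1
  have key : ∀ θ ∈ Icc (0 : ℝ) 1, ‖F (y, θ) - F (x, θ) - F' (x, θ) (y - x)‖ ≤ ε * ‖y - x‖ := by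
    intro θ hθ
    refine Convex.norm_image_sub_le_of_norm_hasFDerivWithin_le' (s := S ∩ Metric.ball x r)
      (f := fun y => F (y, θ)) (f' := fun y => F' (y, θ))
      (fun z hz => (hd z hz.1 θ hθ).mono inter_subset_left) (fun z hz => ?_)
      (hS.inter (convex_ball x r)) ⟨hx, Metric.mem_ball_self hr⟩ hy
    rw [← dist_eq_norm]
    exact (hball ⟨hz.2, hz.1⟩ θ hθ).le
  have e1 : (∫ θ in (0 : ℝ)..1, F' (x, θ)) (y - x) = ∫ θ in (0 : ℝ)..1, F' (x, θ) (y - x) := by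
    rw [intervalIntegral.intervalIntegral_eq_integral_uIoc,
      intervalIntegral.intervalIntegral_eq_integral_uIoc]
    simp only [zero_le_one, if_true, one_smul]
    exact ContinuousLinearMap.integral_apply (by rw [uIoc_of_le zero_le_one]; exact hint'.1) _
  have hint'' : IntervalIntegrable (fun θ => F' (x, θ) (y - x)) volume 0 1 :=
    ((hF'.comp (hline x hx) fun θ hθ => ⟨hx, hθ⟩).clm_apply
      continuousOn_const).intervalIntegrable_of_Icc zero_le_one
  rw [e1, ← intervalIntegral.integral_sub (hint y hyS) (hint x hx),
    ← intervalIntegral.integral_sub ((hint y hyS).sub (hint x hx)) hint'']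
  have := intervalIntegral.norm_integral_le_of_norm_le_const (a := (0 : ℝ)) (b := 1)
    (f := fun θ => F (y, θ) - F (x, θ) - F' (x, θ) (y - x)) (C := ε * ‖y - x‖)
    (fun θ hθ => key θ (by rw [uIoc_of_le zero_le_one] at hθ; exact Ioc_subset_Icc_self hθ))
  simpa using this

theorem continuousOn_integral_of_continuousOn {X : Type*} [TopologicalSpace X] {S : Set X}
    {F : X × ℝ → G}
    (hF : ContinuousOn F (S ×ˢ Icc 0 1)) :
    ContinuousOn (fun y => ∫ θ in (0 : ℝ)..1, F (y, θ)) S := by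
  have hint : ∀ y ∈ S, IntervalIntegrable (fun θ => F (y, θ)) volume 0 1 := fun y hy =>
    (hF.comp (by fun_prop : ContinuousOn (fun θ : ℝ => (y, θ)) (Icc (0 : ℝ) 1))
      fun θ hθ => ⟨hy, hθ⟩).intervalIntegrable_of_Icc zero_le_one
  intro x hx
  rw [ContinuousWithinAt, Metric.tendsto_nhds]
  intro ε hε
  obtain ⟨v, hv, h⟩ := (isCompact_Icc (a := (0 : ℝ)) (b := 1)).mem_uniformity_of_prod
    (f := fun y θ => F (y, θ)) (s := S) (q := x) hF hx (Metric.dist_mem_uniformity (half_pos hε))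
  filter_upwards [hv, self_mem_nhdsWithin] with y hy hyS
  rw [dist_eq_norm, ← intervalIntegral.integral_sub (hint y hyS) (hint x hx)]
  have := intervalIntegral.norm_integral_le_of_norm_le_const (a := (0 : ℝ)) (b := 1)
    (f := fun θ => F (y, θ) - F (x, θ)) (C := ε / 2)
    (fun θ hθ => by
      rw [uIoc_of_le zero_le_one] at hθ
      rw [← dist_eq_norm]
      exact (h y hy θ (Ioc_subset_Icc_self hθ)).le)
  simp only [sub_zero, abs_one, mul_one] at this
  linarith

/-- Smoothness of an integral depending on a parameter in a convex set. -/
theorem contDiffOn_integral_of_convex {X : Type u} [NormedAddCommGroup X] [NormedSpace ℝ X]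
    {S : Set X} (hS : Convex ℝ S) (hSu : UniqueDiffOn ℝ S)
    (n : ℕ) : ∀ {G : Type u} [NormedAddCommGroup G] [NormedSpace ℝ G] {F : X × ℝ → G},
    ContDiffOn ℝ n F (S ×ˢ Icc 0 1) → ContDiffOn ℝ n (fun y => ∫ θ in (0 : ℝ)..1, F (y, θ)) S := by
  induction n with
  | zero =>
    intro G _ _ F hF
    simp only [Nat.cast_zero, contDiffOn_zero] at hF ⊢
    exact continuousOn_integral_of_continuousOn hF
  | succ n ih =>
    intro G _ _ F hF
    have hu : UniqueDiffOn ℝ (S ×ˢ Icc (0 : ℝ) 1) := hSu.prod (uniqueDiffOn_Icc zero_lt_one)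
    push_cast at hF ⊢
    obtain ⟨-, F', hF', hd⟩ := (contDiffOn_succ_iff_hasFDerivWithinAt_of_uniqueDiffOn hu).1 hF
    refine (contDiffOn_succ_iff_hasFDerivWithinAt_of_uniqueDiffOn hSu).2 ⟨by simp,
      fun x => ∫ θ in (0 : ℝ)..1, (F' (x, θ)).comp (ContinuousLinearMap.inl ℝ X ℝ), ?_, ?_⟩
    -- The induction passes from values in G to values in X →L[ℝ] G, which is why G is quantified
    -- inside the statement and lives in the universe of X.
    · exact ih (F := fun q => (F' q).comp (ContinuousLinearMap.inl ℝ X ℝ))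
        (hF'.clm_comp contDiffOn_const)
    · intro x hx
      refine hasFDerivWithinAt_integral_of_continuousOn hS hF.continuousOn
        (F' := fun q => (F' q).comp (ContinuousLinearMap.inl ℝ X ℝ))
        (hF'.clm_comp contDiffOn_const).continuousOn (fun y hy θ hθ => ?_) hx
      have h1 : HasFDerivWithinAt (fun z : X => (z, θ)) (ContinuousLinearMap.inl ℝ X ℝ) S y :=
        (hasFDerivAt_prodMk_left y θ).hasFDerivWithinAt
      exact HasFDerivWithinAt.comp (t := S ×ˢ Icc (0 : ℝ) 1) y (hd (y, θ) (mk_mem_prod hy hθ)) h1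
        fun z hz => mk_mem_prod hz hθ

/-- Smoothness of a primitive depending on parameters. -/
theorem contDiffOn_primitive {X : Type} [NormedAddCommGroup X] [NormedSpace ℝ X]
    {V : Set X} (hV : Convex ℝ V) (hVu : UniqueDiffOn ℝ V)
    {T : Set ℝ} (hT : Convex ℝ T) (hTu : UniqueDiffOn ℝ T) {l : ℝ} (hl : l ∈ T) {a : X × ℝ → ℝ}
    (ha : ContDiffOn ℝ ∞ a (V ×ˢ T)) :
    ContDiffOn ℝ ∞ (fun q : X × ℝ => ∫ s in l..q.2, a (q.1, s)) (V ×ˢ T) := by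
  -- Rescaling to [0, 1] turns the moving end point into a parameter of the integrand.
  have e : (fun q : X × ℝ => ∫ s in l..q.2, a (q.1, s)) =
      fun q => (q.2 - l) * ∫ θ in (0 : ℝ)..1, a (q.1, l + (q.2 - l) * θ) := by
    ext q
    have := intervalIntegral.smul_integral_comp_add_mul (a := 0) (b := 1)
      (fun s => a (q.1, s)) (q.2 - l) l
    simp only [smul_eq_mul, mul_zero, add_zero, mul_one, add_sub_cancel] at this
    exact this.symm
  rw [e]
  refine ContDiffOn.mul (by fun_prop) ?_
  rw [contDiffOn_infty]
  intro n
  refine contDiffOn_integral_of_convex (F := fun w : (X × ℝ) × ℝ =>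
    a (w.1.1, l + (w.1.2 - l) * w.2)) (hV.prod hT) (hVu.prod hTu) n ?_
  refine (contDiffOn_infty.1 ha n).comp (f := fun w : (X × ℝ) × ℝ =>
    (w.1.1, l + (w.1.2 - l) * w.2)) (ContDiff.contDiffOn (by fun_prop)) ?_
  rintro ⟨⟨x, t⟩, θ⟩ ⟨⟨hx, ht⟩, hθ⟩
  refine ⟨hx, ?_⟩
  have := hT hl ht (sub_nonneg.2 hθ.2) hθ.1 (by ring)
  simp only [smul_eq_mul] at this
  convert this using 1
  ring

/-- Smoothness of a scalar function defined implicitly, within a set of unique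
differentiability. -/
theorem contDiffOn_implicit {S : Set X} (hS : UniqueDiffOn ℝ S) {T : Set ℝ}
    (hT : UniqueDiffOn ℝ T) {F : X × ℝ → ℝ} {g σ : X → ℝ} {d : X × ℝ → ℝ} {c : ℝ} (hc : 0 < c)
    (hF : ContDiffOn ℝ ∞ F (S ×ˢ T)) (hg : ContDiffOn ℝ ∞ g S) (hσ : MapsTo σ S T)
    (hFσ : ∀ x ∈ S, F (x, σ x) = g x)
    (hd : ∀ x ∈ S, ∀ t ∈ T, HasDerivWithinAt (fun s => F (x, s)) (d (x, t)) T t)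
    (hdpos : ∀ x ∈ S, ∀ t ∈ T, 0 < d (x, t))
    (hmono : ∀ x ∈ S, ∀ s ∈ T, ∀ t ∈ T, c * |s - t| ≤ |F (x, s) - F (x, t)|) :
    ContDiffOn ℝ ∞ σ S := by
  have hu : UniqueDiffOn ℝ (S ×ˢ T) := hS.prod hT
  -- Continuity comes from expansion: c |σ y - σ x| ≤ |g y - F (y, σ x)|, and the right side tends
  -- to 0.
  have hcont : ContinuousOn σ S := by
    intro x hx
    have h1 : Tendsto (fun y => |g y - F (y, σ x)| / c) (𝓝[S] x) (𝓝 0) := by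
      have h2 : ContinuousWithinAt (fun y => |g y - F (y, σ x)| / c) S x := by
        have h3 : ContinuousWithinAt (fun y => F (y, σ x)) S x :=
          ContinuousWithinAt.comp (t := S ×ˢ T) (f := fun y => (y, σ x))
            (hF.continuousOn (x, σ x) ⟨hx, hσ hx⟩) (by fun_prop) fun y hy => ⟨hy, hσ hx⟩
        exact ((hg.continuousOn x hx).sub h3).abs.div_const c
      have h4 := h2.tendsto
      simpa [hFσ x hx] using h4
    rw [ContinuousWithinAt, tendsto_iff_dist_tendsto_zero]
    refine squeeze_zero' (Eventually.of_forall fun _ => dist_nonneg) ?_ h1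
    filter_upwards [self_mem_nhdsWithin] with y hy
    rw [le_div_iff₀ hc, mul_comm, Real.dist_eq, ← hFσ y hy]
    exact hmono y hy _ (hσ hy) _ (hσ hx)
  obtain ⟨-, F', hF', hFd⟩ := (contDiffOn_succ_iff_hasFDerivWithinAt_of_uniqueDiffOn
    (n := ∞) hu).1 (by simpa using hF)
  obtain ⟨-, g', hg', hgd⟩ := (contDiffOn_succ_iff_hasFDerivWithinAt_of_uniqueDiffOn
    (n := ∞) hS).1 (by simpa using hg)
  have hF1 : ∀ x ∈ S, ∀ t ∈ T, F' (x, t) (0, 1) = d (x, t) := by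
    intro x hx t ht
    have h1 : HasDerivWithinAt (fun s : ℝ => (x, s)) ((0 : X), (1 : ℝ)) T t :=
      (hasDerivWithinAt_const t T x).prodMk (hasDerivWithinAt_id t T)
    have h2 := (hFd (x, t) ⟨hx, ht⟩).comp_hasDerivWithinAt t h1 fun s hs => ⟨hx, hs⟩
    exact (hT t ht).eq_deriv _ h2 (hd x hx t ht)
  have hmem : ∀ x ∈ S, (x, σ x) ∈ S ×ˢ T := fun x hx => ⟨hx, hσ hx⟩
  let σ' : X → X →L[ℝ] ℝ := fun x =>
    (F' (x, σ x) (0, 1))⁻¹ • (g' x - (F' (x, σ x)).comp (ContinuousLinearMap.inl ℝ X ℝ))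
  -- The map (x, t) ↦ (x, F (x, t)) has a triangular derivative with left inverse `Bi`. Composing it
  -- with y ↦ (y, σ y) gives y ↦ (y, g y), so the derivative of σ can be read off within S, boundary
  -- points included.
  have hσ' : ∀ x ∈ S, HasFDerivWithinAt σ (σ' x) S x := by
    intro x hx
    have hne : F' (x, σ x) (0, 1) ≠ 0 := by
      rw [hF1 x hx _ (hσ hx)]; exact (hdpos x hx _ (hσ hx)).ne'
    let A := F' (x, σ x)
    let Bi : X × ℝ →L[ℝ] X × ℝ := (ContinuousLinearMap.fst ℝ X ℝ).prod
      ((A (0, 1))⁻¹ • (ContinuousLinearMap.snd ℝ X ℝ -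
        (A.comp (ContinuousLinearMap.inl ℝ X ℝ)).comp (ContinuousLinearMap.fst ℝ X ℝ)))
    have h1 : HasFDerivWithinAt (fun q : X × ℝ => (q.1, F q))
        ((ContinuousLinearMap.fst ℝ X ℝ).prod A) (S ×ˢ T) (x, σ x) :=
      hasFDerivWithinAt_fst.prodMk (hFd _ (hmem x hx))
    have h2 : HasFDerivWithinAt (fun y => (y, g y)) ((ContinuousLinearMap.id ℝ X).prod (g' x)) S x :=
      (hasFDerivWithinAt_id x S).prodMk (hgd x hx)
    have h3 : Tendsto (fun y => (y, σ y)) (𝓝[S] x) (𝓝[S ×ˢ T] (x, σ x)) :=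
      tendsto_nhdsWithin_of_tendsto_nhds_of_eventually_within _
        (continuousWithinAt_id.prodMk (hcont x hx)) (by
          filter_upwards [self_mem_nhdsWithin] with y hy using hmem y hy)
    have h4 := HasFDerivWithinAt.of_comp_of_leftInverse (f'symm := Bi) h3 h1 h2 (by
      filter_upwards [self_mem_nhdsWithin] with y hy
      simp [hFσ y hy]) (by
      rintro ⟨v, s⟩
      have hv : A (v, s) = A (v, 0) + s * A (0, 1) := by
        rw [← smul_eq_mul, ← map_smul, ← map_add]; simp
      have hne' : A (0, 1) ≠ 0 := hne
      simp only [Bi, ContinuousLinearMap.prod_apply, ContinuousLinearMap.coe_fst',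
        _root_.smul_apply, _root_.sub_apply,
        ContinuousLinearMap.coe_snd', ContinuousLinearMap.comp_apply,
        ContinuousLinearMap.inl_apply, hv, smul_eq_mul]
      congr 1
      field_simp
      ring) hx
    have h5 := h4.snd
    refine h5.congr_fderiv ?_
    ext v
    simp [Bi, σ', A]
  -- Bootstrap: σ' is a smooth expression in σ and in the derivatives of F and g, so each order of
  -- smoothness of σ yields the next.
  rw [contDiffOn_infty]
  intro n
  induction n with
  | zero => simpa using hcont
  | succ n ih =>
    push_cast
    refine (contDiffOn_succ_iff_hasFDerivWithinAt_of_uniqueDiffOn hS).2 ⟨by simp, σ', ?_, hσ'⟩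
    have h1 : ContDiffOn ℝ n (fun x => F' (x, σ x)) S :=
      (contDiffOn_infty.1 hF' n).comp (contDiffOn_id.prodMk ih) hmem
    refine ContDiffOn.smul (ContDiffOn.inv (h1.clm_apply contDiffOn_const) fun x hx => ?_)
      ((contDiffOn_infty.1 hg' n).sub (h1.clm_comp contDiffOn_const))
    rw [hF1 x hx _ (hσ hx)]; exact (hdpos x hx _ (hσ hx)).ne'

end Analysis

/-! ### Rearrangement of densities along lines parallel to a coordinate axis. -/

section LineTransport

/-- A function on the line whose derivative is at least `c` expands distances by the factor `c`. -/
theorem mul_abs_sub_le_of_le_deriv {F f : ℝ → ℝ} {c : ℝ} {T : Set ℝ} (hT : Convex ℝ T)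
    (hF : ∀ t ∈ T, HasDerivWithinAt F (f t) T t) (hc : ∀ t ∈ T, c ≤ f t) {s t : ℝ} (hs : s ∈ T)
    (ht : t ∈ T) : c * |s - t| ≤ |F s - F t| := by
  have key : ∀ {s t : ℝ}, s ∈ T → t ∈ T → s ≤ t → c * (t - s) ≤ F t - F s := by
    intro s t hs ht hst
    have hcont : ContinuousOn F T := fun x hx => (hF x hx).continuousWithinAt
    have hder : ∀ x ∈ interior T, HasDerivAt F (f x) x := fun x hx =>
      (hF x (interior_subset hx)).hasDerivAt (mem_interior_iff_mem_nhds.1 hx)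
    exact hT.mul_sub_le_image_sub_of_le_deriv hcont
      (fun x hx => (hder x hx).differentiableAt.differentiableWithinAt)
      (fun x hx => by rw [(hder x hx).deriv]; exact hc x (interior_subset hx)) s hs t ht hst
  rcases le_total s t with h | h
  · rw [abs_sub_comm, abs_of_nonneg (sub_nonneg.2 h), abs_sub_comm]
    exact (key hs ht h).trans (le_abs_self _)
  · rw [abs_of_nonneg (sub_nonneg.2 h)]
    exact (key ht hs h).trans (le_abs_self _)

/-- A function on the line whose derivative is bounded below by a positive constant is
surjective. -/
theorem surjective_of_le_deriv {F f : ℝ → ℝ} {c : ℝ} (hc : 0 < c)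
    (hF : ∀ t, HasDerivAt F (f t) t) (hfc : ∀ t, c ≤ f t) : Function.Surjective F := by
  have hcont : Continuous F := continuous_iff_continuousAt.2 fun t => (hF t).continuousAt
  have hd : ∀ x, c ≤ deriv F x := fun x => by rw [(hF x).deriv]; exact hfc x
  have hdiff : Differentiable ℝ F := fun t => (hF t).differentiableAt
  refine hcont.surjective ?_ ?_
  · refine tendsto_atTop_mono' atTop (f₁ := fun t => F 0 + c * t) ?_
      (tendsto_atTop_add_const_left _ _ (tendsto_id.const_mul_atTop hc))
    filter_upwards [eventually_ge_atTop 0] with t ht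
    have := mul_sub_le_image_sub_of_le_deriv hdiff hd ht
    simp only [sub_zero] at this
    linarith
  · refine tendsto_atBot_mono' atBot (f₁ := fun t => F 0 + c * t) ?_
      (tendsto_atBot_add_const_left _ _ (tendsto_id.const_mul_atBot hc))
    filter_upwards [eventually_le_atBot 0] with t ht
    have := mul_sub_le_image_sub_of_le_deriv hdiff hd ht
    simp only [zero_sub] at this
    linarith

variable {m : ℕ}

/-- The vector obtained from `y` by replacing the coordinate `k` by `t`. -/
def setCoord (k : Fin m) (y : EuclideanSpace ℝ (Fin m)) (t : ℝ) : EuclideanSpace ℝ (Fin m) :=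
  y + (t - y k) • EuclideanSpace.single k (1 : ℝ)

@[simp] theorem setCoord_same (k : Fin m) (y : EuclideanSpace ℝ (Fin m)) (t : ℝ) :
    setCoord k y t k = t := by simp [setCoord]

theorem setCoord_of_ne {k j : Fin m} (h : j ≠ k) (y : EuclideanSpace ℝ (Fin m)) (t : ℝ) :
    setCoord k y t j = y j := by simp [setCoord, h]

@[simp] theorem setCoord_setCoord (k : Fin m) (y : EuclideanSpace ℝ (Fin m)) (s t : ℝ) :
    setCoord k (setCoord k y s) t = setCoord k y t := by
  ext j
  by_cases h : j = k
  · subst h; simp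
  · simp [setCoord_of_ne h]

@[simp] theorem setCoord_self (k : Fin m) (y : EuclideanSpace ℝ (Fin m)) :
    setCoord k y (y k) = y := by simp [setCoord]

theorem contDiff_setCoord (k : Fin m) :
    ContDiff ℝ ∞ (fun q : EuclideanSpace ℝ (Fin m) × ℝ => setCoord k q.1 q.2) := by
  unfold setCoord
  have : ContDiff ℝ ∞ (fun q : EuclideanSpace ℝ (Fin m) × ℝ => q.1 k) :=
    (EuclideanSpace.proj k : EuclideanSpace ℝ (Fin m) →L[ℝ] ℝ).contDiff.comp contDiff_fst
  fun_prop

theorem hasDerivAt_setCoord (k : Fin m) (y : EuclideanSpace ℝ (Fin m)) (t : ℝ) :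
    HasDerivAt (fun s => setCoord k y s) (EuclideanSpace.single k (1 : ℝ)) t := by
  unfold setCoord
  simpa using (((hasDerivAt_id t).sub_const (y k)).smul_const
    (EuclideanSpace.single k (1 : ℝ))).const_add y

theorem norm_sub_setCoord (k : Fin m) (y : EuclideanSpace ℝ (Fin m)) (t : ℝ) :
    ‖setCoord k y t - y‖ = |t - y k| := by
  simp [setCoord, norm_smul]

/-- `A` is a primitive of the density `a` along the lines parallel to the coordinate `k`. -/
structure IsLinePrimitive (k : Fin m) (a : EuclideanSpace ℝ (Fin m) × ℝ → ℝ)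
    (A : (EuclideanSpace ℝ (Fin m) × ℝ) × ℝ → ℝ) : Prop where
  contDiff : ContDiff ℝ ∞ A
  hasDerivAt : ∀ y z t, HasDerivAt (fun s => A ((y, z), s)) (a (setCoord k y t, z)) t
  setCoord : ∀ y z s t, A ((setCoord k y s, z), t) = A ((y, z), t)

theorem exists_isLinePrimitive (k : Fin m) {a : EuclideanSpace ℝ (Fin m) × ℝ → ℝ}
    (ha : ContDiff ℝ ∞ a) : ∃ A, IsLinePrimitive k a A := by
  have hg : ContDiff ℝ ∞ (fun w : (EuclideanSpace ℝ (Fin m) × ℝ) × ℝ =>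
      a (setCoord k w.1.1 w.2, w.1.2)) :=
    ha.comp (((contDiff_setCoord k).comp (by fun_prop :
      ContDiff ℝ ∞ fun w : (EuclideanSpace ℝ (Fin m) × ℝ) × ℝ => (w.1.1, w.2))).prodMk
        (by fun_prop))
  refine ⟨fun w => ∫ s in (0 : ℝ)..w.2, a (setCoord k w.1.1 s, w.1.2), ?_, ?_, ?_⟩
  · have := contDiffOn_primitive (X := EuclideanSpace ℝ (Fin m) × ℝ) convex_univ uniqueDiffOn_univ
      convex_univ uniqueDiffOn_univ (mem_univ (0 : ℝ)) (hg.contDiffOn (s := univ ×ˢ univ))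
    rwa [univ_prod_univ, contDiffOn_univ] at this
  · intro y z t
    have hc : Continuous fun s => a (VolumeAdjust.setCoord k y s, z) :=
      hg.continuous.comp (by fun_prop : Continuous fun s : ℝ => ((y, z), s))
    exact intervalIntegral.integral_hasDerivAt_right (hc.intervalIntegrable _ _)
      (hc.stronglyMeasurableAtFilter _ _) hc.continuousAt
  · intro y z s t
    simp

theorem IsLinePrimitive.mul_abs_sub_le {k : Fin m} {b : EuclideanSpace ℝ (Fin m) × ℝ → ℝ}
    {B : (EuclideanSpace ℝ (Fin m) × ℝ) × ℝ → ℝ} (hB : IsLinePrimitive k b B) {c : ℝ}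
    (hbc : ∀ q, c ≤ b q) (q : EuclideanSpace ℝ (Fin m) × ℝ) (s t : ℝ) :
    c * |s - t| ≤ |B (q, s) - B (q, t)| :=
  mul_abs_sub_le_of_le_deriv convex_univ
    (fun t _ => (hB.hasDerivAt q.1 q.2 t).hasDerivWithinAt)
    (fun t _ => hbc (VolumeAdjust.setCoord k q.1 t, q.2)) (mem_univ s) (mem_univ t)

/-- One-dimensional rearrangement with parameters: the new coordinate τ is the point at which the
primitive of b takes the value of the primitive of a. The lower bound on b over the whole line gives
existence, uniqueness and, by `contDiffOn_implicit`, smoothness. Differentiating the defining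
equation along the line gives the Jacobian equation. -/
theorem exists_line_transport {k : Fin m} {a b : EuclideanSpace ℝ (Fin m) × ℝ → ℝ}
    {A B : (EuclideanSpace ℝ (Fin m) × ℝ) × ℝ → ℝ} (hA : IsLinePrimitive k a A)
    (hB : IsLinePrimitive k b B) {c : ℝ} (hc : 0 < c) (hbc : ∀ q, c ≤ b q) :
    ∃ τ : EuclideanSpace ℝ (Fin m) × ℝ → ℝ, ContDiff ℝ ∞ τ ∧
      (∀ q, B (q, τ q) = A (q, q.1 k)) ∧
      ∀ y z, b (setCoord k y (τ (y, z)), z) *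
        fderiv ℝ τ (y, z) (EuclideanSpace.single k 1, 0) = a (y, z) := by
  have hsurj : ∀ q : EuclideanSpace ℝ (Fin m) × ℝ, Function.Surjective fun t => B (q, t) :=
    fun q => surjective_of_le_deriv hc (hB.hasDerivAt q.1 q.2) fun t => hbc _
  choose τ hτ using fun q : EuclideanSpace ℝ (Fin m) × ℝ => hsurj q (A (q, q.1 k))
  simp only at hτ
  have hproj : ContDiff ℝ ∞ (fun q : EuclideanSpace ℝ (Fin m) × ℝ => q.1 k) :=
    (EuclideanSpace.proj k : EuclideanSpace ℝ (Fin m) →L[ℝ] ℝ).contDiff.comp contDiff_fst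
  have hsm : ContDiff ℝ ∞ τ := by
    rw [← contDiffOn_univ]
    refine contDiffOn_implicit (T := univ) (F := B) (g := fun q => A (q, q.1 k))
      (d := fun w => b (setCoord k w.1.1 w.2, w.1.2)) uniqueDiffOn_univ uniqueDiffOn_univ hc
      hB.contDiff.contDiffOn (hA.contDiff.comp (contDiff_id.prodMk hproj)).contDiffOn
      (mapsTo_univ _ _) (fun q _ => hτ q)
      (fun q _ t _ => (hB.hasDerivAt q.1 q.2 t).hasDerivWithinAt)
      (fun q _ t _ => hc.trans_le (hbc _)) fun q _ s _ t _ => hB.mul_abs_sub_le hbc q s t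
  refine ⟨τ, hsm, hτ, fun y z => ?_⟩
  have h1 : HasDerivAt (fun s => τ (setCoord k y s, z))
      (fderiv ℝ τ (y, z) (EuclideanSpace.single k 1, 0)) (y k) := by
    have h2 : HasFDerivAt τ (fderiv ℝ τ (y, z)) (setCoord k y (y k), z) := by
      rw [setCoord_self]
      exact (hsm.differentiable (by simp) (y, z)).hasFDerivAt
    exact h2.comp_hasDerivAt (f := fun s => (setCoord k y s, z)) (y k)
      ((hasDerivAt_setCoord k y (y k)).prodMk (hasDerivAt_const _ _))
  have h3 : HasDerivAt (fun s => B ((y, z), τ (setCoord k y s, z)))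
      (b (setCoord k y (τ (y, z)), z) * fderiv ℝ τ (y, z) (EuclideanSpace.single k 1, 0)) (y k) := by
    have h4 := hB.hasDerivAt y z (τ (setCoord k y (y k), z))
    rw [setCoord_self] at h4
    have h5 := HasDerivAt.comp (y k) (h₂ := fun s => B ((y, z), s)) (by rwa [setCoord_self]) h1
    exact h5
  -- Neither primitive depends on the k-th coordinate of its base point, so y may be moved along its
  -- line without changing the functions compared.
  have h6 : (fun s => B ((y, z), τ (setCoord k y s, z))) = fun s => A ((y, z), s) := by
    ext s
    rw [← hB.setCoord y z s, hτ]
    simp [hA.setCoord]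
  rw [h6] at h3
  have h7 := hA.hasDerivAt y z (y k)
  rw [setCoord_self] at h7
  exact h3.unique h7

/-- Transport of the density `a` to `a + ρ ∂ₖu` along the lines parallel to the coordinate `k`. -/
theorem exists_coordinate_transport (k : Fin m) {a : EuclideanSpace ℝ (Fin m) × ℝ → ℝ}
    (ha : ContDiff ℝ ∞ a) {u : EuclideanSpace ℝ (Fin m) → ℝ} (hu : ContDiff ℝ ∞ u) {ρ : ℝ → ℝ}
    (hρ : ContDiff ℝ ∞ ρ) {c : ℝ} (hc : 0 < c) (hac : ∀ q, c ≤ a q)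
    {b : EuclideanSpace ℝ (Fin m) × ℝ → ℝ}
    (hb : ∀ y z, b (y, z) = a (y, z) + ρ z * fderiv ℝ u y (EuclideanSpace.single k 1))
    (hbc : ∀ q, c ≤ b q) :
    ∃ τ σ : EuclideanSpace ℝ (Fin m) × ℝ → ℝ, ContDiff ℝ ∞ τ ∧ ContDiff ℝ ∞ σ ∧
      (∀ y z, σ (setCoord k y (τ (y, z)), z) = y k) ∧
      (∀ y z, τ (setCoord k y (σ (y, z)), z) = y k) ∧
      (∀ y z, ρ z * u y = 0 → τ (y, z) = y k) ∧
      (∀ y z, ρ z * u y = 0 → σ (y, z) = y k) ∧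
      (∀ y z, |τ (y, z) - y k| ≤ |ρ z * u y| / c) ∧
      ∀ y z, b (setCoord k y (τ (y, z)), z) *
        fderiv ℝ τ (y, z) (EuclideanSpace.single k 1, 0) = a (y, z) := by
  obtain ⟨A, hA⟩ := exists_isLinePrimitive k ha
  -- The primitives of a and b are chosen to differ exactly by ρu. This one choice gives both the
  -- displacement bound by |ρu| and the fixing of points where ρu = 0.
  have hB : IsLinePrimitive k b fun w => A w + ρ w.1.2 * u (setCoord k w.1.1 w.2) := by
    refine ⟨?_, ?_, ?_⟩
    · exact hA.contDiff.add ((hρ.comp (by fun_prop)).mul (hu.comp ((contDiff_setCoord k).comp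
        (by fun_prop : ContDiff ℝ ∞ fun w : (EuclideanSpace ℝ (Fin m) × ℝ) × ℝ => (w.1.1, w.2)))))
    · intro y z t
      rw [hb]
      have h1 := ((hu.differentiable (by simp)
        (setCoord k y t)).hasFDerivAt.comp_hasDerivAt t (hasDerivAt_setCoord k y t)).const_mul (ρ z)
      exact (hA.hasDerivAt y z t).add h1
    · intro y z s t
      simp [hA.setCoord]
  obtain ⟨τ, hτ, hτe, hτd⟩ := exists_line_transport hA hB hc hbc
  -- Exchanging the two densities produces the inverse move.
  obtain ⟨σ, hσ, hσe, -⟩ := exists_line_transport hB hA hc hac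
  have injA : ∀ q s t, A (q, s) = A (q, t) → s = t := by
    intro q s t h
    have := hA.mul_abs_sub_le hac q s t
    rw [h, sub_self, abs_zero] at this
    have h2 : |s - t| ≤ 0 := by
      by_contra h3
      exact absurd this (not_le.2 (mul_pos hc (not_le.1 h3)))
    exact sub_eq_zero.1 (abs_nonpos_iff.1 h2)
  have injB : ∀ q s t, A (q, s) + ρ q.2 * u (setCoord k q.1 s) =
      A (q, t) + ρ q.2 * u (setCoord k q.1 t) → s = t := by
    intro q s t h
    have := hB.mul_abs_sub_le hbc q s t
    simp only [h, sub_self, abs_zero] at this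
    have h2 : |s - t| ≤ 0 := by
      by_contra h3
      exact absurd this (not_le.2 (mul_pos hc (not_le.1 h3)))
    exact sub_eq_zero.1 (abs_nonpos_iff.1 h2)
  simp only at hτe hσe
  refine ⟨τ, σ, hτ, hσ, ?_, ?_, ?_, ?_, ?_, hτd⟩
  · intro y z
    refine injA (y, z) _ _ ?_
    have h1 := hσe (setCoord k y (τ (y, z)), z)
    have h2 := hτe (y, z)
    simp only [hA.setCoord, setCoord_setCoord, setCoord_same] at h1 h2
    rw [h1, h2]
  · intro y z
    refine injB (y, z) _ _ ?_
    have h1 := hτe (setCoord k y (σ (y, z)), z)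
    have h2 := hσe (y, z)
    simp only [hA.setCoord, setCoord_setCoord, setCoord_same] at h1 h2
    simp only
    rw [h1, h2]
  · intro y z h
    refine injB (y, z) _ _ ?_
    rw [hτe]
    simp [h]
  · intro y z h
    refine injA (y, z) _ _ ?_
    rw [hσe]
    simp [h]
  · intro y z
    rw [le_div_iff₀ hc, mul_comm]
    refine (hB.mul_abs_sub_le hbc (y, z) _ _).trans (le_of_eq ?_)
    have h1 := hτe (y, z)
    simp only [setCoord_self] at h1 ⊢
    rw [h1, sub_add_cancel_left, abs_neg]

end LineTransport

/-! ### Top-degree forms and determinants. -/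

section AlternatingForms

variable {E : Type*} [NormedAddCommGroup E] [NormedSpace ℝ E] {n : ℕ}

theorem compContinuousLinearMap_eq_det_smul (b : Module.Basis (Fin n) ℝ E)
    (α : E [⋀^Fin n]→L[ℝ] ℝ) (L : E →L[ℝ] E) :
    α.compContinuousLinearMap L = LinearMap.det (L : E →ₗ[ℝ] E) • α := by
  ext v
  have h : ∀ w : Fin n → E, α w = α b * b.det w := fun w => by
    have := congrArg (fun f => f w) (AlternatingMap.eq_smul_basis_det b α.toAlternatingMap)
    simpa using this
  have h2 := b.det_comp (L : E →ₗ[ℝ] E) v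
  have h3 : (⇑L ∘ v) = (⇑(L : E →ₗ[ℝ] E) ∘ v) := rfl
  have h4 : (LinearMap.det (L : E →ₗ[ℝ] E) • α) v = LinearMap.det (L : E →ₗ[ℝ] E) * α v := rfl
  rw [ContinuousAlternatingMap.compContinuousLinearMap_apply, h4, h, h v, h3, h2]
  ring

theorem eq_of_apply_basis_eq (b : Module.Basis (Fin n) ℝ E) {α β : E [⋀^Fin n]→L[ℝ] ℝ}
    (h : α b = β b) : α = β := by
  ext w
  have h' : ∀ α : E [⋀^Fin n]→L[ℝ] ℝ, α w = α b * b.det w := fun α => by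
    have := congrArg (fun f => f w) (AlternatingMap.eq_smul_basis_det b α.toAlternatingMap)
    simpa using this
  rw [h', h' β, h]

end AlternatingForms

/-! ### Forms in charts and pullbacks. -/

section Manifold

variable {E : Type*} [NormedAddCommGroup E] [NormedSpace ℝ E]
  {H : Type*} [TopologicalSpace H] {I : ModelWithCorners ℝ E H}
  {N : Type*} [TopologicalSpace N] [ChartedSpace H N] {n : ℕ}

theorem Form.eq_of_inChart_eq [IsManifold I 1 N] {α β : Form I N n} {c x : N}
    (hx : x ∈ (chartAt H c).source) (h : α.inChart c x = β.inChart c x) : α x = β x := by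
  ext v
  have hb : x ∈ (trivializationAt E (TangentSpace I : N → Type _) c).baseSet := by
    simpa using hx
  have h2 := congrArg (fun f => f fun i =>
    (trivializationAt E (TangentSpace I : N → Type _) c).continuousLinearMapAt ℝ x (v i)) h
  simp only [Form.inChart, ContinuousAlternatingMap.compContinuousLinearMap_apply] at h2
  have h3 : ((trivializationAt E (TangentSpace I : N → Type _) c).symmL ℝ x ∘ fun i =>
      (trivializationAt E (TangentSpace I : N → Type _) c).continuousLinearMapAt ℝ x (v i)) = v := by
    ext i
    exact (trivializationAt E (TangentSpace I : N → Type _) c).symmL_continuousLinearMapAt hb (v i)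
  rwa [h3] at h2

/-- The expression in a chart of the pullback of a form. -/
theorem Form.pullback_inChart [IsManifold I 1 N] (α : Form I N n) {f : N → N} {c x : N}
    (hx : x ∈ (chartAt H c).source) (hfx : f x ∈ (chartAt H c).source)
    (hf : MDifferentiableAt I I f x) {L : E →L[ℝ] E}
    (hL : HasFDerivWithinAt (extChartAt I c ∘ f ∘ (extChartAt I c).symm) L (range I)
      (extChartAt I c x)) :
    (α.pullback f).inChart c x = (α.inChart c (f x)).compContinuousLinearMap L := by
  have hxs : x ∈ (extChartAt I c).source := by rwa [extChartAt_source]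
  have hfs : f x ∈ (extChartAt I c).source := by rwa [extChartAt_source]
  set y := extChartAt I c x with hy
  have hyx : (extChartAt I c).symm y = x := (extChartAt I c).left_inv hxs
  have hyt : y ∈ (extChartAt I c).target := (extChartAt I c).map_source hxs
  have hyr : y ∈ range I := extChartAt_target_subset_range c hyt
  have hu : UniqueMDiffWithinAt 𝓘(ℝ, E) (range I) y :=
    (I.uniqueDiffOn y hyr).uniqueMDiffWithinAt
  have hs : MDifferentiableWithinAt 𝓘(ℝ, E) I (extChartAt I c).symm (range I) y :=
    mdifferentiableWithinAt_extChartAt_symm hyt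
  have h1 : mfderivWithin 𝓘(ℝ, E) I (f ∘ (extChartAt I c).symm) (range I) y =
      (mfderiv I I f x).comp (mfderivWithin 𝓘(ℝ, E) I (extChartAt I c).symm (range I) y) := by
    have hf' : MDifferentiableAt I I f ((extChartAt I c).symm y) := by rwa [hyx]
    have := mfderiv_comp_mfderivWithin (I := 𝓘(ℝ, E)) (I' := I) (I'' := I) y hf' hs hu
    have aux : ∀ x', x' = x → (mfderiv I I f x' : E →L[ℝ] E) = mfderiv I I f x := by
      rintro _ rfl; rfl
    rw [this]
    exact congrArg (fun A : E →L[ℝ] E => A.comp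
      (mfderivWithin 𝓘(ℝ, E) I (extChartAt I c).symm (range I) y : E →L[ℝ] E)) (aux _ hyx)
  set F := extChartAt I c ∘ f ∘ (extChartAt I c).symm with hF
  have hFy : F y = extChartAt I c (f x) := by
    simp only [hF, Function.comp_apply, hyx]
  have h2 : mfderivWithin 𝓘(ℝ, E) I ((extChartAt I c).symm ∘ F) (range I) y =
      (mfderivWithin 𝓘(ℝ, E) I (extChartAt I c).symm (range I) (F y)).comp
        (mfderivWithin 𝓘(ℝ, E) 𝓘(ℝ, E) F (range I) y) := by
    refine mfderivWithin_comp y ?_ hL.differentiableWithinAt.mdifferentiableWithinAt ?_ hu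
    · refine mdifferentiableWithinAt_extChartAt_symm ?_
      rw [hFy]
      exact (extChartAt I c).map_source hfs
    · intro w _
      exact ⟨chartAt H c (f ((extChartAt I c).symm w)), rfl⟩
  -- Near y both maps are f ∘ φ⁻¹, so its derivative has two factorizations. They say that df maps
  -- the coordinate frame at x to the coordinate frame at f x applied to L.
  have h3 : mfderivWithin 𝓘(ℝ, E) I ((extChartAt I c).symm ∘ F) (range I) y =
      mfderivWithin 𝓘(ℝ, E) I (f ∘ (extChartAt I c).symm) (range I) y := by
    have hc : ContinuousWithinAt (f ∘ (extChartAt I c).symm) (range I) y :=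
      ContinuousAt.comp_continuousWithinAt (by rw [hyx]; exact hf.continuousAt)
        hs.continuousWithinAt
    have hmem : (extChartAt I c).source ∈ 𝓝 ((f ∘ (extChartAt I c).symm) y) := by
      simp only [Function.comp_apply, hyx]
      exact extChartAt_source_mem_nhds' hfs
    have hev : ((extChartAt I c).symm ∘ F) =ᶠ[𝓝[range I] y] f ∘ (extChartAt I c).symm := by
      filter_upwards [hc.preimage_mem_nhdsWithin hmem] with w hw
      exact (extChartAt I c).left_inv hw
    exact hev.mfderivWithin_eq (hev.eq_of_nhdsWithin hyr)
  have h4 : mfderivWithin 𝓘(ℝ, E) 𝓘(ℝ, E) F (range I) y = L := by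
    rw [mfderivWithin_eq_fderivWithin]
    exact hL.fderivWithin (I.uniqueDiffOn y hyr)
  rw [h1, h2, h4] at h3
  ext v
  simp only [Form.inChart, Form.pullback, ContinuousAlternatingMap.compContinuousLinearMap_apply]
  congr 1
  ext i
  simp only [Function.comp_apply]
  rw [TangentBundle.symmL_trivializationAt hx, TangentBundle.symmL_trivializationAt hfx, ← hy,
    ← hFy]
  exact (congrArg (fun A => A (v i)) h3).symm

/-- The change of a form between two charts. -/
theorem Form.inChart_eq_inChart_comp [IsManifold I 1 N] (α : Form I N n) {c d x : N}
    (hx : x ∈ (chartAt H c).source) (hx' : x ∈ (chartAt H d).source) :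
    α.inChart c x = (α.inChart d x).compContinuousLinearMap
      (fderivWithin ℝ (extChartAt I d ∘ (extChartAt I c).symm) (range I) (extChartAt I c x)) := by
  have h : ∀ v, (trivializationAt E (TangentSpace I : N → Type _) c).symmL ℝ x v =
      (trivializationAt E (TangentSpace I : N → Type _) d).symmL ℝ x
        (fderivWithin ℝ (extChartAt I d ∘ (extChartAt I c).symm) (range I) (extChartAt I c x) v) := by
    intro v
    rw [TangentBundle.symmL_trivializationAt_eq_core hx,
      TangentBundle.symmL_trivializationAt_eq_core hx']
    have := (tangentBundleCore I N).coordChange_comp (achart H c) (achart H d) (achart H x) x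
      ⟨⟨hx, hx'⟩, mem_chart_source H x⟩ v
    exact this.symm
  ext v
  simp only [Form.inChart, ContinuousAlternatingMap.compContinuousLinearMap_apply]
  congr 1
  ext i
  exact h (v i)

theorem Form.pullback_comp {α : Form I N n} {f g : N → N} (hf : MDifferentiable I I f)
    (hg : MDifferentiable I I g) : α.pullback (g ∘ f) = (α.pullback g).pullback f := by
  ext x v
  simp only [Form.pullback, ContinuousAlternatingMap.compContinuousLinearMap_apply]
  rw [mfderiv_comp x (hg (f x)) (hf x)]
  rfl

theorem Form.pullback_apply_of_eventuallyEq_id {α : Form I N n} {f : N → N} {x : N}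
    (hf : f =ᶠ[𝓝 x] id) : α.pullback f x = α x := by
  have h : mfderiv I I f x = mfderiv I I (id : N → N) x := hf.mfderiv_eq
  have hx : f x = x := hf.eq_of_nhds
  have h2 : (mfderiv I I f x : E →L[ℝ] E) = ContinuousLinearMap.id ℝ E := h.trans mfderiv_id
  have aux : ∀ x', x' = x → (α x' : E [⋀^Fin n]→L[ℝ] ℝ) = α x := by
    rintro _ rfl; rfl
  change (α (f x) : E [⋀^Fin n]→L[ℝ] ℝ).compContinuousLinearMap (mfderiv I I f x : E →L[ℝ] E) = _
  rw [h2, aux _ hx]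
  rfl

end Manifold

/-! ### The charts of [-1, 1]. -/

section CylinderCharts

theorem neg_one_le_one_real : (-1 : ℝ) ≤ 1 := by norm_num

/-- The charts of `[-1, 1]` are affine with slope `±1`. -/
theorem extChartAt_Icc_spec (e : Icc (-1 : ℝ) 1) : ∃ ε z₀ : ℝ, ε * ε = 1 ∧
    (∀ z : Icc (-1 : ℝ) 1, extChartAt (𝓡∂ 1) e z = WithLp.toLp 2 fun _ => ε * ((z : ℝ) - z₀)) ∧
    ∀ v, (extChartAt (𝓡∂ 1) e).symm v = projIcc (-1) 1 neg_one_le_one_real (z₀ + ε * v 0) := by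
  by_cases h : (e : ℝ) < 1
  · refine ⟨1, -1, by norm_num, fun z => ?_, fun v => ?_⟩
    · simp only [extChartAt, Icc_chartedSpaceChartAt_of_le_top h]
      ext i
      rw [Subsingleton.elim i 0]
      simp [IccLeftChart, modelWithCornersEuclideanHalfSpace]
    · simp only [extChartAt, Icc_chartedSpaceChartAt_of_le_top h]
      ext
      simp [IccLeftChart_symm_apply, modelWithCornersEuclideanHalfSpace, coe_projIcc]
      grind
  · refine ⟨-1, 1, by norm_num, fun z => ?_, fun v => ?_⟩
    · simp only [extChartAt, Icc_chartedSpaceChartAt_of_top_le (not_lt.1 h)]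
      ext i
      rw [Subsingleton.elim i 0]
      simp [IccRightChart, modelWithCornersEuclideanHalfSpace]
    · simp only [extChartAt, Icc_chartedSpaceChartAt_of_top_le (not_lt.1 h)]
      ext
      simp [IccRightChart_symm_apply, modelWithCornersEuclideanHalfSpace, coe_projIcc]
      grind

/-- The end point `1` of `[-1, 1]`. -/
def endPt : Icc (-1 : ℝ) 1 := ⟨1, by norm_num⟩

/-- The height chart centred at the upper end covers (-1, 1]. It is the only one needed to check the
transport maps, since these are the identity at heights z ≤ 0. -/
theorem extChartAt_top_apply (z : Icc (-1 : ℝ) 1) :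
    extChartAt (𝓡∂ 1) endPt z = WithLp.toLp 2 fun _ => 1 - (z : ℝ) := by
  simp only [extChartAt, Icc_chartedSpaceChartAt_of_top_le (z := endPt) (by simp [endPt])]
  ext i
  rw [Subsingleton.elim i 0]
  simp [IccRightChart, modelWithCornersEuclideanHalfSpace]

theorem extChartAt_top_symm_apply (v : EuclideanSpace ℝ (Fin 1)) :
    (extChartAt (𝓡∂ 1) endPt).symm v =
      projIcc (-1) 1 neg_one_le_one_real (1 - v 0) := by
  simp only [extChartAt, Icc_chartedSpaceChartAt_of_top_le (z := endPt) (by simp [endPt])]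
  ext
  simp [IccRightChart_symm_apply, modelWithCornersEuclideanHalfSpace, coe_projIcc]
  grind

theorem chartAt_top_source : (chartAt (EuclideanHalfSpace 1) endPt).source =
    {z : Icc (-1 : ℝ) 1 | -1 < (z : ℝ)} := by
  rw [Icc_chartedSpaceChartAt_of_top_le (z := endPt) (by simp [endPt])]
  rfl

theorem extChartAt_top_target : (extChartAt (𝓡∂ 1) endPt).target =
    {v | 0 ≤ v 0 ∧ v 0 < 2} := by
  ext v
  simp only [extChartAt, Icc_chartedSpaceChartAt_of_top_le (z := endPt) (by simp [endPt])]
  simp only [OpenPartialHomeomorph.extend_target, mem_inter_iff, mem_preimage,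
    range_modelWithCornersEuclideanHalfSpace, mem_ofPred_eq]
  simp [IccRightChart, modelWithCornersEuclideanHalfSpace]
  constructor
  · rintro ⟨h1, h2⟩
    exact ⟨h2, by linarith⟩
  · rintro ⟨h1, h2⟩
    exact ⟨by linarith, h1⟩

end CylinderCharts

/-! ### The wedge product evaluated on the standard basis. -/

section Wedge

variable {m : ℕ}

theorem cylBasis_castSucc (i : Fin m) :
    cylBasis m i.castSucc = (EuclideanSpace.single i (1 : ℝ), 0) := by
  have : finSumFinEquiv.symm (i.castSucc : Fin (m + 1)) = Sum.inl i := by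
    rw [Equiv.symm_apply_eq]; rfl
  simp [cylBasis, this]

theorem cylBasis_last :
    cylBasis m (Fin.last m) = (0, EuclideanSpace.single 0 (1 : ℝ)) := by
  have : finSumFinEquiv.symm (Fin.last m : Fin (m + 1)) = Sum.inr 0 := by
    rw [Equiv.symm_apply_eq]; rfl
  simp [cylBasis, this]

/-- The last coordinate on the model space of the cylinder. -/
def lastCoord (m : ℕ) : EuclideanSpace ℝ (Fin m) × EuclideanSpace ℝ (Fin 1) →L[ℝ] ℝ :=
  (EuclideanSpace.proj 0 : EuclideanSpace ℝ (Fin 1) →L[ℝ] ℝ).comp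
    (ContinuousLinearMap.snd ℝ _ _)

@[simp] theorem lastCoord_apply (v : EuclideanSpace ℝ (Fin m) × EuclideanSpace ℝ (Fin 1)) :
    lastCoord m v = v.2 0 := rfl

/-- Only the term in which the height covector meets the last basis vector survives. Its sign (-1)^m
cancels the sign in the definition of `wedgeOne`. -/
theorem wedgeOne_cylBasis (α : EuclideanSpace ℝ (Fin m) [⋀^Fin m]→L[ℝ] ℝ) (ε : ℝ) :
    wedgeOne (α.compContinuousLinearMap
      (ContinuousLinearMap.fst ℝ (EuclideanSpace ℝ (Fin m)) (EuclideanSpace ℝ (Fin 1))))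
      (ε • lastCoord m) (cylBasis m) = ε * α (fun i => EuclideanSpace.single i (1 : ℝ)) := by
  have h : ∀ β : (EuclideanSpace ℝ (Fin m) × EuclideanSpace ℝ (Fin 1)) [⋀^Fin (m + 1)]→L[ℝ] ℝ,
      ((-1 : ℝ) ^ m • β) (cylBasis m) = (-1) ^ m * β (cylBasis m) := fun β => rfl
  rw [wedgeOne, h, ContinuousAlternatingMap.alternatizeUncurryFin_apply, Finset.sum_eq_single
    (Fin.last m)]
  · have h2 : (Fin.last m).removeNth (cylBasis m : Fin (m + 1) → _) =
        fun i => ((EuclideanSpace.single i (1 : ℝ), 0) :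
          EuclideanSpace ℝ (Fin m) × EuclideanSpace ℝ (Fin 1)) := by
      ext1 i
      rw [Fin.removeNth_apply, Fin.succAbove_last, cylBasis_castSucc]
    rw [h2, cylBasis_last, ContinuousLinearMap.smulRight_apply]
    have h3 : (-1 : ℝ) ^ m * (-1) ^ m = 1 := by rw [← mul_pow]; simp
    have h4 : ((ε • lastCoord m) ((0 : EuclideanSpace ℝ (Fin m)),
        EuclideanSpace.single (0 : Fin 1) (1 : ℝ))) = ε := by
      simp
    rw [h4]
    simp only [Fin.val_last]
    change (-1 : ℝ) ^ m * ((-1 : ℤ) ^ m • (ε * α fun i => EuclideanSpace.single i (1 : ℝ))) = _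
    rw [zsmul_eq_mul]
    push_cast
    rw [← mul_assoc, h3, one_mul]
  · intro i _ hi
    obtain ⟨j, rfl⟩ := Fin.exists_castSucc_eq.2 hi
    rw [cylBasis_castSucc, ContinuousLinearMap.smulRight_apply]
    have h4 : ((ε • lastCoord m) (EuclideanSpace.single j (1 : ℝ), 0)) = 0 := by simp
    rw [h4]
    simp
  · simp

end Wedge

/-! ### The form ω' ∧ dz in the charts of the cylinder. -/

section WedgeDz

variable {m : ℕ} {M : Type*} [TopologicalSpace M] [ChartedSpace (EuclideanSpace ℝ (Fin m)) M]

theorem mem_cyl_chart_source {d p : Cyl M} :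
    p ∈ (chartAt (ModelProd (EuclideanSpace ℝ (Fin m)) (EuclideanHalfSpace 1)) d).source ↔
      p.1 ∈ (chartAt (EuclideanSpace ℝ (Fin m)) d.1).source ∧
      p.2 ∈ (chartAt (EuclideanHalfSpace 1) d.2).source := by
  rw [prodChartedSpace_chartAt, OpenPartialHomeomorph.prod_source, mem_prod]

variable [IsManifold (𝓡 m) ∞ M]

theorem mfderiv_fst_symmL {d p : Cyl M}
    (hp : p ∈ (chartAt (ModelProd (EuclideanSpace ℝ (Fin m)) (EuclideanHalfSpace 1)) d).source)
    (v : EuclideanSpace ℝ (Fin m) × EuclideanSpace ℝ (Fin 1)) :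
    (mfderiv (cylModel m) (𝓡 m) (Prod.fst : Cyl M → M) p
      ((trivializationAt (EuclideanSpace ℝ (Fin m) × EuclideanSpace ℝ (Fin 1))
        (TangentSpace (cylModel m) : Cyl M → Type _) d).symmL ℝ p v) : EuclideanSpace ℝ (Fin m)) =
      (trivializationAt (EuclideanSpace ℝ (Fin m)) (TangentSpace (𝓡 m) : M → Type _) d.1).symmL ℝ
        p.1 v.1 := by
  have hp1 := (mem_cyl_chart_source.1 hp).1
  have hps : p ∈ (extChartAt (cylModel m) d).source := by rwa [extChartAt_source]
  rw [TangentBundle.symmL_trivializationAt hp, TangentBundle.symmL_trivializationAt hp1]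
  set y := extChartAt (cylModel m) d p with hy
  have hyx : (extChartAt (cylModel m) d).symm y = p := (extChartAt (cylModel m) d).left_inv hps
  have hyt : y ∈ (extChartAt (cylModel m) d).target := (extChartAt (cylModel m) d).map_source hps
  have hyr : y ∈ range (cylModel m) := extChartAt_target_subset_range d hyt
  have hu : UniqueMDiffWithinAt 𝓘(ℝ, EuclideanSpace ℝ (Fin m) × EuclideanSpace ℝ (Fin 1))
      (range (cylModel m)) y := ((cylModel m).uniqueDiffOn y hyr).uniqueMDiffWithinAt
  have hs := mdifferentiableWithinAt_extChartAt_symm (I := cylModel m) hyt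
  have hy1 : y.1 = extChartAt (𝓡 m) d.1 p.1 := by
    rw [hy, extChartAt_prod]; rfl
  have h1 := mfderiv_comp_mfderivWithin
    (I := 𝓘(ℝ, EuclideanSpace ℝ (Fin m) × EuclideanSpace ℝ (Fin 1)))
    (I' := cylModel m) (I'' := 𝓡 m) (g := (Prod.fst : Cyl M → M)) y mdifferentiableAt_fst hs hu
  have e : (Prod.fst : Cyl M → M) ∘ (extChartAt (cylModel m) d).symm =
      (extChartAt (𝓡 m) d.1).symm ∘ Prod.fst := by
    ext w
    rw [extChartAt_prod]; rfl
  have hs1 : MDifferentiableWithinAt (𝓡 m) (𝓡 m) (extChartAt (𝓡 m) d.1).symm (range (𝓡 m)) y.1 := by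
    refine mdifferentiableWithinAt_extChartAt_symm ?_
    rw [hy1]
    exact (extChartAt (𝓡 m) d.1).map_source (by rwa [extChartAt_source])
  have hfst : HasFDerivWithinAt (Prod.fst : EuclideanSpace ℝ (Fin m) × EuclideanSpace ℝ (Fin 1) → _)
    (ContinuousLinearMap.fst ℝ _ _) (range (cylModel m)) y := hasFDerivWithinAt_fst
  have h2 := mfderivWithin_comp (I := 𝓘(ℝ, EuclideanSpace ℝ (Fin m) × EuclideanSpace ℝ (Fin 1)))
    (I' := 𝓡 m) (I'' := 𝓡 m) y (g := (extChartAt (𝓡 m) d.1).symm) (u := range (𝓡 m)) hs1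
    hfst.differentiableWithinAt.mdifferentiableWithinAt (fun w _ => by simp) hu
  have h3 : (mfderivWithin 𝓘(ℝ, EuclideanSpace ℝ (Fin m) × EuclideanSpace ℝ (Fin 1)) (𝓡 m)
      (Prod.fst : EuclideanSpace ℝ (Fin m) × EuclideanSpace ℝ (Fin 1) → _)
      (range (cylModel m)) y : EuclideanSpace ℝ (Fin m) × EuclideanSpace ℝ (Fin 1) →L[ℝ]
        EuclideanSpace ℝ (Fin m)) =
      ContinuousLinearMap.fst ℝ (EuclideanSpace ℝ (Fin m)) (EuclideanSpace ℝ (Fin 1)) := by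
    have := mfderivWithin_eq_fderivWithin (𝕜 := ℝ) (f := (Prod.fst : EuclideanSpace ℝ (Fin m) ×
      EuclideanSpace ℝ (Fin 1) → _)) (s := range (cylModel m)) (x := y)
    exact this.trans (hfst.fderivWithin ((cylModel m).uniqueDiffOn y hyr))
  have aux : ∀ x', x' = p → (mfderiv (cylModel m) (𝓡 m) (Prod.fst : Cyl M → M) x' :
      EuclideanSpace ℝ (Fin m) × EuclideanSpace ℝ (Fin 1) →L[ℝ] EuclideanSpace ℝ (Fin m)) =
      mfderiv (cylModel m) (𝓡 m) (Prod.fst : Cyl M → M) p := by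
    rintro _ rfl; rfl
  have aux2 : ∀ w, w = y.1 → (mfderivWithin (𝓡 m) (𝓡 m) (extChartAt (𝓡 m) d.1).symm (range (𝓡 m))
      w : EuclideanSpace ℝ (Fin m) →L[ℝ] EuclideanSpace ℝ (Fin m)) =
      mfderivWithin (𝓡 m) (𝓡 m) (extChartAt (𝓡 m) d.1).symm (range (𝓡 m)) y.1 := by
    rintro _ rfl; rfl
  rw [e, h2] at h1
  have h4 := congrArg (fun A : EuclideanSpace ℝ (Fin m) × EuclideanSpace ℝ (Fin 1) →L[ℝ]
    EuclideanSpace ℝ (Fin m) => A v) h1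
  have h5 := congrArg (fun A : EuclideanSpace ℝ (Fin m) × EuclideanSpace ℝ (Fin 1) →L[ℝ]
    EuclideanSpace ℝ (Fin m) => A v) h3
  have h6 := aux _ hyx
  have h7 := aux2 _ hy1.symm
  exact ((congrArg (fun A : EuclideanSpace ℝ (Fin m) × EuclideanSpace ℝ (Fin 1) →L[ℝ]
    EuclideanSpace ℝ (Fin m) => A (mfderivWithin
      𝓘(ℝ, EuclideanSpace ℝ (Fin m) × EuclideanSpace ℝ (Fin 1)) (cylModel m)
      (extChartAt (cylModel m) d).symm (range (cylModel m)) y v)) h6).symm.trans h4.symm).trans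
    ((congrArg (fun w => (mfderivWithin (𝓡 m) (𝓡 m) (extChartAt (𝓡 m) d.1).symm (range (𝓡 m)) y.1 :
      EuclideanSpace ℝ (Fin m) →L[ℝ] EuclideanSpace ℝ (Fin m)) w) h5).trans
      (congrArg (fun A : EuclideanSpace ℝ (Fin m) →L[ℝ] EuclideanSpace ℝ (Fin m) => A v.1) h7.symm))

theorem mfderiv_coord_symmL {d p : Cyl M} {ε z₀ : ℝ}
    (hφ : ∀ z : Icc (-1 : ℝ) 1,
      extChartAt (𝓡∂ 1) d.2 z = WithLp.toLp 2 fun _ => ε * ((z : ℝ) - z₀)) (hε : ε * ε = 1)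
    (hp : p ∈ (chartAt (ModelProd (EuclideanSpace ℝ (Fin m)) (EuclideanHalfSpace 1)) d).source)
    (v : EuclideanSpace ℝ (Fin m) × EuclideanSpace ℝ (Fin 1)) :
    (mfderiv (cylModel m) 𝓘(ℝ, ℝ) (fun q : Cyl M => (q.2 : ℝ)) p
      ((trivializationAt (EuclideanSpace ℝ (Fin m) × EuclideanSpace ℝ (Fin 1))
        (TangentSpace (cylModel m) : Cyl M → Type _) d).symmL ℝ p v) : ℝ) = ε * v.2 0 := by
  have hps : p ∈ (extChartAt (cylModel m) d).source := by rwa [extChartAt_source]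
  rw [TangentBundle.symmL_trivializationAt hp]
  set y := extChartAt (cylModel m) d p with hy
  have hyx : (extChartAt (cylModel m) d).symm y = p := (extChartAt (cylModel m) d).left_inv hps
  have hyt : y ∈ (extChartAt (cylModel m) d).target := (extChartAt (cylModel m) d).map_source hps
  have hyr : y ∈ range (cylModel m) := extChartAt_target_subset_range d hyt
  have hu : UniqueMDiffWithinAt 𝓘(ℝ, EuclideanSpace ℝ (Fin m) × EuclideanSpace ℝ (Fin 1))
      (range (cylModel m)) y := ((cylModel m).uniqueDiffOn y hyr).uniqueMDiffWithinAt
  have hs := mdifferentiableWithinAt_extChartAt_symm (I := cylModel m) hyt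
  have hz : MDifferentiable (cylModel m) 𝓘(ℝ, ℝ) (fun q : Cyl M => (q.2 : ℝ)) :=
    ((contMDiff_subtypeVal_Icc (n := 1)).comp contMDiff_snd).mdifferentiable one_ne_zero
  have h1 := mfderiv_comp_mfderivWithin
    (I := 𝓘(ℝ, EuclideanSpace ℝ (Fin m) × EuclideanSpace ℝ (Fin 1)))
    (I' := cylModel m) (I'' := 𝓘(ℝ, ℝ)) (g := fun q : Cyl M => (q.2 : ℝ)) y (hz _) hs hu
  have hd : HasFDerivWithinAt (fun w : EuclideanSpace ℝ (Fin m) × EuclideanSpace ℝ (Fin 1) =>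
      z₀ + (ε • lastCoord m) w) (ε • lastCoord m) (range (cylModel m)) y :=
    ((ε • lastCoord m).hasFDerivAt.const_add z₀).hasFDerivWithinAt
  have hev : (fun q : Cyl M => (q.2 : ℝ)) ∘ (extChartAt (cylModel m) d).symm
      =ᶠ[𝓝[range (cylModel m)] y] fun w => z₀ + (ε • lastCoord m) w := by
    filter_upwards [extChartAt_target_mem_nhdsWithin' hps] with w hw
    have h5 := (extChartAt (cylModel m) d).right_inv hw
    have h6 : w.2 0 = ε * ((((extChartAt (cylModel m) d).symm w).2 : ℝ) - z₀) := by
      have h7 : (extChartAt (cylModel m) d ((extChartAt (cylModel m) d).symm w)).2 =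
        extChartAt (𝓡∂ 1) d.2 ((extChartAt (cylModel m) d).symm w).2 := by
          rw [extChartAt_prod]; rfl
      rw [h5, hφ] at h7
      rw [h7]
    simp only [Function.comp_apply]
    have h8 : (ε • lastCoord m) w = ε * w.2 0 := rfl
    rw [h8, h6, ← mul_assoc, hε]
    ring
  have h2 : (mfderivWithin 𝓘(ℝ, EuclideanSpace ℝ (Fin m) × EuclideanSpace ℝ (Fin 1)) 𝓘(ℝ, ℝ)
      ((fun q : Cyl M => (q.2 : ℝ)) ∘ (extChartAt (cylModel m) d).symm)
      (range (cylModel m)) y : EuclideanSpace ℝ (Fin m) × EuclideanSpace ℝ (Fin 1) →L[ℝ] ℝ) =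
      ε • lastCoord m := by
    have := mfderivWithin_eq_fderivWithin (𝕜 := ℝ) (f := (fun q : Cyl M => (q.2 : ℝ)) ∘
      (extChartAt (cylModel m) d).symm) (s := range (cylModel m)) (x := y)
    exact this.trans ((hd.congr_of_eventuallyEq hev (hev.eq_of_nhdsWithin hyr)).fderivWithin
      ((cylModel m).uniqueDiffOn y hyr))
  have aux : ∀ x', x' = p → (mfderiv (cylModel m) 𝓘(ℝ, ℝ) (fun q : Cyl M => (q.2 : ℝ)) x' :
      EuclideanSpace ℝ (Fin m) × EuclideanSpace ℝ (Fin 1) →L[ℝ] ℝ) =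
      mfderiv (cylModel m) 𝓘(ℝ, ℝ) (fun q : Cyl M => (q.2 : ℝ)) p := by
    rintro _ rfl; rfl
  have h4 := congrArg (fun A : EuclideanSpace ℝ (Fin m) × EuclideanSpace ℝ (Fin 1) →L[ℝ]
    ℝ => A v) (h1.symm.trans h2)
  exact (congrArg (fun A : EuclideanSpace ℝ (Fin m) × EuclideanSpace ℝ (Fin 1) →L[ℝ]
    ℝ => A (mfderivWithin
      𝓘(ℝ, EuclideanSpace ℝ (Fin m) × EuclideanSpace ℝ (Fin 1)) (cylModel m)
      (extChartAt (cylModel m) d).symm (range (cylModel m)) y v)) (aux _ hyx)).symm.trans h4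

/-- The expression of `ω' ∧ dz` in a chart of the cylinder. -/
theorem wedgeDz_inChart (ω' : Form (𝓡 m) M m) {d p : Cyl M} {ε z₀ : ℝ}
    (hφ : ∀ z : Icc (-1 : ℝ) 1,
      extChartAt (𝓡∂ 1) d.2 z = WithLp.toLp 2 fun _ => ε * ((z : ℝ) - z₀)) (hε : ε * ε = 1)
    (hp : p ∈ (chartAt (ModelProd (EuclideanSpace ℝ (Fin m)) (EuclideanHalfSpace 1)) d).source) :
    (wedgeDz ω').inChart d p = wedgeOne ((ω'.inChart d.1 p.1).compContinuousLinearMap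
      (ContinuousLinearMap.fst ℝ (EuclideanSpace ℝ (Fin m)) (EuclideanSpace ℝ (Fin 1))))
      (ε • lastCoord m) := by
  ext v
  have h : ∀ (β : (EuclideanSpace ℝ (Fin m) × EuclideanSpace ℝ (Fin 1)) [⋀^Fin (m + 1)]→L[ℝ] ℝ) w,
      ((-1 : ℝ) ^ m • β) w = (-1) ^ m * β w := fun β w => rfl
  rw [wedgeOne, h, ContinuousAlternatingMap.alternatizeUncurryFin_apply]
  let B : EuclideanSpace ℝ (Fin m) × EuclideanSpace ℝ (Fin 1) →L[ℝ] ℝ :=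
    mfderiv (cylModel m) 𝓘(ℝ, ℝ) (fun q : Cyl M => (q.2 : ℝ)) p
  let A : EuclideanSpace ℝ (Fin m) × EuclideanSpace ℝ (Fin 1) →L[ℝ] EuclideanSpace ℝ (Fin m) :=
    mfderiv (cylModel m) (𝓡 m) (Prod.fst : Cyl M → M) p
  let S : EuclideanSpace ℝ (Fin m) × EuclideanSpace ℝ (Fin 1) →L[ℝ]
      EuclideanSpace ℝ (Fin m) × EuclideanSpace ℝ (Fin 1) :=
    (trivializationAt (EuclideanSpace ℝ (Fin m) × EuclideanSpace ℝ (Fin 1))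
      (TangentSpace (cylModel m) : Cyl M → Type _) d).symmL ℝ p
  let α : EuclideanSpace ℝ (Fin m) [⋀^Fin m]→L[ℝ] ℝ := ω' p.1
  have h2 : (wedgeDz ω').inChart d p v = (-1) ^ m *
      ContinuousAlternatingMap.alternatizeUncurryFin
      (B.smulRight (α.compContinuousLinearMap A)) (fun i => S (v i)) := rfl
  rw [h2, ContinuousAlternatingMap.alternatizeUncurryFin_apply]
  congr 1
  refine Finset.sum_congr rfl fun i _ => ?_
  congr 1
  have e1 := mfderiv_coord_symmL hφ hε hp (v i)
  have e2 : ∀ j, _ := fun j => mfderiv_fst_symmL hp (v j)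
  refine congrArg₂ (fun a b : ℝ => a * b) e1 ?_
  refine congrArg (fun w => (ω' p.1 : EuclideanSpace ℝ (Fin m) [⋀^Fin m]→L[ℝ] ℝ) w) ?_
  funext j
  exact e2 (i.succAbove j)

theorem wedgeDz_inChart_cylBasis (ω' : Form (𝓡 m) M m) {d p : Cyl M} {ε z₀ : ℝ}
    (hφ : ∀ z : Icc (-1 : ℝ) 1,
      extChartAt (𝓡∂ 1) d.2 z = WithLp.toLp 2 fun _ => ε * ((z : ℝ) - z₀)) (hε : ε * ε = 1)
    (hp : p ∈ (chartAt (ModelProd (EuclideanSpace ℝ (Fin m)) (EuclideanHalfSpace 1)) d).source) :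
    (wedgeDz ω').inChart d p (cylBasis m) =
      ε * ω'.inChart d.1 p.1 (fun i => EuclideanSpace.single i (1 : ℝ)) := by
  rw [wedgeDz_inChart ω' hφ hε hp, wedgeOne_cylBasis]

end WedgeDz

/-! ### Coefficients and the Jacobian equation. -/

section Coefficient

variable {m : ℕ} {M : Type*} [TopologicalSpace M] [ChartedSpace (EuclideanSpace ℝ (Fin m)) M]
  [IsManifold (𝓡 m) ∞ M]

/-- The coefficient of a top-degree form on `M` in the chart at `c`. -/
def coeff (ω' : Form (𝓡 m) M m) (c x : M) : ℝ :=
  ω'.inChart c x (fun i => EuclideanSpace.single i (1 : ℝ))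

theorem coeff_ne_zero {ω' : Form (𝓡 m) M m} (hω' : ω'.IsVolumeForm) {c x : M}
    (hx : x ∈ (chartAt (EuclideanSpace ℝ (Fin m)) c).source) : coeff ω' c x ≠ 0 := by
  intro h
  refine hω'.ne_zero x ?_
  refine Form.eq_of_inChart_eq (β := fun _ => 0) hx ?_
  refine eq_of_apply_basis_eq (EuclideanSpace.basisFun (Fin m) ℝ).toBasis ?_
  have h1 : (⇑(EuclideanSpace.basisFun (Fin m) ℝ).toBasis : Fin m → EuclideanSpace ℝ (Fin m)) =
      fun i => EuclideanSpace.single i (1 : ℝ) := by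
    ext1 i; simp
  rw [h1]
  exact h

theorem contMDiffOn_coeff {ω' : Form (𝓡 m) M m} (hω' : ω'.IsVolumeForm) (c : M) :
    ContMDiffOn (𝓡 m) 𝓘(ℝ, ℝ) ∞ (coeff ω' c) (chartAt (EuclideanSpace ℝ (Fin m)) c).source := by
  have h := hω'.smooth c
  exact (ContinuousAlternatingMap.apply ℝ (EuclideanSpace ℝ (Fin m)) ℝ
    (fun i => EuclideanSpace.single i (1 : ℝ))).contMDiff.comp_contMDiffOn h

theorem contDiffOn_coeff_symm {ω' : Form (𝓡 m) M m} (hω' : ω'.IsVolumeForm) (c : M) :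
    ContDiffOn ℝ ∞ (fun y => coeff ω' c ((extChartAt (𝓡 m) c).symm y))
      (extChartAt (𝓡 m) c).target := by
  rw [← contMDiffOn_iff_contDiffOn]
  refine (contMDiffOn_coeff hω' c).comp (contMDiffOn_extChartAt_symm c) ?_
  intro y hy
  rw [← extChartAt_source (𝓡 m)]
  exact (extChartAt (𝓡 m) c).map_target hy

/-- The sign appears because the height coordinate of this chart is 1 - z. -/
theorem wedgeDz_inChart_endPt (ω' : Form (𝓡 m) M m) {c : M} {p : Cyl M}
    (hp1 : p.1 ∈ (chartAt (EuclideanSpace ℝ (Fin m)) c).source) (hp2 : -1 < (p.2 : ℝ)) :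
    (wedgeDz ω').inChart (c, endPt) p (cylBasis m) = - coeff ω' c p.1 := by
  rw [wedgeDz_inChart_cylBasis (ε := -1) (z₀ := 1)]
  · simp [coeff]
  · intro z
    rw [extChartAt_top_apply]
    congr 1
    ext1 i
    ring
  · norm_num
  · rw [mem_cyl_chart_source]
    refine ⟨hp1, ?_⟩
    rw [chartAt_top_source]
    exact hp2

/-- The Jacobian criterion for a map of the cylinder to pull one multiple of `ω' ∧ dz` back to
another. -/
theorem pullback_smul_wedgeDz_of_transvection (ω' : Form (𝓡 m) M m) {a b : Cyl M → ℝ}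
    {f : Cyl M → Cyl M} {c : M} {p : Cyl M}
    (hp1 : p.1 ∈ (chartAt (EuclideanSpace ℝ (Fin m)) c).source) (hp2 : -1 < (p.2 : ℝ))
    (hf1 : (f p).1 ∈ (chartAt (EuclideanSpace ℝ (Fin m)) c).source) (hf2 : -1 < ((f p).2 : ℝ))
    (hf : MDifferentiableAt (cylModel m) (cylModel m) f p)
    {ℓ : EuclideanSpace ℝ (Fin m) × EuclideanSpace ℝ (Fin 1) →L[ℝ] ℝ}
    {v : EuclideanSpace ℝ (Fin m) × EuclideanSpace ℝ (Fin 1)}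
    (hL : HasFDerivWithinAt (extChartAt (cylModel m) (c, endPt) ∘ f ∘
      (extChartAt (cylModel m) (c, endPt)).symm) (ContinuousLinearMap.id ℝ _ + ℓ.smulRight v)
      (range (cylModel m)) (extChartAt (cylModel m) (c, endPt) p))
    (hab : b (f p) * coeff ω' c (f p).1 * (1 + ℓ v) = a p * coeff ω' c p.1) :
    Form.pullback f (fun q => b q • wedgeDz ω' q) p = a p • wedgeDz ω' p := by
  have hpd : p ∈ (chartAt (ModelProd (EuclideanSpace ℝ (Fin m)) (EuclideanHalfSpace 1))
      ((c, endPt) : Cyl M)).source := by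
    rw [mem_cyl_chart_source]
    refine ⟨hp1, ?_⟩
    rw [chartAt_top_source]
    exact hp2
  have hfd : f p ∈ (chartAt (ModelProd (EuclideanSpace ℝ (Fin m)) (EuclideanHalfSpace 1))
      ((c, endPt) : Cyl M)).source := by
    rw [mem_cyl_chart_source]
    refine ⟨hf1, ?_⟩
    rw [chartAt_top_source]
    exact hf2
  refine Form.eq_of_inChart_eq (β := fun q => a q • wedgeDz ω' q) hpd ?_
  rw [Form.pullback_inChart _ hpd hfd hf hL]
  refine eq_of_apply_basis_eq (cylBasis m) ?_
  rw [compContinuousLinearMap_eq_det_smul (cylBasis m)]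
  -- Moves along a coordinate line and along a fibre both change one coordinate only. Their
  -- derivatives are rank-one perturbations of the identity, with determinant 1 + ℓ v.
  have hdet : ∀ L : EuclideanSpace ℝ (Fin m) × EuclideanSpace ℝ (Fin 1) →L[ℝ]
      EuclideanSpace ℝ (Fin m) × EuclideanSpace ℝ (Fin 1),
      L = ContinuousLinearMap.id ℝ _ + ℓ.smulRight v →
      LinearMap.det (L : EuclideanSpace ℝ (Fin m) × EuclideanSpace ℝ (Fin 1) →ₗ[ℝ]
        EuclideanSpace ℝ (Fin m) × EuclideanSpace ℝ (Fin 1)) = 1 + ℓ v := by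
    rintro L rfl
    exact LinearMap.transvection.det (ℓ : EuclideanSpace ℝ (Fin m) × EuclideanSpace ℝ (Fin 1) →ₗ[ℝ]
      ℝ) v
  rw [hdet _ rfl]
  have e1 : ∀ (b : Cyl M → ℝ) (q : Cyl M),
      Form.inChart (fun q => b q • wedgeDz ω' q) (c, endPt) q (cylBasis m) =
        b q * (wedgeDz ω').inChart (c, endPt) q (cylBasis m) := fun b q => rfl
  change (1 + ℓ v) * Form.inChart (fun q => b q • wedgeDz ω' q) (c, endPt) (f p) (cylBasis m) = _
  rw [e1, e1, wedgeDz_inChart_endPt ω' hp1 hp2, wedgeDz_inChart_endPt ω' hf1 hf2]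
  linear_combination -hab

end Coefficient

/-! ### Composable transports of densities with a displacement bound. -/

section Transport

variable {m : ℕ} {M : Type*} [MetricSpace M] [ChartedSpace (EuclideanSpace ℝ (Fin m)) M]

/-- There is a diffeomorphism of the cylinder which is the identity on `M × [-1, 0]`, pulls
`b ω' ∧ dz` back to `a ω' ∧ dz`, and moves each coordinate by at most `r`. -/
def Transports (ω' : Form (𝓡 m) M m) (a b : Cyl M → ℝ) (r : ℝ) : Prop :=
  ∃ f : Diffeomorph (cylModel m) (cylModel m) (Cyl M) (Cyl M) ∞,
    (∀ p : Cyl M, (p.2 : ℝ) ≤ 0 → f p = p) ∧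
    (∀ p, Form.pullback f (fun q => b q • wedgeDz ω' q) p = a p • wedgeDz ω' p) ∧
    ∀ p, dist p.1 (f p).1 ≤ r ∧ dist p.2 (f p).2 ≤ r

theorem Transports.refl (ω' : Form (𝓡 m) M m) (a : Cyl M → ℝ) : Transports ω' a a 0 :=
  ⟨Diffeomorph.refl _ _ _, fun _ _ => rfl,
    fun _ => Form.pullback_apply_of_eventuallyEq_id (EventuallyEq.refl _ _),
    fun p => by simp⟩

theorem Transports.mono {ω' : Form (𝓡 m) M m} {a b : Cyl M → ℝ} {r s : ℝ}
    (h : Transports ω' a b r) (hrs : r ≤ s) : Transports ω' a b s := by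
  obtain ⟨f, h1, h2, h3⟩ := h
  exact ⟨f, h1, h2, fun p => ⟨(h3 p).1.trans hrs, (h3 p).2.trans hrs⟩⟩

theorem Transports.trans {ω' : Form (𝓡 m) M m} {a b c : Cyl M → ℝ} {r s : ℝ}
    (h : Transports ω' a b r) (h' : Transports ω' b c s) : Transports ω' a c (r + s) := by
  obtain ⟨f, h1, h2, h3⟩ := h
  obtain ⟨g, g1, g2, g3⟩ := h'
  refine ⟨f.trans g, fun p hp => ?_, fun p => ?_, fun p => ⟨?_, ?_⟩⟩
  · simp [h1 p hp, g1 p hp]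
  · have hf : MDifferentiable (cylModel m) (cylModel m) f := f.mdifferentiable (by simp)
    have hg : MDifferentiable (cylModel m) (cylModel m) g := g.mdifferentiable (by simp)
    rw [Diffeomorph.coe_trans, Form.pullback_comp hf hg, funext g2]
    exact h2 p
  · exact (dist_triangle _ (f p).1 _).trans (add_le_add (h3 p).1 (g3 (f p)).1)
  · exact (dist_triangle _ (f p).2 _).trans (add_le_add (h3 p).2 (g3 (f p)).2)

end Transport

/-! ### Comparison of the Riemannian distance with the chart distance. -/

section Lipschitz

open scoped NNReal ENNReal

attribute [local instance] normedAddCommGroupTangentSpaceVectorSpace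
attribute [local instance] normedSpaceTangentSpaceVectorSpace

variable {E : Type*} [NormedAddCommGroup E] [NormedSpace ℝ E]
  {H : Type*} [TopologicalSpace H] (I : ModelWithCorners ℝ E H)
  {M : Type*} [MetricSpace M] [ChartedSpace H M] [IsManifold I 1 M]
  [Bundle.RiemannianBundle (fun x : M => TangentSpace I x)]
  [IsContinuousRiemannianBundle E (fun x : M => TangentSpace I x)]
  [IsRiemannianManifold I M]

/-- The inverse of a chart of a Riemannian manifold is Lipschitz near the centre of the chart. -/
theorem exists_lipschitz_extChartAt_symm (c : M) : ∃ K > 0, ∃ R > 0,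
    Metric.ball (extChartAt I c c) R ∩ range I ⊆ (extChartAt I c).target ∧
    ∀ y ∈ Metric.ball (extChartAt I c c) R ∩ range I,
    ∀ y' ∈ Metric.ball (extChartAt I c c) R ∩ range I,
      dist ((extChartAt I c).symm y) ((extChartAt I c).symm y') ≤ K * dist y y' := by
  rcases eventually_enorm_mfderivWithin_symm_extChartAt_lt I c with ⟨K, K_pos, hK⟩
  obtain ⟨R, R_pos, hR⟩ :=
    Metric.mem_nhdsWithin_iff.1 (inter_mem (extChartAt_target_mem_nhdsWithin c) hK)
  refine ⟨K, by exact_mod_cast K_pos, R, R_pos, fun y hy => (hR hy).1, ?_⟩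
  intro y hy y' hy'
  -- The Riemannian distance is at most the length of the image of the straight segment, along which
  -- the derivative of the inverse chart has norm at most K.
  let η := ContinuousAffineMap.lineMap (R := ℝ) y y'
  set γ := (extChartAt I c).symm ∘ η
  have hη : ∀ t ∈ Icc (0 : ℝ) 1, η t ∈ Metric.ball (extChartAt I c c) R ∩ range I := by
    intro t ht
    have : η t ∈ segment ℝ y y' := by
      rw [segment_eq_image_lineMap]
      exact ⟨t, ht, by simp [η, ContinuousAffineMap.coe_lineMap_eq]⟩
    exact ((convex_ball _ _).inter I.convex_range).segment_subset hy hy' this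
  have η_smooth : ContMDiffOn 𝓘(ℝ, ℝ) 𝓘(ℝ, E) 1 η (Icc 0 1) := by
    apply ContMDiff.contMDiffOn
    rw [contMDiff_iff_contDiff]
    exact ContinuousAffineMap.contDiff _
  have h1 : Manifold.riemannianEDist I ((extChartAt I c).symm y)
      ((extChartAt I c).symm y') ≤ Manifold.pathELength I γ 0 1 := by
    apply Manifold.riemannianEDist_le_pathELength _ _ _ zero_le_one
    · exact (contMDiffOn_extChartAt_symm c).comp η_smooth fun t ht => (hR (hη t ht)).1
    · simp [γ, η, ContinuousAffineMap.coe_lineMap_eq]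
    · simp [γ, η, ContinuousAffineMap.coe_lineMap_eq]
  have h2 : Manifold.pathELength I γ 0 1 ≤ K * edist y y' := by
    rw [← lintegral_fderiv_lineMap_eq_edist, Manifold.pathELength_eq_lintegral_mfderivWithin_Icc,
      ← lintegral_const_mul' _ _ ENNReal.coe_ne_top]
    apply setLIntegral_mono' measurableSet_Icc (fun t ht ↦ ?_)
    have h3 : mfderivWithin 𝓘(ℝ, ℝ) I γ (Icc 0 1) t =
        (mfderivWithin 𝓘(ℝ, E) I (extChartAt I c).symm (range I) (η t)) ∘L
          (mfderivWithin 𝓘(ℝ, ℝ) 𝓘(ℝ, E) η (Icc 0 1) t) := by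
      apply mfderivWithin_comp
      · exact mdifferentiableWithinAt_extChartAt_symm (hR (hη t ht)).1
      · exact η_smooth.mdifferentiableOn one_ne_zero t ht
      · exact fun t ht => (hη t ht).2
      · rw [uniqueMDiffWithinAt_iff_uniqueDiffWithinAt]
        exact uniqueDiffOn_Icc zero_lt_one t ht
    have h4 : mfderivWithin 𝓘(ℝ, ℝ) I γ (Icc 0 1) t 1 =
        (mfderivWithin 𝓘(ℝ, E) I (extChartAt I c).symm (range I) (η t))
          (mfderivWithin 𝓘(ℝ, ℝ) 𝓘(ℝ, E) η (Icc 0 1) t 1) := DFunLike.congr_fun h3 1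
    rw [h4]
    apply (ContinuousLinearMap.le_opENorm _ _).trans
    gcongr
    · exact (hR (hη t ht)).2.le
    · simp only [mfderivWithin_eq_fderivWithin]
      exact le_of_eq rfl
  have h5 := (h1.trans h2)
  rw [← IsRiemannianManifold.out, edist_dist, edist_dist] at h5
  have h6 : (K : ℝ≥0∞) = ENNReal.ofReal K := by simp
  rw [h6, ← ENNReal.ofReal_mul (NNReal.coe_nonneg K)] at h5
  exact (ENNReal.ofReal_le_ofReal_iff (by positivity)).1 h5

end Lipschitz

/-! ### Functions and maps supported in a chart, extended to M and to the cylinder. -/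

section ChartBall

theorem contDiff_of_contDiffOn_of_tsupport_subset {E F : Type*} [NormedAddCommGroup E]
    [NormedSpace ℝ E] [NormedAddCommGroup F] [NormedSpace ℝ F] {v : E → F} {U : Set E}
    (hU : IsOpen U) (hv : ContDiffOn ℝ ∞ v U) (hs : tsupport v ⊆ U) : ContDiff ℝ ∞ v := by
  rw [contDiff_iff_contDiffAt]
  intro y
  by_cases hy : y ∈ U
  · exact hv.contDiffAt (hU.mem_nhds hy)
  · have h0 : v =ᶠ[𝓝 y] fun _ => 0 := notMem_tsupport_iff_eventuallyEq.1 fun h => hy (hs h)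
    exact contDiffAt_const.congr_of_eventuallyEq h0

variable {m : ℕ} {M : Type*} [TopologicalSpace M] [ChartedSpace (EuclideanSpace ℝ (Fin m)) M]

variable (m) in
/-- The inverse image of a ball under the chart at its centre. -/
def chartBall (c : M) (R : ℝ) : Set M :=
  (extChartAt (𝓡 m) c).source ∩ extChartAt (𝓡 m) c ⁻¹' Metric.ball (extChartAt (𝓡 m) c c) R

theorem isOpen_chartBall (c : M) (R : ℝ) : IsOpen (chartBall m c R) :=
  isOpen_extChartAt_preimage' c Metric.isOpen_ball

theorem mem_chartBall_self (c : M) {R : ℝ} (hR : 0 < R) : c ∈ chartBall m c R :=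
  ⟨mem_extChartAt_source c, Metric.mem_ball_self hR⟩

theorem symm_mem_chartBall {c : M} {R : ℝ}
    (hR : Metric.ball (extChartAt (𝓡 m) c c) R ⊆ (extChartAt (𝓡 m) c).target)
    {y : EuclideanSpace ℝ (Fin m)} (hy : y ∈ Metric.ball (extChartAt (𝓡 m) c c) R) :
    (extChartAt (𝓡 m) c).symm y ∈ chartBall m c R := by
  refine ⟨(extChartAt (𝓡 m) c).map_target (hR hy), ?_⟩
  rw [mem_preimage, (extChartAt (𝓡 m) c).right_inv (hR hy)]
  exact hy

theorem isClosed_image_symm [T2Space M] {c : M} {K : Set (EuclideanSpace ℝ (Fin m))}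
    (hK : IsCompact K) (hKt : K ⊆ (extChartAt (𝓡 m) c).target) :
    IsClosed ((extChartAt (𝓡 m) c).symm '' K) :=
  (hK.image_of_continuousOn ((continuousOn_extChartAt_symm c).mono hKt)).isClosed

open scoped Classical in
/-- The function on `M` which is `v` in the chart at `c` over a ball, and `0` elsewhere. -/
def chartExtend (c : M) (R : ℝ) (v : EuclideanSpace ℝ (Fin m) → ℝ) (x : M) : ℝ :=
  if x ∈ chartBall m c R then v (extChartAt (𝓡 m) c x) else 0

theorem chartExtend_of_mem {c : M} {R : ℝ} {v : EuclideanSpace ℝ (Fin m) → ℝ} {x : M}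
    (hx : x ∈ chartBall m c R) : chartExtend c R v x = v (extChartAt (𝓡 m) c x) := if_pos hx

theorem chartExtend_of_notMem {c : M} {R : ℝ} {v : EuclideanSpace ℝ (Fin m) → ℝ} {x : M}
    (hx : x ∉ chartBall m c R) : chartExtend c R v x = 0 := if_neg hx

theorem chartExtend_eq_zero {c : M} {R : ℝ} {v : EuclideanSpace ℝ (Fin m) → ℝ} {x : M}
    (hx : x ∉ (extChartAt (𝓡 m) c).symm '' tsupport v) : chartExtend c R v x = 0 := by
  by_cases h : x ∈ chartBall m c R
  · rw [chartExtend_of_mem h]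
    by_contra h0
    exact hx ⟨extChartAt (𝓡 m) c x, subset_tsupport v h0, (extChartAt (𝓡 m) c).left_inv h.1⟩
  · exact chartExtend_of_notMem h

theorem isCompact_tsupport_of_subset_ball {m : ℕ} {v : EuclideanSpace ℝ (Fin m) → ℝ}
    {y : EuclideanSpace ℝ (Fin m)} {R : ℝ} (hs : tsupport v ⊆ Metric.ball y R) :
    IsCompact (tsupport v) :=
  Metric.isCompact_of_isClosed_isBounded (isClosed_tsupport v) (Metric.isBounded_ball.subset hs)

/-- The image of the compact support is closed in the Hausdorff space M, so the extension vanishes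
near every point outside the chart ball. -/
theorem contMDiff_chartExtend [T2Space M] [IsManifold (𝓡 m) ∞ M] {c : M} {R : ℝ}
    (hR : Metric.ball (extChartAt (𝓡 m) c c) R ⊆ (extChartAt (𝓡 m) c).target)
    {v : EuclideanSpace ℝ (Fin m) → ℝ} (hv : ContDiff ℝ ∞ v)
    (hs : tsupport v ⊆ Metric.ball (extChartAt (𝓡 m) c c) R) :
    ContMDiff (𝓡 m) 𝓘(ℝ, ℝ) ∞ (chartExtend c R v) := by
  intro x
  by_cases hx : x ∈ chartBall m c R
  · have h1 : chartExtend c R v =ᶠ[𝓝 x] v ∘ extChartAt (𝓡 m) c := by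
      filter_upwards [(isOpen_chartBall c R).mem_nhds hx] with x' hx'
      exact chartExtend_of_mem hx'
    refine ContMDiffAt.congr_of_eventuallyEq ?_ h1
    exact hv.contMDiff.contMDiffAt.comp x
      (contMDiffAt_extChartAt' (by rw [← extChartAt_source (𝓡 m)]; exact hx.1))
  · have h2 : IsClosed ((extChartAt (𝓡 m) c).symm '' tsupport v) :=
      isClosed_image_symm (isCompact_tsupport_of_subset_ball hs) (hs.trans hR)
    have h3 : x ∉ (extChartAt (𝓡 m) c).symm '' tsupport v := by
      rintro ⟨y, hy, rfl⟩
      exact hx (symm_mem_chartBall hR (hs hy))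
    have h1 : chartExtend c R v =ᶠ[𝓝 x] fun _ => 0 := by
      filter_upwards [h2.isOpen_compl.mem_nhds h3] with x' hx'
      exact chartExtend_eq_zero hx'
    exact contMDiffAt_const.congr_of_eventuallyEq h1

open scoped Classical in
/-- The map of the cylinder which is the family `T` of maps in the chart at `c` over a ball, and
the identity elsewhere. -/
def chartMove (c : M) (R : ℝ) (T : EuclideanSpace ℝ (Fin m) × ℝ → EuclideanSpace ℝ (Fin m))
    (p : Cyl M) : Cyl M :=
  (if p.1 ∈ chartBall m c R then (extChartAt (𝓡 m) c).symm (T (extChartAt (𝓡 m) c p.1, p.2)) else p.1,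
    p.2)

variable {c : M} {R : ℝ} {T T' : EuclideanSpace ℝ (Fin m) × ℝ → EuclideanSpace ℝ (Fin m)}

theorem chartMove_of_mem {p : Cyl M} (hp : p.1 ∈ chartBall m c R) :
    chartMove c R T p = ((extChartAt (𝓡 m) c).symm (T (extChartAt (𝓡 m) c p.1, p.2)), p.2) := by
  simp only [chartMove, if_pos hp]

theorem chartMove_of_notMem {p : Cyl M} (hp : p.1 ∉ chartBall m c R) : chartMove c R T p = p := by
  simp only [chartMove, if_neg hp]

theorem chartMove_of_fixed {p : Cyl M}
    (h : p.1 ∈ chartBall m c R →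
      T (extChartAt (𝓡 m) c p.1, p.2) = extChartAt (𝓡 m) c p.1) : chartMove c R T p = p := by
  by_cases hp : p.1 ∈ chartBall m c R
  · rw [chartMove_of_mem hp, h hp, (extChartAt (𝓡 m) c).left_inv hp.1]
  · exact chartMove_of_notMem hp

theorem chartMove_chartMove
    (hR : Metric.ball (extChartAt (𝓡 m) c c) R ⊆ (extChartAt (𝓡 m) c).target)
    (hT : ∀ y z, y ∈ Metric.ball (extChartAt (𝓡 m) c c) R →
      T (y, z) ∈ Metric.ball (extChartAt (𝓡 m) c c) R)
    (hTT : ∀ y z, T' (T (y, z), z) = y) (p : Cyl M) :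
    chartMove c R T' (chartMove c R T p) = p := by
  by_cases hp : p.1 ∈ chartBall m c R
  · have h1 := hT _ p.2 hp.2
    rw [chartMove_of_mem hp, chartMove_of_mem (symm_mem_chartBall hR h1)]
    simp only
    rw [(extChartAt (𝓡 m) c).right_inv (hR h1), hTT, (extChartAt (𝓡 m) c).left_inv hp.1]
  · rw [chartMove_of_notMem hp, chartMove_of_notMem hp]

/-- The compact set K plays the role of a support: its image is closed in M, so the map is the
identity in M near every point outside the chart ball. -/
theorem contMDiff_chartMove [T2Space M] [IsManifold (𝓡 m) ∞ M]
    (hR : Metric.ball (extChartAt (𝓡 m) c c) R ⊆ (extChartAt (𝓡 m) c).target)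
    (hTs : ContDiff ℝ ∞ T)
    (hT : ∀ y z, y ∈ Metric.ball (extChartAt (𝓡 m) c c) R →
      T (y, z) ∈ Metric.ball (extChartAt (𝓡 m) c c) R)
    {K : Set (EuclideanSpace ℝ (Fin m))} (hK : IsCompact K)
    (hKR : K ⊆ Metric.ball (extChartAt (𝓡 m) c c) R) (hTK : ∀ y z, y ∉ K → T (y, z) = y) :
    ContMDiff (cylModel m) (cylModel m) ∞ (chartMove c R T) := by
  suffices hfst : ContMDiff (cylModel m) (𝓡 m) ∞ (fun p => (chartMove c R T p).1) from
    hfst.prodMk contMDiff_snd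
  intro p
  by_cases hp : p.1 ∈ chartBall m c R
  · have h1 : (fun p => (chartMove c R T p).1) =ᶠ[𝓝 p]
        fun p => (extChartAt (𝓡 m) c).symm (T (extChartAt (𝓡 m) c p.1, (p.2 : ℝ))) := by
      filter_upwards [((isOpen_chartBall c R).preimage continuous_fst).mem_nhds hp] with q hq
      rw [chartMove_of_mem hq]
    refine ContMDiffAt.congr_of_eventuallyEq ?_ h1
    have h2 : ContMDiffAt (cylModel m) (𝓡 m) ∞ (fun p : Cyl M => extChartAt (𝓡 m) c p.1) p :=
      ContMDiffAt.comp p (contMDiffAt_extChartAt' (I := 𝓡 m) (n := ∞)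
        (by rw [← extChartAt_source (𝓡 m)]; exact hp.1)) contMDiffAt_fst
    have h3 : ContMDiffAt (cylModel m) 𝓘(ℝ, ℝ) ∞ (fun p : Cyl M => (p.2 : ℝ)) p :=
      (contMDiff_subtypeVal_Icc.comp contMDiff_snd).contMDiffAt
    have h4 : ContMDiffAt (cylModel m) (𝓡 m) ∞
        (fun p : Cyl M => T (extChartAt (𝓡 m) c p.1, (p.2 : ℝ))) p :=
      hTs.contMDiff.contMDiffAt.comp p (h2.prodMk_space h3)
    have h5 : T (extChartAt (𝓡 m) c p.1, (p.2 : ℝ)) ∈ (extChartAt (𝓡 m) c).target :=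
      hR (hT _ _ hp.2)
    exact ((contMDiffOn_extChartAt_symm c).contMDiffAt
      ((isOpen_extChartAt_target c).mem_nhds h5)).comp p h4
  · have h2 := isClosed_image_symm hK (hKR.trans hR)
    have h3 : p.1 ∉ (extChartAt (𝓡 m) c).symm '' K := by
      rintro ⟨y, hy, hyp⟩
      exact hp (hyp ▸ symm_mem_chartBall hR (hKR hy))
    have h1 : (fun p => (chartMove c R T p).1) =ᶠ[𝓝 p] Prod.fst := by
      filter_upwards [(h2.isOpen_compl.preimage continuous_fst).mem_nhds h3] with q hq
      rw [chartMove_of_fixed]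
      intro hq1
      refine hTK _ _ fun hqK => hq ⟨_, hqK, (extChartAt (𝓡 m) c).left_inv hq1.1⟩
    exact contMDiffAt_fst.congr_of_eventuallyEq h1

end ChartBall

/-! ### Chart balls with nearly constant density, and cutoffs. -/

section Box

variable {m : ℕ} {M : Type*} [MetricSpace M] [ChartedSpace (EuclideanSpace ℝ (Fin m)) M]

theorem extChartAt_endPt_apply (c : M) (p : Cyl M) :
    extChartAt (cylModel m) (c, endPt) p =
      (extChartAt (𝓡 m) c p.1, WithLp.toLp 2 fun _ => 1 - (p.2 : ℝ)) := by
  rw [extChartAt_prod]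
  exact Prod.ext rfl (extChartAt_top_apply p.2)

theorem extChartAt_endPt_symm_apply (c : M)
    (w : EuclideanSpace ℝ (Fin m) × EuclideanSpace ℝ (Fin 1)) :
    (extChartAt (cylModel m) (c, endPt)).symm w =
      ((extChartAt (𝓡 m) c).symm w.1, projIcc (-1) 1 neg_one_le_one_real (1 - w.2 0)) := by
  rw [extChartAt_prod]
  exact Prod.ext rfl (extChartAt_top_symm_apply w.2)

variable [IsManifold (𝓡 m) ∞ M]

/-- The density of `ω'` in the chart at `c`, normalized to be `1` at `c`. -/
def weight (ω' : Form (𝓡 m) M m) (c : M) (y : EuclideanSpace ℝ (Fin m)) : ℝ :=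
  coeff ω' c ((extChartAt (𝓡 m) c).symm y) / coeff ω' c c

/-- On the ball of radius `R` in the chart at `c`, the density of `ω'` is almost constant and the
inverse of the chart is Lipschitz with constant `K`. -/
structure IsBox (ω' : Form (𝓡 m) M m) (c : M) (K R : ℝ) : Prop where
  K_pos : 0 < K
  R_pos : 0 < R
  subset_target : Metric.ball (extChartAt (𝓡 m) c c) R ⊆ (extChartAt (𝓡 m) c).target
  dist_le : ∀ y ∈ Metric.ball (extChartAt (𝓡 m) c c) R,
    ∀ y' ∈ Metric.ball (extChartAt (𝓡 m) c c) R,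
      dist ((extChartAt (𝓡 m) c).symm y) ((extChartAt (𝓡 m) c).symm y') ≤ K * dist y y'
  half_le : ∀ y ∈ Metric.ball (extChartAt (𝓡 m) c c) R, 1 / 2 ≤ weight ω' c y
  le_two : ∀ y ∈ Metric.ball (extChartAt (𝓡 m) c c) R, weight ω' c y ≤ 2

theorem contDiffOn_weight {ω' : Form (𝓡 m) M m} (hω' : ω'.IsVolumeForm) (c : M) :
    ContDiffOn ℝ ∞ (weight ω' c) (extChartAt (𝓡 m) c).target :=
  (contDiffOn_coeff_symm hω' c).div_const _

theorem exists_isBox [Bundle.RiemannianBundle (fun x : M => TangentSpace (𝓡 m) x)]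
    [IsContMDiffRiemannianBundle (𝓡 m) ∞ (EuclideanSpace ℝ (Fin m))
      (fun x : M => TangentSpace (𝓡 m) x)]
    [IsRiemannianManifold (𝓡 m) M] {ω' : Form (𝓡 m) M m} (hω' : ω'.IsVolumeForm) (c : M) :
    ∃ K R, IsBox ω' c K R := by
  have : IsContinuousRiemannianBundle (EuclideanSpace ℝ (Fin m))
      (fun x : M => TangentSpace (𝓡 m) x) := by
    obtain ⟨g, hg, h⟩ := IsContMDiffRiemannianBundle.exists_contMDiff (IB := 𝓡 m) (n := ∞)
      (F := EuclideanSpace ℝ (Fin m)) (E := fun x : M => TangentSpace (𝓡 m) x)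
    exact ⟨g, hg.continuous, h⟩
  obtain ⟨K, hK, R, hR, hsub, hlip⟩ := exists_lipschitz_extChartAt_symm (𝓡 m) c
  have hrange : range (𝓡 m) = univ := by simp
  rw [hrange, inter_univ] at hsub hlip
  have hc : ContinuousAt (weight ω' c) (extChartAt (𝓡 m) c c) :=
    (contDiffOn_weight hω' c).continuousOn.continuousAt
      ((isOpen_extChartAt_target c).mem_nhds (mem_extChartAt_target c))
  have h1 : weight ω' c (extChartAt (𝓡 m) c c) = 1 := by
    rw [weight, (extChartAt (𝓡 m) c).left_inv (mem_extChartAt_source c)]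
    exact div_self (coeff_ne_zero hω' (mem_chart_source _ c))
  have h2 : ∀ᶠ y in 𝓝 (extChartAt (𝓡 m) c c), weight ω' c y ∈ Ioo (1 / 2) 2 := by
    refine hc.eventually_mem ?_
    rw [h1]
    exact Ioo_mem_nhds (by norm_num) (by norm_num)
  obtain ⟨R', hR', h3⟩ := Metric.eventually_nhds_iff_ball.1 h2
  have hs1 : Metric.ball (extChartAt (𝓡 m) c c) (min R R') ⊆ Metric.ball (extChartAt (𝓡 m) c c) R :=
    Metric.ball_subset_ball (min_le_left _ _)
  have hs2 : Metric.ball (extChartAt (𝓡 m) c c) (min R R') ⊆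
      Metric.ball (extChartAt (𝓡 m) c c) R' := Metric.ball_subset_ball (min_le_right _ _)
  exact ⟨K, min R R', hK, lt_min hR hR', hs1.trans hsub,
    fun y hy y' hy' => hlip y (hs1 hy) y' (hs1 hy'), fun y hy => (h3 y (hs2 hy)).1.le,
    fun y hy => (h3 y (hs2 hy)).2.le⟩

/-- The constant `coeff ω' c c` may be negative, as the chart may reverse orientation. It cancels
from the Jacobian equation, which leaves the positive weight. -/
theorem coeff_eq_weight_mul {ω' : Form (𝓡 m) M m} (hω' : ω'.IsVolumeForm) {c x : M}
    (hx : x ∈ (extChartAt (𝓡 m) c).source) :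
    coeff ω' c x = weight ω' c (extChartAt (𝓡 m) c x) * coeff ω' c c := by
  rw [weight, (extChartAt (𝓡 m) c).left_inv hx,
    div_mul_cancel₀ _ (coeff_ne_zero hω' (mem_chart_source _ c))]

theorem exists_bump {E : Type*} [NormedAddCommGroup E] [InnerProductSpace ℝ E]
    [FiniteDimensional ℝ E] {y : E} {R : ℝ} (hR : 0 < R) {K : Set E} (hK : IsClosed K)
    (hKR : K ⊆ Metric.ball y R) : ∃ β : E → ℝ, ContDiff ℝ ∞ β ∧ (∀ x, 0 ≤ β x) ∧ (∀ x, β x ≤ 1) ∧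
      (∀ x ∈ K, β x = 1) ∧ tsupport β ⊆ Metric.ball y R := by
  obtain ⟨r, ⟨hr0, hr⟩, hKr⟩ := exists_pos_lt_subset_ball hR hK hKR
  let f : ContDiffBump y := ⟨r, (r + R) / 2, hr0, by linarith⟩
  refine ⟨f, f.contDiff, fun x => f.nonneg, fun x => f.le_one,
    fun x hx => f.one_of_mem_closedBall (Metric.ball_subset_closedBall (hKr hx)), ?_⟩
  rw [f.tsupport_eq]
  exact Metric.closedBall_subset_ball (by change (r + R) / 2 < R; linarith)

theorem contDiff_mul_of_tsupport_subset {E : Type*} [NormedAddCommGroup E] [NormedSpace ℝ E]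
    {β f : E → ℝ} {U : Set E} (hU : IsOpen U) (hβ : ContDiff ℝ ∞ β) (hs : tsupport β ⊆ U)
    (hf : ContDiffOn ℝ ∞ f U) : ContDiff ℝ ∞ (fun y => β y * f y) :=
  contDiff_of_contDiffOn_of_tsupport_subset hU (hβ.contDiffOn.mul hf)
    ((tsupport_mul_subset_left (f := β) (g := f)).trans hs)

/-- The derivative of a map moving the coordinate `k` by a function of the point and the height,
in the coordinates `(y, 1 - z)`. -/
theorem hasFDerivAt_setCoord_height {k : Fin m} {τ : EuclideanSpace ℝ (Fin m) × ℝ → ℝ}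
    (hτ : ContDiff ℝ ∞ τ) (w : EuclideanSpace ℝ (Fin m) × EuclideanSpace ℝ (Fin 1)) :
    ∃ ℓ : EuclideanSpace ℝ (Fin m) × EuclideanSpace ℝ (Fin 1) →L[ℝ] ℝ,
      HasFDerivAt (fun w : EuclideanSpace ℝ (Fin m) × EuclideanSpace ℝ (Fin 1) =>
        (setCoord k w.1 (τ (w.1, 1 - w.2 0)), w.2))
        (ContinuousLinearMap.id ℝ _ + ℓ.smulRight (EuclideanSpace.single k (1 : ℝ), 0)) w ∧
      1 + ℓ (EuclideanSpace.single k (1 : ℝ), 0) =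
        fderiv ℝ τ (w.1, 1 - w.2 0) (EuclideanSpace.single k (1 : ℝ), 0) := by
  let P : EuclideanSpace ℝ (Fin m) × EuclideanSpace ℝ (Fin 1) →L[ℝ] ℝ :=
    (EuclideanSpace.proj k : EuclideanSpace ℝ (Fin m) →L[ℝ] ℝ).comp (ContinuousLinearMap.fst ℝ _ _)
  let A : EuclideanSpace ℝ (Fin m) × EuclideanSpace ℝ (Fin 1) →L[ℝ] EuclideanSpace ℝ (Fin m) × ℝ :=
    (ContinuousLinearMap.fst ℝ _ _).prod (-lastCoord m)
  refine ⟨(fderiv ℝ τ (w.1, 1 - w.2 0)).comp A - P, ?_, ?_⟩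
  · have h1 : HasFDerivAt (fun w : EuclideanSpace ℝ (Fin m) × EuclideanSpace ℝ (Fin 1) =>
        (w.1, 1 - w.2 0)) A w := by
      refine HasFDerivAt.prodMk hasFDerivAt_fst ?_
      exact (lastCoord m).hasFDerivAt.const_sub 1
    have h2 := ((hτ.differentiable (by simp) (w.1, 1 - w.2 0)).hasFDerivAt).comp w h1
    have h3 := (hasFDerivAt_id (𝕜 := ℝ) w).add ((h2.sub P.hasFDerivAt).smul_const
      ((EuclideanSpace.single k (1 : ℝ), 0) :
        EuclideanSpace ℝ (Fin m) × EuclideanSpace ℝ (Fin 1)))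
    refine h3.congr_of_eventuallyEq (Eventually.of_forall fun w => ?_)
    simp [setCoord, P, Prod.ext_iff]
  · simp [A, P]

/-- Near the image of a point of positive height, the range of the model of the cylinder is
described by the last coordinate. -/
theorem eventually_range_cylModel {w : EuclideanSpace ℝ (Fin m) × EuclideanSpace ℝ (Fin 1)}
    (hw : w.2 0 < 2) {U : Set (EuclideanSpace ℝ (Fin m))} (hU : U ∈ 𝓝 w.1) :
    ∀ᶠ w' in 𝓝[range (cylModel m)] w, w'.1 ∈ U ∧ 0 ≤ w'.2 0 ∧ w'.2 0 < 2 := by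
  have h1 : ∀ᶠ w' in 𝓝 w, w'.1 ∈ U := continuousAt_fst.eventually_mem hU
  have h2 : ∀ᶠ w' in 𝓝 w, w'.2 0 < 2 :=
    ((lastCoord m).continuous.continuousAt (x := w)).eventually_lt_const hw
  filter_upwards [self_mem_nhdsWithin, nhdsWithin_le_nhds h1, nhdsWithin_le_nhds h2]
    with w' h3 h4 h5
  refine ⟨h4, ?_, h5⟩
  obtain ⟨q, rfl⟩ := h3
  exact q.2.2

end Box

/-! ### Adding one elementary function to a density. -/

section Elementary

variable {m : ℕ} {M : Type*} [MetricSpace M] [ChartedSpace (EuclideanSpace ℝ (Fin m)) M]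
  [IsManifold (𝓡 m) ∞ M]

/-- The function on `M` whose product with `ω'` is, in the chart at `c`, the derivative of `u` in
the direction of the coordinate `k`. -/
def elemFun (ω' : Form (𝓡 m) M m) (c : M) (R : ℝ) (k : Fin m)
    (u : EuclideanSpace ℝ (Fin m) → ℝ) : M → ℝ :=
  chartExtend c R fun y => fderiv ℝ u y (EuclideanSpace.single k 1) / weight ω' c y

/-- In the chart the density gains the term ρ ∂ₖu, so `exists_coordinate_transport` applies after
the data have been extended from the ball to the whole space. The line moves preserve the support of
u, hence they glue with the identity on M. -/
theorem transports_elemFun {ω' : Form (𝓡 m) M m} (hω' : ω'.IsVolumeForm) {c : M} {K R : ℝ}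
    (hbox : IsBox ω' c K R) (k : Fin m) {u : EuclideanSpace ℝ (Fin m) → ℝ} (hu : ContDiff ℝ ∞ u)
    (hsupp : tsupport u ⊆ Metric.ball (extChartAt (𝓡 m) c c) R) {a : M → ℝ}
    (ha : ContMDiff (𝓡 m) 𝓘(ℝ, ℝ) ∞ a) {ρ : ℝ → ℝ} (hρ : ContDiff ℝ ∞ ρ)
    (hρ0 : ∀ z ≤ 0, ρ z = 0) {κ : ℝ} (hκ : 0 < κ) (hκ1 : κ ≤ 1)
    (h1 : ∀ x z, κ ≤ 1 + ρ z * a x)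
    (h2 : ∀ x z, κ ≤ 1 + ρ z * (a x + elemFun ω' c R k u x)) {s : ℝ}
    (hs : ∀ y z, |ρ z * u y| ≤ s) :
    Transports ω' (fun p => 1 + ρ p.2 * a p.1)
      (fun p => 1 + ρ p.2 * (a p.1 + elemFun ω' c R k u p.1)) (K * (2 * s / κ)) := by
  set U := Metric.ball (extChartAt (𝓡 m) c c) R with hU
  have hUt := hbox.subset_target
  -- The cutoff β is 1 on the support of u. It extends the density to all of ℝᵐ by interpolating
  -- with 1, without changing it where points move.
  obtain ⟨β, hβ, hβ0, hβ1, hβu, hβs⟩ := exists_bump hbox.R_pos (isClosed_tsupport u) hsupp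
  have hW : ContDiff ℝ ∞ (fun y => β y * weight ω' c y) :=
    contDiff_mul_of_tsupport_subset Metric.isOpen_ball hβ hβs ((contDiffOn_weight hω' c).mono hUt)
  have hA : ContDiff ℝ ∞ (fun y => β y * a ((extChartAt (𝓡 m) c).symm y)) := by
    refine contDiff_mul_of_tsupport_subset Metric.isOpen_ball hβ hβs ?_
    rw [← contMDiffOn_iff_contDiffOn]
    exact ha.comp_contMDiffOn ((contMDiffOn_extChartAt_symm c).mono hUt)
  set â : EuclideanSpace ℝ (Fin m) × ℝ → ℝ := fun q =>
    (1 + ρ q.2 * (β q.1 * a ((extChartAt (𝓡 m) c).symm q.1))) *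
      (β q.1 * weight ω' c q.1 + (1 - β q.1)) with hâ
  set b : EuclideanSpace ℝ (Fin m) × ℝ → ℝ := fun q =>
    â q + ρ q.2 * fderiv ℝ u q.1 (EuclideanSpace.single k 1) with hb
  have hâs : ContDiff ℝ ∞ â := by
    have e1 : ContDiff ℝ ∞ fun q : EuclideanSpace ℝ (Fin m) × ℝ => ρ q.2 := hρ.comp contDiff_snd
    have e2 : ContDiff ℝ ∞ fun q : EuclideanSpace ℝ (Fin m) × ℝ =>
      β q.1 * a ((extChartAt (𝓡 m) c).symm q.1) := hA.comp contDiff_fst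
    have e3 : ContDiff ℝ ∞ fun q : EuclideanSpace ℝ (Fin m) × ℝ =>
      β q.1 * weight ω' c q.1 := hW.comp contDiff_fst
    have e4 : ContDiff ℝ ∞ fun q : EuclideanSpace ℝ (Fin m) × ℝ => β q.1 := hβ.comp contDiff_fst
    exact (contDiff_const.add (e1.mul e2)).mul (e3.add (contDiff_const.sub e4))
  have hβU : ∀ y, y ∉ U → β y = 0 := fun y hy => image_eq_zero_of_notMem_tsupport fun h => hy (hβs h)
  have hâκ : ∀ q, κ / 2 ≤ â q := by
    rintro ⟨y, z⟩
    -- This is a convex combination of 1 and 1 + ρa, both at least κ; here κ ≤ 1 is needed. The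
    -- second factor of `â` is at least 1/2, whence the bound κ / 2.
    have e1 : κ ≤ 1 + ρ z * (β y * a ((extChartAt (𝓡 m) c).symm y)) := by
      have := h1 ((extChartAt (𝓡 m) c).symm y) z
      nlinarith [hβ0 y, hβ1 y]
    have e2 : 1 / 2 ≤ β y * weight ω' c y + (1 - β y) := by
      by_cases hy : y ∈ U
      · nlinarith [hβ0 y, hβ1 y, hbox.half_le y hy]
      · rw [hβU y hy]; norm_num
    simp only [hâ]
    nlinarith
  have hx : ∀ y ∈ U, (extChartAt (𝓡 m) c).symm y ∈ chartBall m c R := fun y hy =>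
    symm_mem_chartBall hUt hy
  have hbeq : ∀ y ∈ tsupport u, ∀ z, b (y, z) = weight ω' c y *
      (1 + ρ z * (a ((extChartAt (𝓡 m) c).symm y) +
        elemFun ω' c R k u ((extChartAt (𝓡 m) c).symm y))) := by
    intro y hy z
    have hw : weight ω' c y ≠ 0 := by have := hbox.half_le y (hsupp hy); linarith
    rw [elemFun, chartExtend_of_mem (hx y (hsupp hy)),
      (extChartAt (𝓡 m) c).right_inv (hUt (hsupp hy))]
    simp only [hb, hâ, hβu y hy]
    field_simp
    ring
  have hbκ : ∀ q, κ / 2 ≤ b q := by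
    rintro ⟨y, z⟩
    by_cases hy : y ∈ tsupport u
    · rw [hbeq y hy]
      have e1 := hbox.half_le y (hsupp hy)
      have e2 := h2 ((extChartAt (𝓡 m) c).symm y) z
      nlinarith
    · have e : fderiv ℝ u y = 0 := fderiv_of_notMem_tsupport ℝ hy
      simp only [hb, e]
      simpa using hâκ (y, z)
  obtain ⟨τ, σ, hτ, hσ, hστ, hτσ, hτ0, hσ0, hτd, hτe⟩ := exists_coordinate_transport k hâs hu hρ
    (half_pos hκ) hâκ (fun y z => rfl) hbκ
  -- If the image of y were a zero of u, the inverse move would fix it. The image would then be y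
  -- itself, and u y = 0.
  have mapsτ : ∀ y z, y ∈ tsupport u → setCoord k y (τ (y, z)) ∈ tsupport u := by
    intro y z hy
    by_cases h : u y = 0
    · rw [hτ0 y z (by simp [h]), setCoord_self]; exact hy
    · refine subset_tsupport u fun h' => h ?_
      have e1 := hσ0 (setCoord k y (τ (y, z))) z (by simp [h'])
      rw [hστ, setCoord_same] at e1
      rwa [← e1, setCoord_self] at h'
  have mapsσ : ∀ y z, y ∈ tsupport u → setCoord k y (σ (y, z)) ∈ tsupport u := by
    intro y z hy
    by_cases h : u y = 0
    · rw [hσ0 y z (by simp [h]), setCoord_self]; exact hy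
    · refine subset_tsupport u fun h' => h ?_
      have e1 := hτ0 (setCoord k y (σ (y, z))) z (by simp [h'])
      rw [hτσ, setCoord_same] at e1
      rwa [← e1, setCoord_self] at h'
  have fixτ : ∀ y z, y ∉ tsupport u → setCoord k y (τ (y, z)) = y := fun y z hy => by
    rw [hτ0 y z (by rw [image_eq_zero_of_notMem_tsupport hy, mul_zero]), setCoord_self]
  have fixσ : ∀ y z, y ∉ tsupport u → setCoord k y (σ (y, z)) = y := fun y z hy => by
    rw [hσ0 y z (by rw [image_eq_zero_of_notMem_tsupport hy, mul_zero]), setCoord_self]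
  have mapsτU : ∀ y z, y ∈ U → setCoord k y (τ (y, z)) ∈ U := fun y z hy => by
    by_cases h : y ∈ tsupport u
    · exact hsupp (mapsτ y z h)
    · rwa [fixτ y z h]
  have mapsσU : ∀ y z, y ∈ U → setCoord k y (σ (y, z)) ∈ U := fun y z hy => by
    by_cases h : y ∈ tsupport u
    · exact hsupp (mapsσ y z h)
    · rwa [fixσ y z h]
  set T : EuclideanSpace ℝ (Fin m) × ℝ → EuclideanSpace ℝ (Fin m) :=
    fun q => setCoord k q.1 (τ q) with hT
  set T' : EuclideanSpace ℝ (Fin m) × ℝ → EuclideanSpace ℝ (Fin m) :=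
    fun q => setCoord k q.1 (σ q) with hT'
  have hTs : ContDiff ℝ ∞ T := (contDiff_setCoord k).comp (contDiff_fst.prodMk hτ)
  have hTs' : ContDiff ℝ ∞ T' := (contDiff_setCoord k).comp (contDiff_fst.prodMk hσ)
  have hcpt := isCompact_tsupport_of_subset_ball hsupp
  have hsm := contMDiff_chartMove hUt hTs mapsτU hcpt hsupp fixτ
  have hsm' := contMDiff_chartMove hUt hTs' mapsσU hcpt hsupp fixσ
  let f : Diffeomorph (cylModel m) (cylModel m) (Cyl M) (Cyl M) ∞ :=
    { toFun := chartMove c R T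
      invFun := chartMove c R T'
      left_inv := chartMove_chartMove hUt mapsτU fun y z => by simp [hT, hT', hστ]
      right_inv := chartMove_chartMove hUt mapsσU fun y z => by simp [hT, hT', hτσ]
      contMDiff_toFun := hsm
      contMDiff_invFun := hsm' }
  have hfix : ∀ p : Cyl M, (p.2 : ℝ) ≤ 0 → chartMove c R T p = p := fun p hp =>
    chartMove_of_fixed fun _ => by
      simp only [hT]
      rw [hτ0 _ _ (by rw [hρ0 _ hp, zero_mul]), setCoord_self]
  refine ⟨f, hfix, fun p => ?_, fun p => ?_⟩
  · change Form.pullback (chartMove c R T) _ p = _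
    have hcl := isClosed_image_symm (c := c) hcpt (hsupp.trans hUt)
    -- The chart at `endPt` misses height -1, so negative heights are treated by the identity.
    -- Height 0 is left to the chart computation, where a whole neighbourhood is needed.
    rcases lt_or_ge (p.2 : ℝ) 0 with hz | hz
    · have hev : chartMove c R T =ᶠ[𝓝 p] id := by
        have hcont : Continuous fun q : Cyl M => (q.2 : ℝ) := by fun_prop
        filter_upwards [hcont.continuousAt.eventually_lt_const hz] with q hq
        exact hfix q hq.le
      rw [Form.pullback_apply_of_eventuallyEq_id hev]
      simp [hρ0 _ hz.le]
    by_cases hp : p.1 ∈ (extChartAt (𝓡 m) c).symm '' tsupport u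
    · obtain ⟨y, hy, hyp⟩ := hp
      have hyU := hsupp hy
      have hpb : p.1 ∈ chartBall m c R := hyp ▸ hx y hyU
      have hφp : extChartAt (𝓡 m) c p.1 = y := by
        rw [← hyp, (extChartAt (𝓡 m) c).right_inv (hUt hyU)]
      have hfp : chartMove c R T p = ((extChartAt (𝓡 m) c).symm (T (y, p.2)), p.2) := by
        rw [chartMove_of_mem hpb, hφp]
      have hTy : T (y, (p.2 : ℝ)) ∈ tsupport u := mapsτ y p.2 hy
      set w := extChartAt (cylModel m) (c, endPt) p with hw
      have hw1 : w.1 = y := by rw [hw, extChartAt_endPt_apply, hφp]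
      have hw2 : 1 - w.2 0 = (p.2 : ℝ) := by rw [hw, extChartAt_endPt_apply]; simp
      obtain ⟨ℓ, hℓ, hℓ1⟩ := hasFDerivAt_setCoord_height (k := k) hτ w
      have hb1 := hx _ (hsupp hTy)
      refine pullback_smul_wedgeDz_of_transvection ω' (c := c) (ℓ := ℓ)
        (a := fun p => 1 + ρ p.2 * a p.1)
        (b := fun p => 1 + ρ p.2 * (a p.1 + elemFun ω' c R k u p.1))
        (v := (EuclideanSpace.single k (1 : ℝ), 0)) ?_ (by linarith) ?_ ?_
        (hsm.mdifferentiable (by simp) p) ?_ ?_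
      · rw [← extChartAt_source (𝓡 m)]; exact hpb.1
      · rw [hfp, ← extChartAt_source (𝓡 m)]; exact hb1.1
      · rw [hfp]; simp only; linarith
      · have hwr : w ∈ range (cylModel m) := ⟨_, rfl⟩
        have hev : extChartAt (cylModel m) (c, endPt) ∘ chartMove c R T ∘
            (extChartAt (cylModel m) (c, endPt)).symm =ᶠ[𝓝[range (cylModel m)] w]
            fun w => (setCoord k w.1 (τ (w.1, 1 - w.2 0)), w.2) := by
          filter_upwards [eventually_range_cylModel (w := w) (by linarith [hw2])
            (by rw [hw1]; exact Metric.isOpen_ball.mem_nhds hyU : U ∈ 𝓝 w.1)] with w' hw'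
          have e1 : ((projIcc (-1) 1 neg_one_le_one_real (1 - w'.2 0) : Icc (-1 : ℝ) 1) : ℝ) =
              1 - w'.2 0 := by
            rw [projIcc_of_mem neg_one_le_one_real (x := 1 - w'.2 0)
              ⟨by linarith [hw'.2.2], by linarith [hw'.2.1]⟩]
          simp only [Function.comp_apply, extChartAt_endPt_symm_apply]
          rw [chartMove_of_mem (hx _ hw'.1), extChartAt_endPt_apply]
          simp only [(extChartAt (𝓡 m) c).right_inv (hUt hw'.1), e1]
          rw [(extChartAt (𝓡 m) c).right_inv (hUt (mapsτU _ _ hw'.1))]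
          refine Prod.ext rfl ?_
          ext i
          rw [Subsingleton.elim i 0]
          simp
        exact hℓ.hasFDerivWithinAt.congr_of_eventuallyEq hev (hev.eq_of_nhdsWithin hwr)
      · rw [hfp, hℓ1, hw1, hw2]
        simp only
        rw [coeff_eq_weight_mul hω' hb1.1, coeff_eq_weight_mul hω' hpb.1, hφp,
          (extChartAt (𝓡 m) c).right_inv (hUt (hsupp hTy))]
        have e1 := hτe y p.2
        change b (T (y, (p.2 : ℝ)), (p.2 : ℝ)) * _ = _ at e1
        rw [hbeq _ hTy] at e1
        have e2 : â (y, (p.2 : ℝ)) = (1 + ρ p.2 * a p.1) * weight ω' c y := by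
          simp only [hâ, hβu y hy, hyp]; ring
        rw [e2] at e1
        linear_combination coeff ω' c c * e1
    · have hev : chartMove c R T =ᶠ[𝓝 p] id := by
        filter_upwards [(hcl.isOpen_compl.preimage continuous_fst).mem_nhds hp] with q hq
        refine chartMove_of_fixed fun hq1 => fixτ _ _ fun h => hq ⟨_, h,
          (extChartAt (𝓡 m) c).left_inv hq1.1⟩
      rw [Form.pullback_apply_of_eventuallyEq_id hev]
      have e : elemFun ω' c R k u p.1 = 0 := by
        by_cases hpb : p.1 ∈ chartBall m c R
        · rw [elemFun, chartExtend_of_mem hpb, fderiv_of_notMem_tsupport ℝ fun h => hp ⟨_, h,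
            (extChartAt (𝓡 m) c).left_inv hpb.1⟩]
          simp
        · exact chartExtend_of_notMem hpb
      simp only [e, add_zero]
  · change dist p.1 (chartMove c R T p).1 ≤ _ ∧ dist p.2 (chartMove c R T p).2 ≤ _
    have hs0 : 0 ≤ s := (abs_nonneg _).trans (hs 0 0)
    have hnn : 0 ≤ K * (2 * s / κ) := by have := hbox.K_pos; positivity
    by_cases hpb : p.1 ∈ chartBall m c R
    · rw [chartMove_of_mem hpb]
      refine ⟨?_, by simpa using hnn⟩
      have e0 := hbox.dist_le _ hpb.2 _ (mapsτU _ p.2 hpb.2)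
      rw [(extChartAt (𝓡 m) c).left_inv hpb.1] at e0
      refine e0.trans (mul_le_mul_of_nonneg_left ?_ hbox.K_pos.le)
      rw [dist_comm, dist_eq_norm, norm_sub_setCoord]
      refine (hτd _ _).trans ?_
      -- The density bound κ / 2 gives the displacement |ρu| / (κ / 2) ≤ 2s / κ in the chart. The
      -- Lipschitz constant K of the box transfers it to M.
      rw [div_le_div_iff₀ (half_pos hκ) hκ]
      have := hs (extChartAt (𝓡 m) c p.1) p.2
      nlinarith
    · rw [chartMove_of_notMem hpb]
      simpa using hnn

end Elementary

/-! ### Monotone rearrangement along the fibres. -/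

section Vertical

/-- The extension of a function on the cylinder to all heights, constant below `-1` and above
`1`. -/
def extendHeight {M : Type*} (a : Cyl M → ℝ) (x : M) (t : ℝ) : ℝ :=
  a (x, projIcc (-1) 1 neg_one_le_one_real t)

/-- The integral of a function over the part of the fibre over `x` below the height `t`. -/
def fibreInt {M : Type*} (a : Cyl M → ℝ) (x : M) (t : ℝ) : ℝ :=
  ∫ s in (-1 : ℝ)..t, extendHeight a x s

theorem extendHeight_coe {M : Type*} (a : Cyl M → ℝ) (p : Cyl M) : extendHeight a p.1 p.2 = a p := by
  simp [extendHeight]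

variable {m : ℕ} {M : Type*} [MetricSpace M] [ChartedSpace (EuclideanSpace ℝ (Fin m)) M]

theorem continuous_extendHeight {a : Cyl M → ℝ} (ha : Continuous a) (x : M) :
    Continuous (extendHeight a x) :=
  ha.comp (continuous_const.prodMk continuous_projIcc)

theorem hasDerivAt_fibreInt {a : Cyl M → ℝ} (ha : Continuous a) (x : M) (t : ℝ) :
    HasDerivAt (fibreInt a x) (extendHeight a x t) t :=
  intervalIntegral.integral_hasDerivAt_right
    ((continuous_extendHeight ha x).intervalIntegrable _ _)
    ((continuous_extendHeight ha x).stronglyMeasurableAtFilter _ _)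
    (continuous_extendHeight ha x).continuousAt

theorem mul_abs_sub_le_fibreInt {a : Cyl M → ℝ} (ha : Continuous a) {κ : ℝ} (hκ : ∀ p, κ ≤ a p)
    (x : M) (s t : ℝ) : κ * |s - t| ≤ |fibreInt a x s - fibreInt a x t| :=
  mul_abs_sub_le_of_le_deriv convex_univ
    (fun t _ => (hasDerivAt_fibreInt ha x t).hasDerivWithinAt) (fun _ _ => hκ _) (mem_univ s)
    (mem_univ t)

theorem strictMono_fibreInt {a : Cyl M → ℝ} (ha : Continuous a) {κ : ℝ} (hκ0 : 0 < κ)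
    (hκ : ∀ p, κ ≤ a p) (x : M) : StrictMono (fibreInt a x) :=
  strictMono_of_deriv_pos fun t => by
    rw [(hasDerivAt_fibreInt ha x t).deriv]
    exact hκ0.trans_le (hκ _)

theorem contDiffOn_extendHeight [IsManifold (𝓡 m) ∞ M] {a : Cyl M → ℝ}
    (ha : ContMDiff (cylModel m) 𝓘(ℝ, ℝ) ∞ a) (c : M) {V : Set (EuclideanSpace ℝ (Fin m))}
    (hV : V ⊆ (extChartAt (𝓡 m) c).target) :
    ContDiffOn ℝ ∞ (fun q : EuclideanSpace ℝ (Fin m) × ℝ =>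
      extendHeight a ((extChartAt (𝓡 m) c).symm q.1) q.2) (V ×ˢ Icc (-1) 1) := by
  rw [← contMDiffOn_iff_contDiffOn]
  refine ha.comp_contMDiffOn (ContMDiffOn.prodMk ?_ ?_)
  · refine ((contMDiffOn_extChartAt_symm c).mono hV).comp
      (contDiff_fst.contMDiff.contMDiffOn (I := 𝓘(ℝ, EuclideanSpace ℝ (Fin m) × ℝ))) ?_
    exact fun q hq => hq.1
  · refine (contMDiffOn_projIcc (x := -1) (y := 1)).comp
      (contDiff_snd.contMDiff.contMDiffOn (I := 𝓘(ℝ, EuclideanSpace ℝ (Fin m) × ℝ))) ?_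
    exact fun q hq => hq.2

theorem contDiffOn_fibreInt [IsManifold (𝓡 m) ∞ M] {a : Cyl M → ℝ}
    (ha : ContMDiff (cylModel m) 𝓘(ℝ, ℝ) ∞ a) (c : M) {V : Set (EuclideanSpace ℝ (Fin m))}
    (hVo : IsOpen V) (hVc : Convex ℝ V) (hV : V ⊆ (extChartAt (𝓡 m) c).target) :
    ContDiffOn ℝ ∞ (fun q : EuclideanSpace ℝ (Fin m) × ℝ =>
      fibreInt a ((extChartAt (𝓡 m) c).symm q.1) q.2) (V ×ˢ Icc (-1) 1) :=
  contDiffOn_primitive (a := fun q : EuclideanSpace ℝ (Fin m) × ℝ =>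
      extendHeight a ((extChartAt (𝓡 m) c).symm q.1) q.2) hVc hVo.uniqueDiffOn (convex_Icc _ _)
    (uniqueDiffOn_Icc (by norm_num)) (by norm_num) (contDiffOn_extendHeight ha c hV)

/-- Monotone rearrangement along the fibres. -/
theorem exists_fibre_transport [IsManifold (𝓡 m) ∞ M] {a b : Cyl M → ℝ}
    (ha : ContMDiff (cylModel m) 𝓘(ℝ, ℝ) ∞ a) (hb : ContMDiff (cylModel m) 𝓘(ℝ, ℝ) ∞ b) {κ : ℝ}
    (hκ0 : 0 < κ) (hκa : ∀ p, κ ≤ a p) (hκb : ∀ p, κ ≤ b p)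
    (hint : ∀ x, fibreInt a x 1 = fibreInt b x 1) :
    ∃ g : Cyl M → Icc (-1 : ℝ) 1, ContMDiff (cylModel m) (𝓡∂ 1) ∞ g ∧
      (∀ p, fibreInt b p.1 (g p) = fibreInt a p.1 p.2) ∧
      ∀ (c : M) (V : Set (EuclideanSpace ℝ (Fin m))), IsOpen V → Convex ℝ V →
        V ⊆ (extChartAt (𝓡 m) c).target →
        ContDiffOn ℝ ∞ (fun q : EuclideanSpace ℝ (Fin m) × ℝ =>
          (g ((extChartAt (𝓡 m) c).symm q.1, projIcc (-1) 1 neg_one_le_one_real q.2) : ℝ))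
          (V ×ˢ Icc (-1) 1) := by
  -- With the densities extended past ±1 by constants, the fibre integral is an increasing bijection
  -- of the whole line. Equality of the totals over [-1, 1] then forces the solution back into [-1,
  -- 1].
  have hsurj : ∀ x, Function.Surjective (fibreInt b x) := fun x =>
    surjective_of_le_deriv hκ0 (hasDerivAt_fibreInt hb.continuous x) fun t => hκb _
  have hmb := strictMono_fibreInt hb.continuous hκ0 hκb
  have hma := strictMono_fibreInt ha.continuous hκ0 hκa
  choose g₀ hg₀ using fun p : Cyl M => hsurj p.1 (fibreInt a p.1 p.2)
  have hg₀mem : ∀ p, g₀ p ∈ Icc (-1 : ℝ) 1 := by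
    intro p
    constructor
    · rw [← (hmb p.1).le_iff_le, hg₀ p]
      have e1 : fibreInt b p.1 (-1) = fibreInt a p.1 (-1) := by simp [fibreInt]
      rw [e1]
      exact (hma p.1).monotone p.2.2.1
    · rw [← (hmb p.1).le_iff_le, hg₀ p, ← hint]
      exact (hma p.1).monotone p.2.2.2
  have hsm : ∀ (c : M) (V : Set (EuclideanSpace ℝ (Fin m))), IsOpen V → Convex ℝ V →
        V ⊆ (extChartAt (𝓡 m) c).target →
        ContDiffOn ℝ ∞ (fun q : EuclideanSpace ℝ (Fin m) × ℝ =>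
          g₀ ((extChartAt (𝓡 m) c).symm q.1, projIcc (-1) 1 neg_one_le_one_real q.2))
          (V ×ˢ Icc (-1) 1) := by
    intro c V hVo hVc hV
    have hu : UniqueDiffOn ℝ (Icc (-1 : ℝ) 1) := uniqueDiffOn_Icc (by norm_num)
    have hB := contDiffOn_fibreInt hb c hVo hVc hV
    refine contDiffOn_implicit (S := V ×ˢ Icc (-1 : ℝ) 1) (T := Icc (-1 : ℝ) 1)
      (F := fun w : (EuclideanSpace ℝ (Fin m) × ℝ) × ℝ =>
        fibreInt b ((extChartAt (𝓡 m) c).symm w.1.1) w.2)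
      (g := fun q : EuclideanSpace ℝ (Fin m) × ℝ =>
        fibreInt a ((extChartAt (𝓡 m) c).symm q.1) q.2)
      (d := fun w => extendHeight b ((extChartAt (𝓡 m) c).symm w.1.1) w.2)
      (hVo.uniqueDiffOn.prod hu) hu hκ0 ?_ (contDiffOn_fibreInt ha c hVo hVc hV)
      (fun q _ => hg₀mem _) ?_
      (fun q _ t _ => (hasDerivAt_fibreInt hb.continuous
        ((extChartAt (𝓡 m) c).symm q.1) t).hasDerivWithinAt)
      (fun q _ t _ => hκ0.trans_le (hκb _))
      (fun q _ s _ t _ => mul_abs_sub_le_fibreInt hb.continuous hκb _ s t)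
    · exact hB.comp (f := fun w : (EuclideanSpace ℝ (Fin m) × ℝ) × ℝ => (w.1.1, w.2))
        (ContDiff.contDiffOn (by fun_prop)) fun w hw => ⟨hw.1.1, hw.2⟩
    · intro q hq
      refine (hg₀ ((extChartAt (𝓡 m) c).symm q.1, projIcc (-1) 1 neg_one_le_one_real q.2)).trans ?_
      simp only
      rw [projIcc_of_mem neg_one_le_one_real hq.2]
  have hsmM : ContMDiff (cylModel m) 𝓘(ℝ, ℝ) ∞ g₀ := by
    intro p
    obtain ⟨r, hr, hball⟩ := Metric.isOpen_iff.1 (isOpen_extChartAt_target (I := 𝓡 m) p.1) _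
      (mem_extChartAt_target p.1)
    have h1 := hsm p.1 _ Metric.isOpen_ball (convex_ball (extChartAt (𝓡 m) p.1 p.1) r) hball
    have hO : IsOpen (Prod.fst ⁻¹' chartBall m p.1 r : Set (Cyl M)) :=
      (isOpen_chartBall p.1 r).preimage continuous_fst
    have h2 : ContMDiffOn (cylModel m) 𝓘(ℝ, EuclideanSpace ℝ (Fin m) × ℝ) ∞
        (fun q : Cyl M => (extChartAt (𝓡 m) p.1 q.1, (q.2 : ℝ)))
        (Prod.fst ⁻¹' chartBall m p.1 r) := by
      refine ContMDiffOn.prodMk_space ?_ ?_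
      · refine (contMDiffOn_extChartAt (I := 𝓡 m) (x := p.1)).comp contMDiffOn_fst ?_
        intro q hq
        rw [← extChartAt_source (𝓡 m)]
        exact hq.1
      · exact (contMDiff_subtypeVal_Icc.comp contMDiff_snd).contMDiffOn
    have h3 := h1.contMDiffOn.comp h2 (fun q hq => ⟨hq.2, q.2.2⟩)
    have hmem : (Prod.fst ⁻¹' chartBall m p.1 r : Set (Cyl M)) ∈ 𝓝 p :=
      hO.mem_nhds (mem_chartBall_self p.1 hr)
    refine (h3.contMDiffAt hmem).congr_of_eventuallyEq ?_
    filter_upwards [hmem] with q hq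
    simp only [Function.comp_apply]
    rw [(extChartAt (𝓡 m) p.1).left_inv hq.1]
    simp
  refine ⟨fun p => ⟨g₀ p, hg₀mem p⟩, ?_, hg₀, hsm⟩
  rw [contMDiff_iff_comp_subtypeVal_Icc]
  exact ⟨hsmM.continuous.subtype_mk _, hsmM⟩

/-- Two lower bounds occur. The bound κ holds for both densities and serves only existence and
smoothness; κ' bounds the source density a alone and governs the displacement. With primitives A and
B and B(g) = A(z), one has κ' |g - z| ≤ |A(g) - A(z)| = |A(g) - B(g)| ≤ s. Thus no quantitative
lower bound for the target is needed. -/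
theorem transports_vertical [IsManifold (𝓡 m) ∞ M] {ω' : Form (𝓡 m) M m} {a b : Cyl M → ℝ}
    (ha : ContMDiff (cylModel m) 𝓘(ℝ, ℝ) ∞ a) (hb : ContMDiff (cylModel m) 𝓘(ℝ, ℝ) ∞ b) {κ : ℝ}
    (hκ0 : 0 < κ) (hκa : ∀ p, κ ≤ a p) (hκb : ∀ p, κ ≤ b p)
    (hint : ∀ x, fibreInt a x 1 = fibreInt b x 1)
    (hab : ∀ p : Cyl M, (p.2 : ℝ) ≤ 0 → a p = b p) {κ' s : ℝ} (hκ' : 0 < κ')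
    (hκa' : ∀ p, κ' ≤ a p)
    (hs : ∀ p : Cyl M, |fibreInt a p.1 p.2 - fibreInt b p.1 p.2| ≤ s) :
    Transports ω' a b (s / κ') := by
  obtain ⟨g, hg, hge, hgs⟩ := exists_fibre_transport ha hb hκ0 hκa hκb hint
  obtain ⟨g', hg', hge', -⟩ := exists_fibre_transport hb ha hκ0 hκb hκa fun x => (hint x).symm
  have hmb := strictMono_fibreInt hb.continuous hκ0 hκb
  have hma := strictMono_fibreInt ha.continuous hκ0 hκa
  have hlow : ∀ x, ∀ t : ℝ, t ≤ 0 → fibreInt a x t = fibreInt b x t := by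
    intro x t ht
    refine intervalIntegral.integral_congr fun s hs => hab _ ?_
    have : s ≤ 0 := by
      rcases mem_uIcc.1 hs with h | h
      · exact h.2.trans ht
      · exact h.2.trans (by norm_num)
    simp only [coe_projIcc]
    exact max_le (by norm_num) ((min_le_right _ _).trans this)
  have hgfix : ∀ p : Cyl M, (p.2 : ℝ) ≤ 0 → g p = p.2 := by
    intro p hp
    refine Subtype.ext ((hmb p.1).injective ?_)
    rw [hge, hlow _ _ hp]
  have hsm : ContMDiff (cylModel m) (cylModel m) ∞ (fun p : Cyl M => (p.1, g p)) :=
    contMDiff_fst.prodMk hg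
  have hsm' : ContMDiff (cylModel m) (cylModel m) ∞ (fun p : Cyl M => (p.1, g' p)) :=
    contMDiff_fst.prodMk hg'
  let f : Diffeomorph (cylModel m) (cylModel m) (Cyl M) (Cyl M) ∞ :=
    { toFun := fun p => (p.1, g p)
      invFun := fun p => (p.1, g' p)
      left_inv := fun p => by
        refine Prod.ext rfl (Subtype.ext ((hma p.1).injective ?_))
        have := hge' (p.1, g p)
        simp only at this ⊢
        rw [this, hge]
      right_inv := fun p => by
        refine Prod.ext rfl (Subtype.ext ((hmb p.1).injective ?_))
        have := hge (p.1, g' p)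
        simp only at this ⊢
        rw [this, hge']
      contMDiff_toFun := hsm
      contMDiff_invFun := hsm' }
  have hfix : ∀ p : Cyl M, (p.2 : ℝ) ≤ 0 → f p = p := fun p hp => Prod.ext rfl (hgfix p hp)
  refine ⟨f, hfix, fun p => ?_, fun p => ?_⟩
  · rcases lt_or_ge (p.2 : ℝ) 0 with hz | hz
    · have hev : f =ᶠ[𝓝 p] id := by
        have hcont : Continuous fun q : Cyl M => (q.2 : ℝ) := by fun_prop
        filter_upwards [hcont.continuousAt.eventually_lt_const hz] with q hq
        exact hfix q hq.le
      rw [Form.pullback_apply_of_eventuallyEq_id hev, hab p hz.le]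
    have hgp : 0 ≤ (g p : ℝ) := by
      rw [← (hmb p.1).le_iff_le, hge, ← hlow p.1 0 le_rfl]
      exact (hma p.1).monotone hz
    obtain ⟨r, hr, hball⟩ := Metric.isOpen_iff.1 (isOpen_extChartAt_target (I := 𝓡 m) p.1) _
      (mem_extChartAt_target p.1)
    set U := Metric.ball (extChartAt (𝓡 m) p.1 p.1) r with hU
    set ĝ : EuclideanSpace ℝ (Fin m) × ℝ → ℝ := fun q =>
      (g ((extChartAt (𝓡 m) p.1).symm q.1, projIcc (-1) 1 neg_one_le_one_real q.2) : ℝ) with hĝ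
    have hĝs := hgs p.1 U Metric.isOpen_ball (convex_ball _ _) hball
    set y := extChartAt (𝓡 m) p.1 p.1 with hy
    have hyp : (extChartAt (𝓡 m) p.1).symm y = p.1 := (extChartAt (𝓡 m) p.1).left_inv
      (mem_extChartAt_source p.1)
    have hyU : y ∈ U := Metric.mem_ball_self hr
    have hĝp : ĝ (y, p.2) = g p := by simp only [hĝ, hyp, projIcc_val]
    obtain ⟨D, hD⟩ : DifferentiableWithinAt ℝ ĝ (U ×ˢ Icc (-1) 1) (y, (p.2 : ℝ)) :=
      hĝs.differentiableOn (by simp) _ ⟨hyU, p.2.2⟩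
    have hD1 : b (p.1, g p) * D (0, 1) = a p := by
      have h1 : HasDerivWithinAt (fun t : ℝ => ĝ (y, t)) (D (0, 1)) (Icc (-1) 1) p.2 :=
        hD.comp_hasDerivWithinAt (f := fun t : ℝ => (y, t)) (p.2 : ℝ)
          ((hasDerivWithinAt_const _ _ y).prodMk (hasDerivWithinAt_id _ _)) fun t ht => ⟨hyU, ht⟩
      have h2 : HasDerivWithinAt (fun t : ℝ => fibreInt b p.1 (ĝ (y, t)))
          (extendHeight b p.1 (g p) * D (0, 1)) (Icc (-1) 1) p.2 := by
        have h3 := hasDerivAt_fibreInt hb.continuous p.1 (ĝ (y, (p.2 : ℝ)))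
        have h4 := h3.comp_hasDerivWithinAt (p.2 : ℝ) h1
        rw [hĝp] at h4
        exact h4
      have h5 : HasDerivWithinAt (fun t : ℝ => fibreInt b p.1 (ĝ (y, t)))
          (extendHeight a p.1 p.2) (Icc (-1) 1) p.2 := by
        refine (hasDerivAt_fibreInt ha.continuous p.1 p.2).hasDerivWithinAt.congr_of_mem
          (fun t ht => ?_) p.2.2
        have := hge (p.1, ⟨t, ht⟩)
        simp only at this
        simp only [hĝ, hyp, projIcc_of_mem neg_one_le_one_real ht]
        exact this
      have h6 := (uniqueDiffOn_Icc (by norm_num : (-1 : ℝ) < 1) _ p.2.2).eq_deriv _ h2 h5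
      rw [extendHeight_coe, show extendHeight b p.1 (g p) = b (p.1, g p) from
        extendHeight_coe b (p.1, g p)] at h6
      exact h6
    set w := extChartAt (cylModel m) (p.1, endPt) p with hw
    have hw1 : w.1 = y := by rw [hw, extChartAt_endPt_apply]
    have hw2 : 1 - w.2 0 = (p.2 : ℝ) := by rw [hw, extChartAt_endPt_apply]; simp
    let A : EuclideanSpace ℝ (Fin m) × EuclideanSpace ℝ (Fin 1) →L[ℝ]
        EuclideanSpace ℝ (Fin m) × ℝ := (ContinuousLinearMap.fst ℝ _ _).prod (-lastCoord m)
    let Sw : Set (EuclideanSpace ℝ (Fin m) × EuclideanSpace ℝ (Fin 1)) :=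
      {w' | w'.1 ∈ U ∧ 0 ≤ w'.2 0 ∧ w'.2 0 < 2}
    have hSw : Sw ∈ 𝓝[range (cylModel m)] w := eventually_range_cylModel (by linarith)
      (by rw [hw1]; exact Metric.isOpen_ball.mem_nhds hyU : U ∈ 𝓝 w.1)
    have hwr : w ∈ range (cylModel m) := ⟨_, rfl⟩
    -- In the coordinates (y, t) with t = 1 - z the map adds 1 - ĝ - t to the last coordinate. This
    -- gives ℓ and v, and 1 + ℓ v is the z-derivative of ĝ.
    refine pullback_smul_wedgeDz_of_transvection ω' (c := p.1) (ℓ := -(D.comp A) - lastCoord m)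
      (v := ((0 : EuclideanSpace ℝ (Fin m)), EuclideanSpace.single (0 : Fin 1) (1 : ℝ)))
      (mem_chart_source _ p.1) (by linarith) (mem_chart_source _ p.1)
      (by change -1 < (g p : ℝ); linarith) (hsm.mdifferentiable (by simp) p) ?_ ?_
    · have h1 : HasFDerivWithinAt (fun w : EuclideanSpace ℝ (Fin m) × EuclideanSpace ℝ (Fin 1) =>
          (w.1, 1 - w.2 0)) A Sw w := by
        refine HasFDerivWithinAt.prodMk hasFDerivWithinAt_fst ?_
        exact ((lastCoord m).hasFDerivAt.const_sub 1).hasFDerivWithinAt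
      have h2 : HasFDerivWithinAt (fun w : EuclideanSpace ℝ (Fin m) × EuclideanSpace ℝ (Fin 1) =>
          ĝ (w.1, 1 - w.2 0)) (D.comp A) Sw w := by
        refine HasFDerivWithinAt.comp (t := U ×ˢ Icc (-1) 1) w (by rwa [hw1, hw2]) h1 ?_
        intro w' hw'
        exact ⟨hw'.1, by linarith [hw'.2.2], by linarith [hw'.2.1]⟩
      have h3 := (hasFDerivWithinAt_id (𝕜 := ℝ) w Sw).add
        (((h2.const_sub 1).sub (lastCoord m).hasFDerivWithinAt).smul_const
        ((0, EuclideanSpace.single (0 : Fin 1) (1 : ℝ)) :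
          EuclideanSpace ℝ (Fin m) × EuclideanSpace ℝ (Fin 1)))
      refine HasFDerivWithinAt.congr_of_eventuallyEq (h3.mono_of_mem_nhdsWithin hSw) ?_ ?_
      all_goals
        have key : ∀ w' ∈ Sw, (extChartAt (cylModel m) (p.1, endPt) ∘ f ∘
            (extChartAt (cylModel m) (p.1, endPt)).symm) w' = w' +
            (1 - ĝ (w'.1, 1 - w'.2 0) - lastCoord m w') •
            ((0, EuclideanSpace.single (0 : Fin 1) (1 : ℝ)) :
              EuclideanSpace ℝ (Fin m) × EuclideanSpace ℝ (Fin 1)) := by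
          intro w' hw'
          simp only [Function.comp_apply, extChartAt_endPt_symm_apply]
          rw [extChartAt_endPt_apply]
          refine Prod.ext ?_ ?_
          · change extChartAt (𝓡 m) p.1 ((extChartAt (𝓡 m) p.1).symm w'.1) = _
            rw [(extChartAt (𝓡 m) p.1).right_inv (hball hw'.1)]
            simp
          · ext i
            rw [Subsingleton.elim i 0]
            change 1 - ĝ (w'.1, 1 - w'.2 0) = _
            simp
      · filter_upwards [hSw] with w' hw'
        exact key w' hw'
      · exact key w (mem_of_mem_nhdsWithin hwr hSw)
    · have e1 : 1 + (-(D.comp A) - lastCoord m) ((0 : EuclideanSpace ℝ (Fin m)),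
          EuclideanSpace.single (0 : Fin 1) (1 : ℝ)) = D (0, 1) := by
        have e2 : A ((0 : EuclideanSpace ℝ (Fin m)), EuclideanSpace.single (0 : Fin 1) (1 : ℝ)) =
            -((0 : EuclideanSpace ℝ (Fin m)), (1 : ℝ)) := by
          simp [A]
        change 1 + (-(D (A _)) - (lastCoord m) _) = _
        rw [e2, map_neg]
        simp
      rw [e1]
      change b (p.1, g p) * coeff ω' p.1 p.1 * D (0, 1) = _
      linear_combination coeff ω' p.1 p.1 * hD1
  · have hs0 : 0 ≤ s := (abs_nonneg _).trans (hs p)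
    refine ⟨?_, ?_⟩
    · change dist p.1 p.1 ≤ _
      rw [dist_self]; positivity
    · change dist (p.2 : ℝ) (g p : ℝ) ≤ _
      rw [dist_comm, Real.dist_eq, le_div_iff₀ hκ', mul_comm]
      refine (mul_abs_sub_le_fibreInt ha.continuous hκa' p.1 _ _).trans ?_
      rw [← hge]
      exact hs (p.1, g p)

end Vertical

/-! ### Integration of densities on manifolds. -/

section Measurability

variable {E : Type*} [NormedAddCommGroup E] [NormedSpace ℝ E] [MeasurableSpace E] [BorelSpace E]
  {H : Type*} [TopologicalSpace H] {I : ModelWithCorners ℝ E H}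
  {N : Type*} [TopologicalSpace N] [ChartedSpace H N]

theorem measurableSet_extChartAt_target (c : N) :
    MeasurableSet (extChartAt I c).target := by
  rw [extChartAt_target]
  exact ((chartAt H c).open_target.preimage I.continuous_symm).measurableSet.inter
    I.isClosed_range.measurableSet

theorem measurableSet_coordChange_source (c d : N) :
    MeasurableSet ((extChartAt I d).symm.trans (extChartAt I c)).source := by
  rw [ext_coord_change_source, I.image_eq]
  exact ((OpenPartialHomeomorph.open_source _).preimage I.continuous_symm).measurableSet.inter
    I.isClosed_range.measurableSet

theorem integrableOn_chart {n : ℕ} (b : Module.Basis (Fin n) ℝ E) [CompactSpace N]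
    [IsManifold I 1 N] {o : Form I N n}
    {g : N → ℝ} (hg : Continuous g) {c : N}
    (ho : ContinuousOn (fun x => o.inChart c x b) (chartAt H c).source)
    (hc : tsupport g ⊆ (chartAt H c).source) :
    IntegrableOn (fun y => g ((extChartAt I c).symm y) *
      |o.inChart c ((extChartAt I c).symm y) b|) (extChartAt I c).target b.addHaar := by
  have hc' : tsupport g ⊆ (extChartAt I c).source := by rwa [extChartAt_source]
  have hK : IsCompact (extChartAt I c '' tsupport g) :=
    (isClosed_tsupport g).isCompact.image_of_continuousOn ((continuousOn_extChartAt c).mono hc')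
  have hKt : extChartAt I c '' tsupport g ⊆ (extChartAt I c).target := by
    rintro _ ⟨x, hx, rfl⟩
    exact (extChartAt I c).map_source (hc' hx)
  have hcont : ContinuousOn (fun y => g ((extChartAt I c).symm y) *
      |o.inChart c ((extChartAt I c).symm y) b|) (extChartAt I c).target := by
    have h1 := continuousOn_extChartAt_symm (I := I) c
    refine (hg.comp_continuousOn h1).mul (ContinuousOn.abs (ho.comp h1 ?_))
    intro y hy
    rw [← extChartAt_source I]
    exact (extChartAt I c).map_target hy
  refine ((hcont.mono hKt).integrableOn_compact hK).of_forall_sdiff_eq_zero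
    (measurableSet_extChartAt_target c) ?_
  rintro y ⟨hy, hy'⟩
  have : g ((extChartAt I c).symm y) = 0 := by
    by_contra h
    exact hy' ⟨_, subset_tsupport _ h, (extChartAt I c).right_inv hy⟩
  rw [this, zero_mul]

end Measurability

section ChartPartition

variable {E : Type*} [NormedAddCommGroup E] [NormedSpace ℝ E] [FiniteDimensional ℝ E]
  {H : Type*} [TopologicalSpace H] {I : ModelWithCorners ℝ E H}
  {N : Type*} [TopologicalSpace N] [ChartedSpace H N] [IsManifold I ∞ N] [T2Space N]
  [CompactSpace N]

theorem tsupport_chartPartition_subset (c : N) :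
    tsupport (chartPartition I N c) ⊆ (chartAt H c).source :=
  (SmoothPartitionOfUnity.exists_isSubordinate_chartAt_source I N).choose_spec c

variable (I N) in
theorem finite_chartPartition_ne_zero : {c : N | ∃ x, chartPartition I N c x ≠ 0}.Finite :=
  (chartPartition I N).locallyFinite.finite_nonempty_of_compact

end ChartPartition

section Mass

variable {E : Type*} [NormedAddCommGroup E] [NormedSpace ℝ E] [FiniteDimensional ℝ E]
  [MeasurableSpace E] [BorelSpace E]
  {H : Type*} [TopologicalSpace H] {I : ModelWithCorners ℝ E H}
  {N : Type*} [TopologicalSpace N] [ChartedSpace H N] [IsManifold I ∞ N] {n : ℕ}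

/-- The integral of `g` against the density `|o|`, computed in the chart at `c`. -/
def chartIntegral (b : Module.Basis (Fin n) ℝ E) (o : Form I N n) (g : N → ℝ) (c : N) : ℝ :=
  ∫ y in (extChartAt I c).target,
    g ((extChartAt I c).symm y) * |o.inChart c ((extChartAt I c).symm y) b| ∂b.addHaar

/-- The integral of `g` against the density `|o|`. -/
def mass [T2Space N] [SigmaCompactSpace N] (b : Module.Basis (Fin n) ℝ E) (o : Form I N n)
    (g : N → ℝ) : ℝ :=
  Form.integral b o fun x => g x • o x

/-- Change of variables: the absolute Jacobian determinant of the coordinate change is exactly the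
factor relating the two absolute coefficients. -/
theorem chartIntegral_eq_of_support_subset (b : Module.Basis (Fin n) ℝ E) (o : Form I N n)
    {g : N → ℝ} {c d : N} (hc : ∀ x, g x ≠ 0 → x ∈ (chartAt H c).source)
    (hd : ∀ x, g x ≠ 0 → x ∈ (chartAt H d).source) :
    chartIntegral b o g c = chartIntegral b o g d := by
  have restr : ∀ c d : N, (∀ x, g x ≠ 0 → x ∈ (chartAt H d).source) → chartIntegral b o g c =
      ∫ y in ((extChartAt I c).symm.trans (extChartAt I d)).source,
        g ((extChartAt I c).symm y) * |o.inChart c ((extChartAt I c).symm y) b| ∂b.addHaar := by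
    intro c d hd
    refine setIntegral_eq_of_subset_of_forall_sdiff_eq_zero (measurableSet_extChartAt_target c)
      ?_ ?_
    · intro y hy
      rw [PartialEquiv.trans_source] at hy
      exact hy.1
    · rintro y ⟨hy, hy'⟩
      have : g ((extChartAt I c).symm y) = 0 := by
        by_contra h
        refine hy' ?_
        rw [PartialEquiv.trans_source]
        refine ⟨hy, ?_⟩
        rw [mem_preimage, extChartAt_source]
        exact hd _ h
      rw [this, zero_mul]
  rw [restr c d hd, restr d c hc]
  set s := ((extChartAt I d).symm.trans (extChartAt I c)).source with hs
  have himage : ((extChartAt I c).symm.trans (extChartAt I d)).source =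
      (extChartAt I c ∘ (extChartAt I d).symm) '' s := by
    have h := ((extChartAt I d).symm.trans (extChartAt I c)).image_source_eq_target
    rw [PartialEquiv.coe_trans] at h
    rw [hs, h, ← PartialEquiv.symm_source, PartialEquiv.trans_symm_eq_symm_trans_symm,
      PartialEquiv.symm_symm]
  rw [himage, integral_image_eq_integral_abs_det_fderiv_smul b.addHaar
    (measurableSet_coordChange_source c d)
    (f' := fun y => fderivWithin ℝ (extChartAt I c ∘ (extChartAt I d).symm) (range I) y)]
  · refine setIntegral_congr_fun (measurableSet_coordChange_source c d) fun y hy => ?_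
    have hy1 : y ∈ (extChartAt I d).target := by
      rw [PartialEquiv.trans_source] at hy
      exact hy.1
    have hyc : (extChartAt I d).symm y ∈ (extChartAt I c).source := by
      rw [PartialEquiv.trans_source] at hy
      exact hy.2
    have hyd : (extChartAt I d).symm y ∈ (extChartAt I d).source := (extChartAt I d).map_target hy1
    have hback : (extChartAt I c).symm (extChartAt I c ((extChartAt I d).symm y)) =
      (extChartAt I d).symm y := (extChartAt I c).left_inv hyc
    rw [extChartAt_source] at hyc hyd
    have h1 := o.inChart_eq_inChart_comp hyd hyc
    rw [compContinuousLinearMap_eq_det_smul b, (extChartAt I d).right_inv hy1] at h1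
    have h2 : o.inChart d ((extChartAt I d).symm y) b =
        (fderivWithin ℝ (extChartAt I c ∘ (extChartAt I d).symm) (range I) y).det *
          o.inChart c ((extChartAt I d).symm y) b := by
      rw [h1]; rfl
    simp only [Function.comp_apply, hback, smul_eq_mul]
    rw [h2, abs_mul]
    ring
  · intro y hy
    have h1 : ContDiffWithinAt ℝ ∞ (extChartAt I c ∘ (extChartAt I d).symm) (range I) y :=
      contDiffWithinAt_ext_coord_change c d hy
    refine ((h1.differentiableWithinAt (by simp)).hasFDerivWithinAt).mono ?_
    rw [ext_coord_change_source]
    exact image_subset_range _ _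
  · have h := ((extChartAt I d).symm.trans (extChartAt I c)).injOn
    rwa [PartialEquiv.coe_trans] at h

variable [T2Space N] [CompactSpace N]

/-- A form is here integrated against its own orientation, so the sign turns the coefficient into
its absolute value and orientations of charts disappear. -/
theorem mass_eq_finsum (b : Module.Basis (Fin n) ℝ E) (o : Form I N n) (g : N → ℝ) :
    mass b o g = ∑ᶠ c, chartIntegral b o (fun x => chartPartition I N c x * g x) c := by
  refine finsum_congr fun c => setIntegral_congr_fun (measurableSet_extChartAt_target c)
    fun y _ => ?_
  have h : (Form.inChart (fun x => g x • o x) c ((extChartAt I c).symm y)) b =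
      g ((extChartAt I c).symm y) * o.inChart c ((extChartAt I c).symm y) b := rfl
  simp only [h]
  rw [mul_left_comm (Real.sign _), ← mul_assoc]
  congr 1
  rcases lt_trichotomy (o.inChart c ((extChartAt I c).symm y) b) 0 with h | h | h
  · rw [Real.sign_of_neg h, abs_of_neg h]; ring
  · rw [h, mul_zero, abs_zero]
  · rw [Real.sign_of_pos h, abs_of_pos h]; ring

theorem mass_eq_sum (b : Module.Basis (Fin n) ℝ E) (o : Form I N n) (g : N → ℝ) :
    mass b o g = ∑ c ∈ (finite_chartPartition_ne_zero I N).toFinset,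
      chartIntegral b o (fun x => chartPartition I N c x * g x) c := by
  rw [mass_eq_finsum]
  refine finsum_eq_sum_of_support_subset _ fun c hc => ?_
  rw [Finite.coe_toFinset]
  by_contra h
  refine hc ?_
  have h0 : ∀ x, chartPartition I N c x = 0 := by simpa using h
  simp [chartIntegral, h0]

theorem mass_add (b : Module.Basis (Fin n) ℝ E) {o : Form I N n}
    (ho : ∀ c, ContinuousOn (fun x => o.inChart c x b) (chartAt H c).source)
    {g g' : N → ℝ} (hg : Continuous g) (hg' : Continuous g') :
    mass b o (fun x => g x + g' x) = mass b o g + mass b o g' := by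
  simp only [mass_eq_sum]
  rw [← Finset.sum_add_distrib]
  refine Finset.sum_congr rfl fun c _ => ?_
  have hi : ∀ g : N → ℝ, Continuous g → IntegrableOn (fun y =>
      (chartPartition I N c ((extChartAt I c).symm y) * g ((extChartAt I c).symm y)) *
      |o.inChart c ((extChartAt I c).symm y) b|) (extChartAt I c).target b.addHaar := fun g hg =>
    integrableOn_chart b (g := fun x => chartPartition I N c x * g x)
      ((chartPartition I N c).contMDiff.continuous.mul hg) (ho c)
      ((tsupport_mul_subset_left (f := chartPartition I N c) (g := g)).trans
        (tsupport_chartPartition_subset c))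
  rw [chartIntegral, chartIntegral, chartIntegral, ← integral_add (hi g hg) (hi g' hg')]
  congr 1
  ext y
  ring

theorem mass_const_mul (b : Module.Basis (Fin n) ℝ E) (o : Form I N n) (r : ℝ) (g : N → ℝ) :
    mass b o (fun x => r * g x) = r * mass b o g := by
  simp only [mass_eq_sum]
  rw [Finset.mul_sum]
  refine Finset.sum_congr rfl fun c _ => ?_
  rw [chartIntegral, chartIntegral, ← integral_const_mul]
  congr 1
  ext y
  ring

/-- The mass of a function supported in the domain of a chart is its integral in this chart. -/
theorem mass_eq_chartIntegral (b : Module.Basis (Fin n) ℝ E) {o : Form I N n} {d : N}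
    (ho : ContinuousOn (fun x => o.inChart d x b) (chartAt H d).source)
    {g : N → ℝ} (hg : Continuous g) (hd : tsupport g ⊆ (chartAt H d).source) :
    mass b o g = chartIntegral b o g d := by
  rw [mass_eq_sum]
  -- Every piece of the partition of unity is supported in two charts and can be computed in the
  -- chart at d. There the pieces sum to 1.
  have h1 : ∀ c, chartIntegral b o (fun x => chartPartition I N c x * g x) c =
      chartIntegral b o (fun x => chartPartition I N c x * g x) d := by
    intro c
    refine chartIntegral_eq_of_support_subset b o (fun x hx => ?_) fun x hx => ?_
    · exact tsupport_chartPartition_subset c (subset_tsupport _ (left_ne_zero_of_mul hx))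
    · exact hd (subset_tsupport _ (right_ne_zero_of_mul hx))
  rw [Finset.sum_congr rfl fun c _ => h1 c]
  simp only [chartIntegral]
  rw [← integral_finsetSum]
  · congr 1
    ext y
    rw [← Finset.sum_mul, ← Finset.sum_mul]
    have : ∑ c ∈ (finite_chartPartition_ne_zero I N).toFinset,
        chartPartition I N c ((extChartAt I d).symm y) = 1 := by
      rw [← (chartPartition I N).sum_eq_one (mem_univ ((extChartAt I d).symm y))]
      refine (finsum_eq_sum_of_support_subset _ fun c hc => ?_).symm
      rw [Finite.coe_toFinset]
      exact ⟨_, hc⟩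
    rw [this, one_mul]
  · intro c _
    exact integrableOn_chart b (g := fun x => chartPartition I N c x * g x)
      ((chartPartition I N c).contMDiff.continuous.mul hg) ho
      ((tsupport_mul_subset_right (f := chartPartition I N c) (g := g)).trans hd)

end Mass

/-- The standard basis of the model space of `M`. -/
def baseBasis (m : ℕ) : Module.Basis (Fin m) ℝ (EuclideanSpace ℝ (Fin m)) :=
  (EuclideanSpace.basisFun (Fin m) ℝ).toBasis

theorem coe_baseBasis (m : ℕ) :
    ⇑(baseBasis m) = fun i => EuclideanSpace.single i (1 : ℝ) := by
  ext1 i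
  simp [baseBasis]

theorem baseBasis_addHaar (m : ℕ) : (baseBasis m).addHaar = volume :=
  (EuclideanSpace.basisFun (Fin m) ℝ).addHaar_eq_volume

/-- The identification of the model space of the cylinder with `ℝᵐ × ℝ`. -/
def splitHeight (m : ℕ) :
    (EuclideanSpace ℝ (Fin m) × EuclideanSpace ℝ (Fin 1)) ≃L[ℝ] EuclideanSpace ℝ (Fin m) × ℝ :=
  (ContinuousLinearEquiv.refl ℝ _).prodCongr
    ((EuclideanSpace.equiv (Fin 1) ℝ).trans (ContinuousLinearEquiv.funUnique (Fin 1) ℝ ℝ))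

/-- Uniqueness of Haar measure. The factor κ need not be computed, because Fubini is only used to
pass from one vanishing integral to another. -/
theorem exists_map_splitHeight (m : ℕ) : ∃ κ : NNReal, 0 < κ ∧
    (cylBasis m).addHaar.map (splitHeight m) = κ • (volume.prod volume) := by
  have h1 : ((cylBasis m).addHaar.map (splitHeight m)).IsAddHaarMeasure := inferInstance
  exact ⟨_, Measure.addHaarScalarFactor_pos_of_isAddHaarMeasure _ _,
    Measure.isAddLeftInvariant_eq_smul _ _⟩

section FibreMass

variable {m : ℕ} {M : Type*} [MetricSpace M] [ChartedSpace (EuclideanSpace ℝ (Fin m)) M]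
  [IsManifold (𝓡 m) ∞ M]

theorem inChart_baseBasis (ω' : Form (𝓡 m) M m) (c x : M) :
    ω'.inChart c x (baseBasis m) = coeff ω' c x := by
  rw [coe_baseBasis, coeff]

theorem continuousOn_inChart_baseBasis {ω' : Form (𝓡 m) M m} (hω' : ω'.IsVolumeForm) (c : M) :
    ContinuousOn (fun x => ω'.inChart c x (baseBasis m))
      (chartAt (EuclideanSpace ℝ (Fin m)) c).source := by
  simp only [inChart_baseBasis]
  exact (contMDiffOn_coeff hω' c).continuousOn

theorem continuousOn_wedgeDz_inChart {ω' : Form (𝓡 m) M m} (hω' : ω'.IsVolumeForm) (d : Cyl M) :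
    ContinuousOn (fun p => (wedgeDz ω').inChart d p (cylBasis m))
      (chartAt (ModelProd (EuclideanSpace ℝ (Fin m)) (EuclideanHalfSpace 1)) d).source := by
  obtain ⟨ε, z₀, hε, hφ, -⟩ := extChartAt_Icc_spec d.2
  have h : ContinuousOn (fun p : Cyl M => ε * coeff ω' d.1 p.1)
      (chartAt (ModelProd (EuclideanSpace ℝ (Fin m)) (EuclideanHalfSpace 1)) d).source :=
    continuousOn_const.mul ((contMDiffOn_coeff hω' d.1).continuousOn.comp continuousOn_fst
      fun p hp => (mem_cyl_chart_source.1 hp).1)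
  exact h.congr fun p hp => wedgeDz_inChart_cylBasis ω' hφ hε hp

variable [CompactSpace M]

/-- Fubini's theorem in a chart of the cylinder. -/
theorem exists_chartIntegral_eq_fibre {ω' : Form (𝓡 m) M m} (hω' : ω'.IsVolumeForm) :
    ∃ κ : ℝ, 0 < κ ∧ ∀ (c : M) (g : Cyl M → ℝ), Continuous g →
      (tsupport g ⊆ {p | p.1 ∈ (chartAt (EuclideanSpace ℝ (Fin m)) c).source ∧ -1 < (p.2 : ℝ)}) →
      chartIntegral (cylBasis m) (wedgeDz ω') g (c, endPt) =
        κ * chartIntegral (baseBasis m) ω' (fun x => fibreInt g x 1) c := by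
  obtain ⟨κ, hκ, hmap⟩ := exists_map_splitHeight m
  refine ⟨κ, hκ, fun c g hg hsupp => ?_⟩
  have hsupp' : tsupport g ⊆ (chartAt (ModelProd (EuclideanSpace ℝ (Fin m))
      (EuclideanHalfSpace 1)) (c, endPt)).source := by
    intro p hp
    rw [mem_cyl_chart_source]
    refine ⟨(hsupp hp).1, ?_⟩
    rw [chartAt_top_source]
    exact (hsupp hp).2
  -- The integrand in the coordinates (y, 1 - z), whose second component runs over [0, 2).
  let G : EuclideanSpace ℝ (Fin m) × ℝ → ℝ := fun q =>
    extendHeight g ((extChartAt (𝓡 m) c).symm q.1) (1 - q.2) *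
      |coeff ω' c ((extChartAt (𝓡 m) c).symm q.1)|
  have hpre : (extChartAt (cylModel m) (c, endPt)).target =
      splitHeight m ⁻¹' ((extChartAt (𝓡 m) c).target ×ˢ Ico 0 2) := by
    rw [extChartAt_prod, PartialEquiv.prod_target, extChartAt_top_target]
    rfl
  have hmeas := measurableSet_extChartAt_target (I := cylModel m) (c, (endPt : Icc (-1 : ℝ) 1))
  have hG : ∀ w ∈ (extChartAt (cylModel m) (c, endPt)).target,
      g ((extChartAt (cylModel m) (c, endPt)).symm w) *
        |(wedgeDz ω').inChart (c, endPt) ((extChartAt (cylModel m) (c, endPt)).symm w)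
          (cylBasis m)| = (G ∘ splitHeight m) w := by
    intro w hw
    have hs := (extChartAt (cylModel m) (c, (endPt : Icc (-1 : ℝ) 1))).map_target hw
    rw [extChartAt_source, mem_cyl_chart_source, chartAt_top_source] at hs
    rw [wedgeDz_inChart_endPt ω' hs.1 hs.2, abs_neg, extChartAt_endPt_symm_apply]
    rfl
  have hint : IntegrableOn (G ∘ splitHeight m) (extChartAt (cylModel m) (c, endPt)).target
      (cylBasis m).addHaar :=
    (integrableOn_chart (cylBasis m) hg (continuousOn_wedgeDz_inChart hω' _) hsupp').congr_fun hG
      hmeas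
  have hemb : MeasurableEmbedding (splitHeight m) :=
    (splitHeight m).toHomeomorph.measurableEmbedding
  rw [hpre, ← hemb.integrableOn_map_iff, hmap, IntegrableOn, Measure.restrict_smul] at hint
  replace hint := (integrable_smul_measure (c := (κ : ENNReal)) (by simpa using hκ.ne')
    ENNReal.coe_ne_top).1 hint
  rw [chartIntegral, setIntegral_congr_fun hmeas hG, hpre]
  simp only [Function.comp_apply]
  rw [← hemb.setIntegral_map, hmap, Measure.restrict_smul, integral_smul_nnreal_measure,
    setIntegral_prod _ hint, chartIntegral, baseBasis_addHaar]
  change (κ : ℝ) * _ = _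
  congr 1
  refine setIntegral_congr_fun (measurableSet_extChartAt_target c) fun y _ => ?_
  simp only [G, inChart_baseBasis]
  rw [integral_mul_const, integral_Ico_eq_integral_Ioc,
    ← intervalIntegral.integral_of_le (by norm_num), intervalIntegral.integral_comp_sub_left]
  norm_num [fibreInt]

end FibreMass

theorem mass_sum {E : Type*} [NormedAddCommGroup E] [NormedSpace ℝ E] [FiniteDimensional ℝ E]
    [MeasurableSpace E] [BorelSpace E] {H : Type*} [TopologicalSpace H] {I : ModelWithCorners ℝ E H}
    {N : Type*} [TopologicalSpace N] [ChartedSpace H N] [IsManifold I ∞ N] {n : ℕ} [T2Space N]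
    [CompactSpace N] (b : Module.Basis (Fin n) ℝ E) {o : Form I N n}
    (ho : ∀ c, ContinuousOn (fun x => o.inChart c x b) (chartAt H c).source)
    {ι : Type*} (s : Finset ι) {g : ι → N → ℝ} (hg : ∀ i, Continuous (g i)) :
    mass b o (fun x => ∑ i ∈ s, g i x) = ∑ i ∈ s, mass b o (g i) := by
  classical
  induction s using Finset.induction_on with
  | empty =>
    simp only [Finset.sum_empty]
    simpa using mass_const_mul b o 0 (fun _ => 0)
  | insert i s hi ih =>
    simp only [Finset.sum_insert hi]
    rw [mass_add b ho (hg i) (continuous_finsetSum _ fun j _ => hg j), ih]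

theorem tsupport_chartExtend_subset {m : ℕ} {M : Type*} [TopologicalSpace M] [T2Space M]
    [ChartedSpace (EuclideanSpace ℝ (Fin m)) M] {c : M} {R : ℝ}
    (hR : Metric.ball (extChartAt (𝓡 m) c c) R ⊆ (extChartAt (𝓡 m) c).target)
    {v : EuclideanSpace ℝ (Fin m) → ℝ}
    (hs : tsupport v ⊆ Metric.ball (extChartAt (𝓡 m) c c) R) :
    tsupport (chartExtend c R v) ⊆ (chartAt (EuclideanSpace ℝ (Fin m)) c).source := by
  have hcl : IsClosed ((extChartAt (𝓡 m) c).symm '' tsupport v) :=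
    isClosed_image_symm (isCompact_tsupport_of_subset_ball hs) (hs.trans hR)
  have h1 : tsupport (chartExtend c R v) ⊆ (extChartAt (𝓡 m) c).symm '' tsupport v := by
    refine closure_minimal (fun x hx => ?_) hcl
    by_contra h
    exact hx (chartExtend_eq_zero h)
  refine h1.trans ?_
  rintro _ ⟨y, hy, rfl⟩
  rw [← extChartAt_source (𝓡 m)]
  exact (extChartAt (𝓡 m) c).map_target (hR (hs hy))

section FibreMass

variable {m : ℕ} {M : Type*} [MetricSpace M] [ChartedSpace (EuclideanSpace ℝ (Fin m)) M]
  [IsManifold (𝓡 m) ∞ M] [CompactSpace M]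

theorem fibreInt_mul_left {M : Type*} (a : M → ℝ) (g : Cyl M → ℝ) (x : M) (t : ℝ) :
    fibreInt (fun p => a p.1 * g p) x t = a x * fibreInt g x t := by
  simp only [fibreInt, extendHeight]
  exact intervalIntegral.integral_const_mul _ _

theorem sum_chartPartition (x : M) :
    ∑ c ∈ (finite_chartPartition_ne_zero (𝓡 m) M).toFinset, chartPartition (𝓡 m) M c x = 1 := by
  rw [← (chartPartition (𝓡 m) M).sum_eq_one (mem_univ x)]
  refine (finsum_eq_sum_of_support_subset _ fun c hc => ?_).symm
  rw [Finite.coe_toFinset]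
  exact ⟨_, hc⟩

/-- The integral over the cylinder is the integral over the base of the integral over the
fibres. -/
theorem exists_mass_eq_fibre {ω' : Form (𝓡 m) M m} (hω' : ω'.IsVolumeForm) :
    ∃ κ : ℝ, 0 < κ ∧ ∀ g : Cyl M → ℝ, Continuous g → (∀ p : Cyl M, (p.2 : ℝ) ≤ 0 → g p = 0) →
      mass (cylBasis m) (wedgeDz ω') g =
        κ * mass (baseBasis m) ω' (fun x => fibreInt g x 1) := by
  obtain ⟨κ, hκ, h⟩ := exists_chartIntegral_eq_fibre hω'
  refine ⟨κ, hκ, fun g hg hg0 => ?_⟩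
  have hP : ∀ c, Continuous fun p : Cyl M => chartPartition (𝓡 m) M c p.1 := fun c =>
    (chartPartition (𝓡 m) M c).contMDiff.continuous.comp continuous_fst
  have hPg : ∀ c, Continuous fun p : Cyl M => chartPartition (𝓡 m) M c p.1 * g p := fun c =>
    (hP c).mul hg
  have hsum : mass (cylBasis m) (wedgeDz ω') g =
      ∑ c ∈ (finite_chartPartition_ne_zero (𝓡 m) M).toFinset,
        mass (cylBasis m) (wedgeDz ω') fun p => chartPartition (𝓡 m) M c p.1 * g p := by
    rw [← mass_sum (cylBasis m) (continuousOn_wedgeDz_inChart hω') _ hPg]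
    congr 1
    ext p
    rw [← Finset.sum_mul, sum_chartPartition, one_mul]
  rw [hsum, mass_eq_sum, Finset.mul_sum]
  refine Finset.sum_congr rfl fun c _ => ?_
  -- Since g vanishes for z ≤ 0, its support avoids height -1. A partition of unity of M, pulled
  -- back, therefore reduces everything to charts with the single height chart at `endPt`.
  have hsupp : tsupport (fun p : Cyl M => chartPartition (𝓡 m) M c p.1 * g p) ⊆
      {p | p.1 ∈ (chartAt (EuclideanSpace ℝ (Fin m)) c).source ∧ -1 < (p.2 : ℝ)} := by
    have h1 : IsClosed {p : Cyl M | p.1 ∈ tsupport (chartPartition (𝓡 m) M c) ∧ 0 ≤ (p.2 : ℝ)} :=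
      ((isClosed_tsupport _).preimage continuous_fst).inter
        (isClosed_le continuous_const (continuous_subtype_val.comp continuous_snd))
    refine (closure_minimal ?_ h1).trans ?_
    · intro p hp
      refine ⟨subset_tsupport _ (left_ne_zero_of_mul hp), ?_⟩
      by_contra! hneg
      exact right_ne_zero_of_mul hp (hg0 p hneg.le)
    · rintro p ⟨hp1, hp2⟩
      exact ⟨tsupport_chartPartition_subset c hp1, by linarith⟩
  have hsupp' : tsupport (fun p : Cyl M => chartPartition (𝓡 m) M c p.1 * g p) ⊆
      (chartAt (ModelProd (EuclideanSpace ℝ (Fin m))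
        (EuclideanHalfSpace 1)) ((c, endPt) : Cyl M)).source := by
    intro p hp
    rw [mem_cyl_chart_source]
    refine ⟨(hsupp hp).1, ?_⟩
    rw [chartAt_top_source]
    exact (hsupp hp).2
  rw [mass_eq_chartIntegral (cylBasis m) (continuousOn_wedgeDz_inChart hω' _) (hPg c)
    hsupp', h c _ (hPg c) hsupp]
  simp only [fibreInt_mul_left]

theorem chartIntegral_pos {ω' : Form (𝓡 m) M m} (hω' : ω'.IsVolumeForm) {e : M → ℝ}
    (he : Continuous e)
    {c x : M} (hc : tsupport e ⊆ (chartAt (EuclideanSpace ℝ (Fin m)) c).source)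
    (he0 : ∀ x, 0 ≤ e x) (hx : 0 < e x) : 0 < chartIntegral (baseBasis m) ω' e c := by
  rw [chartIntegral]
  have hint := integrableOn_chart (baseBasis m) he (continuousOn_inChart_baseBasis hω' c) hc
  rw [setIntegral_pos_iff_support_of_nonneg_ae
    (Eventually.of_forall fun y => mul_nonneg (he0 _) (abs_nonneg _)) hint, baseBasis_addHaar]
  have hxs : x ∈ (extChartAt (𝓡 m) c).source := by
    rw [extChartAt_source]
    exact hc (subset_tsupport _ hx.ne')
  have hopen : IsOpen ((extChartAt (𝓡 m) c).target ∩
      (extChartAt (𝓡 m) c).symm ⁻¹' {x | 0 < e x}) :=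
    (continuousOn_extChartAt_symm c).isOpen_inter_preimage (isOpen_extChartAt_target c)
      (isOpen_lt continuous_const he)
  refine (hopen.measure_pos volume ⟨extChartAt (𝓡 m) c x, (extChartAt (𝓡 m) c).map_source hxs,
    ?_⟩).trans_le (measure_mono ?_)
  · rw [mem_preimage, (extChartAt (𝓡 m) c).left_inv hxs]
    exact hx
  · rintro y ⟨hy, hy'⟩
    refine ⟨mul_ne_zero (ne_of_gt hy') (abs_ne_zero.2 ?_), hy⟩
    rw [inChart_baseBasis]
    refine coeff_ne_zero hω' ?_
    rw [← extChartAt_source (𝓡 m)]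
    exact (extChartAt (𝓡 m) c).map_target hy

theorem mass_pos {ω' : Form (𝓡 m) M m} (hω' : ω'.IsVolumeForm) {e : M → ℝ} (he : Continuous e)
    (he0 : ∀ x, 0 ≤ e x) {x : M} (hx : 0 < e x) : 0 < mass (baseBasis m) ω' e := by
  rw [mass_eq_sum]
  refine Finset.sum_pos' (fun c _ => ?_) ?_
  · exact setIntegral_nonneg (measurableSet_extChartAt_target c) fun y _ =>
      mul_nonneg (mul_nonneg ((chartPartition (𝓡 m) M).nonneg _ _) (he0 _)) (abs_nonneg _)
  · obtain ⟨c, hc⟩ := (chartPartition (𝓡 m) M).exists_pos_of_mem (mem_univ x)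
    refine ⟨c, by simpa using ⟨x, hc.ne'⟩, ?_⟩
    refine chartIntegral_pos hω' (x := x) ((chartPartition (𝓡 m) M c).contMDiff.continuous.mul he)
      ?_ (fun y => mul_nonneg ((chartPartition (𝓡 m) M).nonneg _ _) (he0 _)) (mul_pos hc hx)
    exact (tsupport_mul_subset_left (f := chartPartition (𝓡 m) M c) (g := e)).trans
      (tsupport_chartPartition_subset c)

theorem integral_fderiv_eq_zero {E : Type*} [NormedAddCommGroup E] [NormedSpace ℝ E]
    [FiniteDimensional ℝ E] [MeasurableSpace E] [BorelSpace E] {μ : Measure E}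
    [μ.IsAddHaarMeasure] {u : E → ℝ} (hu : ContDiff ℝ ∞ u) (hc : HasCompactSupport u) (v : E) :
    ∫ y, fderiv ℝ u y v ∂μ = 0 := by
  have hcont : Continuous fun y => fderiv ℝ u y v :=
    (hu.continuous_fderiv (by simp)).clm_apply continuous_const
  have hcs : HasCompactSupport fun y => fderiv ℝ u y v := hc.fderiv_apply ℝ v
  have h := integral_mul_fderiv_eq_neg_fderiv_mul_of_integrable (μ := μ) (f := fun _ : E => (1 : ℝ))
    (g := u) (v := v) (by simp) (by simpa using hcont.integrable_of_hasCompactSupport hcs)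
    (by simpa using hu.continuous.integrable_of_hasCompactSupport hc)
    (fun _ _ => differentiableAt_const _) (fun y _ => hu.differentiable (by simp) y)
  simpa using h

/-- Dividing by the weight cancels the density of ω', and what remains is the integral of a
derivative of a compactly supported function. -/
theorem mass_elemFun {ω' : Form (𝓡 m) M m} (hω' : ω'.IsVolumeForm) {c : M} {K R : ℝ}
    (hbox : IsBox ω' c K R) (k : Fin m) {u : EuclideanSpace ℝ (Fin m) → ℝ} (hu : ContDiff ℝ ∞ u)
    (hsupp : tsupport u ⊆ Metric.ball (extChartAt (𝓡 m) c c) R)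
    (hcont : Continuous (elemFun ω' c R k u)) :
    mass (baseBasis m) ω' (elemFun ω' c R k u) = 0 := by
  have hsv : tsupport (fun y => fderiv ℝ u y (EuclideanSpace.single k 1) / weight ω' c y) ⊆
      tsupport u :=
    closure_minimal (fun y hy => support_fderiv_subset ℝ fun h =>
      hy (by simp only [h, zero_apply, zero_div])) (isClosed_tsupport u)
  rw [mass_eq_chartIntegral (baseBasis m) (continuousOn_inChart_baseBasis hω' c) hcont
    (tsupport_chartExtend_subset hbox.subset_target (hsv.trans hsupp)), chartIntegral,
    baseBasis_addHaar]
  have hzero : ∀ y ∉ Metric.ball (extChartAt (𝓡 m) c c) R,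
      fderiv ℝ u y (EuclideanSpace.single k 1) = 0 := by
    intro y hy
    have : fderiv ℝ u y = 0 := by
      by_contra h
      exact hy (hsupp (support_fderiv_subset ℝ h))
    rw [this]; rfl
  have hEq : ∀ y ∈ (extChartAt (𝓡 m) c).target,
      elemFun ω' c R k u ((extChartAt (𝓡 m) c).symm y) *
        |ω'.inChart c ((extChartAt (𝓡 m) c).symm y) (baseBasis m)| =
      fderiv ℝ u y (EuclideanSpace.single k 1) * |coeff ω' c c| := by
    intro y hy
    by_cases hyb : y ∈ Metric.ball (extChartAt (𝓡 m) c c) R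
    · have hw : 0 < weight ω' c y := by linarith [hbox.half_le y hyb]
      rw [elemFun, chartExtend_of_mem (symm_mem_chartBall hbox.subset_target hyb),
        (extChartAt (𝓡 m) c).right_inv hy, inChart_baseBasis,
        coeff_eq_weight_mul hω' ((extChartAt (𝓡 m) c).map_target hy),
        (extChartAt (𝓡 m) c).right_inv hy, abs_mul, abs_of_pos hw]
      field_simp
    · rw [elemFun, chartExtend_of_notMem, hzero y hyb, zero_mul, zero_mul]
      rintro ⟨-, h⟩
      rw [mem_preimage, (extChartAt (𝓡 m) c).right_inv hy] at h
      exact hyb h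
  rw [setIntegral_congr_fun (measurableSet_extChartAt_target c) hEq, integral_mul_const,
    setIntegral_eq_integral_of_forall_compl_eq_zero,
    integral_fderiv_eq_zero hu (isCompact_tsupport_of_subset_ball hsupp), zero_mul]
  exact fun y hy => hzero y fun h => hy (hbox.subset_target h)

end FibreMass

/-! ### Writing a function on a cube as a divergence plus a multiple of a bump, with bounds. -/

section Averaging

variable {m : ℕ}

theorem contDiff_linePrimitive (k : Fin m) {h : EuclideanSpace ℝ (Fin m) → ℝ} (hh : ContDiff ℝ ∞ h)
    (l : ℝ) : ContDiff ℝ ∞ (fun q : EuclideanSpace ℝ (Fin m) × ℝ =>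
      ∫ s in l..q.2, h (setCoord k q.1 s)) := by
  rw [← contDiffOn_univ, ← univ_prod_univ]
  exact contDiffOn_primitive (a := fun q => h (setCoord k q.1 q.2)) convex_univ uniqueDiffOn_univ
    convex_univ uniqueDiffOn_univ (mem_univ l) (hh.comp (contDiff_setCoord k)).contDiffOn

/-- The function `h` vanishes outside the closed cube with centre `y₀` and edge length `2 * q`. -/
def InCube (y₀ : EuclideanSpace ℝ (Fin m)) (q : ℝ) (h : EuclideanSpace ℝ (Fin m) → ℝ) : Prop :=
  ∀ y k, q < |y k - y₀ k| → h y = 0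

/-- A smooth nonnegative function with integral one supported in `[-q, q]`. -/
structure IsKernel (q A : ℝ) (θ : ℝ → ℝ) : Prop where
  smooth : ContDiff ℝ ∞ θ
  nonneg : ∀ t, 0 ≤ θ t
  le : ∀ t, θ t ≤ A
  eq_zero : ∀ t, q < |t| → θ t = 0
  integral_eq : ∫ t in (-q)..q, θ t = 1
  pos : 0 < θ 0

theorem exists_isKernel {q : ℝ} (hq : 0 < q) : ∃ A θ, IsKernel q A θ := by
  let f : ContDiffBump (0 : ℝ) := ⟨q / 2, q, by linarith, by linarith⟩
  have hsupp : Function.support (f.normed volume) = Metric.ball 0 q := f.support_normed_eq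
  obtain ⟨A, hA⟩ := f.continuous_normed.bounded_above_of_compact_support
    (f.hasCompactSupport_normed (μ := volume))
  refine ⟨A, f.normed volume, f.contDiff_normed, f.nonneg_normed,
    fun t => (le_abs_self _).trans (hA t), fun t ht => ?_, ?_, ?_⟩
  · by_contra h
    have : t ∈ Metric.ball (0 : ℝ) q := hsupp ▸ h
    rw [Metric.mem_ball, dist_zero_right, Real.norm_eq_abs] at this
    linarith
  · rw [intervalIntegral.integral_eq_integral_of_support_subset, f.integral_normed]
    rw [hsupp, Real.ball_eq_Ioo]
    simpa using Ioo_subset_Ioc_self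
  · refine lt_of_le_of_ne (f.nonneg_normed 0) (Ne.symm ?_)
    have : (0 : ℝ) ∈ Function.support (f.normed volume) := hsupp ▸ Metric.mem_ball_self hq
    exact this

/-- The function obtained from `h` by concentrating its integrals over the lines parallel to the
coordinate `k` according to the profile `θ`. -/
def lineAvg (θ : ℝ → ℝ) (q : ℝ) (y₀ : EuclideanSpace ℝ (Fin m)) (k : Fin m)
    (h : EuclideanSpace ℝ (Fin m) → ℝ) (y : EuclideanSpace ℝ (Fin m)) : ℝ :=
  θ (y k - y₀ k) * ∫ s in (y₀ k - q)..(y₀ k + q), h (setCoord k y s)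

/-- The function `h` depends on the coordinate `j` through the factor `θ`. -/
def HasProfile (θ : ℝ → ℝ) (y₀ : EuclideanSpace ℝ (Fin m)) (j : Fin m)
    (h : EuclideanSpace ℝ (Fin m) → ℝ) : Prop :=
  ∀ y t, h (setCoord j y t) * θ (y j - y₀ j) = h y * θ (t - y₀ j)

theorem setCoord_comm {j k : Fin m} (hjk : j ≠ k) (y : EuclideanSpace ℝ (Fin m)) (s t : ℝ) :
    setCoord j (setCoord k y s) t = setCoord k (setCoord j y t) s := by
  ext i
  by_cases hj : i = j
  · subst hj
    rw [setCoord_same, setCoord_of_ne hjk, setCoord_same]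
  · by_cases hk : i = k
    · subst hk
      rw [setCoord_of_ne hj, setCoord_same, setCoord_same]
    · rw [setCoord_of_ne hj, setCoord_of_ne hk, setCoord_of_ne hk, setCoord_of_ne hj]

theorem continuous_setCoord (k : Fin m) (y : EuclideanSpace ℝ (Fin m)) :
    Continuous fun s => setCoord k y s :=
  continuous_iff_continuousAt.2 fun t => (hasDerivAt_setCoord k y t).continuousAt

theorem contDiff_coord (k : Fin m) : ContDiff ℝ ∞ fun y : EuclideanSpace ℝ (Fin m) => y k :=
  (EuclideanSpace.proj k : EuclideanSpace ℝ (Fin m) →L[ℝ] ℝ).contDiff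

variable {q A : ℝ} {θ : ℝ → ℝ} {y₀ : EuclideanSpace ℝ (Fin m)} {k : Fin m}
  {h : EuclideanSpace ℝ (Fin m) → ℝ}

theorem IsKernel.contDiff_lineAvg (hθ : IsKernel q A θ) (hh : ContDiff ℝ ∞ h) :
    ContDiff ℝ ∞ (lineAvg θ q y₀ k h) :=
  (hθ.smooth.comp ((contDiff_coord k).sub contDiff_const)).mul
    ((contDiff_linePrimitive k hh (y₀ k - q)).comp (contDiff_id.prodMk contDiff_const))

theorem IsKernel.inCube_lineAvg (hθ : IsKernel q A θ) (hh : InCube y₀ q h) :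
    InCube y₀ q (lineAvg θ q y₀ k h) := by
  intro y j hj
  by_cases hjk : j = k
  · subst hjk
    rw [lineAvg, hθ.eq_zero _ hj, zero_mul]
  · have : ∀ s, h (setCoord k y s) = 0 := fun s => hh _ j (by rwa [setCoord_of_ne hjk])
    simp [lineAvg, this]

theorem abs_integral_le {a b S : ℝ} {f : ℝ → ℝ} (hab : a ≤ b) (hf : ∀ t, |f t| ≤ S) :
    |∫ t in a..b, f t| ≤ S * (b - a) := by
  have := intervalIntegral.norm_integral_le_of_norm_le_const (a := a) (b := b) (f := f) (C := S)
    fun t _ => hf t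
  rwa [Real.norm_eq_abs, abs_of_nonneg (by linarith : 0 ≤ b - a)] at this

theorem IsKernel.abs_lineAvg_le (hθ : IsKernel q A θ) (hq : 0 < q) {S : ℝ} (hS : ∀ y, |h y| ≤ S)
    (y : EuclideanSpace ℝ (Fin m)) : |lineAvg θ q y₀ k h y| ≤ A * (2 * q * S) := by
  have h1 := abs_integral_le (a := y₀ k - q) (b := y₀ k + q) (by linarith)
    (fun s => hS (setCoord k y s))
  rw [lineAvg, abs_mul, abs_of_nonneg (hθ.nonneg _)]
  exact mul_le_mul (hθ.le _) (by linarith) (abs_nonneg _) ((hθ.nonneg _).trans (hθ.le 0))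

theorem hasProfile_lineAvg : HasProfile θ y₀ k (lineAvg θ q y₀ k h) := by
  intro y t
  simp only [lineAvg, setCoord_same, setCoord_setCoord]
  ring

theorem HasProfile.lineAvg {j : Fin m} (hj : HasProfile θ y₀ j h) (hjk : j ≠ k) :
    HasProfile θ y₀ j (lineAvg θ q y₀ k h) := by
  intro y t
  simp only [VolumeAdjust.lineAvg]
  rw [setCoord_of_ne hjk.symm, mul_assoc, mul_assoc, ← intervalIntegral.integral_mul_const,
    ← intervalIntegral.integral_mul_const]
  congr 2
  ext s
  have := hj (setCoord k y s) t
  rwa [setCoord_comm hjk, setCoord_of_ne hjk] at this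

/-- Subtracting `lineAvg` makes the integral over each line parallel to the k-th axis vanish. The
primitive started at the lower face is therefore zero again beyond the upper face. An interval of
length at most 2q and the bound (1 + 2qA) S on the integrand give the constant. -/
theorem IsKernel.exists_primitive (hθ : IsKernel q A θ) (hq : 0 < q) (hh : ContDiff ℝ ∞ h)
    (hc : InCube y₀ q h) {S : ℝ} (hS : ∀ y, |h y| ≤ S) :
    ∃ u : EuclideanSpace ℝ (Fin m) → ℝ, ContDiff ℝ ∞ u ∧ InCube y₀ q u ∧
      (∀ y, |u y| ≤ (1 + A * (2 * q)) * (2 * q) * S) ∧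
      ∀ y, fderiv ℝ u y (EuclideanSpace.single k 1) = h y - lineAvg θ q y₀ k h y := by
  set g : EuclideanSpace ℝ (Fin m) → ℝ := fun y => h y - lineAvg θ q y₀ k h y with hg
  have hgs : ContDiff ℝ ∞ g := hh.sub (hθ.contDiff_lineAvg hh)
  have hgc : InCube y₀ q g := fun y j hj => by
    rw [hg]; simp only; rw [hc y j hj, hθ.inCube_lineAvg hc y j hj, sub_zero]
  have hgS : ∀ y, |g y| ≤ (1 + A * (2 * q)) * S := fun y => by
    refine (abs_sub _ _).trans ?_
    linarith [hS y, hθ.abs_lineAvg_le hq hS (y₀ := y₀) (k := k) y]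
  have hgcont : ∀ y, Continuous fun s => g (setCoord k y s) := fun y =>
    hgs.continuous.comp (continuous_setCoord k y)
  let u : EuclideanSpace ℝ (Fin m) → ℝ := fun y => ∫ s in (y₀ k - q)..(y k), g (setCoord k y s)
  have hu : ContDiff ℝ ∞ u :=
    (contDiff_linePrimitive k hgs (y₀ k - q)).comp (contDiff_id.prodMk (contDiff_coord k))
  have hzero : ∀ y, ∀ a b, (∀ s, s ∈ uIcc a b → q ≤ |s - y₀ k|) →
      ∫ s in a..b, g (setCoord k y s) = 0 := by
    intro y a b hab
    have : ∀ s ∈ uIcc a b, g (setCoord k y s) = 0 := by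
      intro s hs
      have hclosed : ∀ s, q ≤ |s - y₀ k| → g (setCoord k y s) = 0 := by
        intro s hs
        rcases hs.lt_or_eq with hlt | heq
        · exact hgc _ k (by rwa [setCoord_same])
        -- `InCube` says nothing on the faces, where the distance equals q; continuity extends the
        -- vanishing to them.
        · have hmem : s ∈ closure {s : ℝ | q < |s - y₀ k|} := by
            rw [Metric.mem_closure_iff]
            intro ε hε
            rcases le_total 0 (s - y₀ k) with h0 | h0
            · refine ⟨s + ε / 2, ?_, ?_⟩
              · rw [abs_of_nonneg h0] at heq
                rw [mem_ofPred_eq, abs_of_nonneg (by linarith)]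
                linarith
              · rw [Real.dist_eq]
                rw [abs_of_nonpos (by linarith)]
                linarith
            · refine ⟨s - ε / 2, ?_, ?_⟩
              · rw [abs_of_nonpos h0] at heq
                rw [mem_ofPred_eq, abs_of_nonpos (by linarith)]
                linarith
              · rw [Real.dist_eq]
                rw [abs_of_nonneg (by linarith)]
                linarith
          have : closure {s : ℝ | q < |s - y₀ k|} ⊆ {s | g (setCoord k y s) = 0} :=
            closure_minimal (fun s hs => hgc _ k (by rwa [setCoord_same]))
              (isClosed_eq (hgcont y) continuous_const)
          exact this hmem
      exact hclosed s (hab s hs)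
    rw [intervalIntegral.integral_congr this, intervalIntegral.integral_zero]
  have htotal : ∀ y, ∫ s in (y₀ k - q)..(y₀ k + q), g (setCoord k y s) = 0 := by
    intro y
    have hcont : Continuous fun s => h (setCoord k y s) :=
      hh.continuous.comp (continuous_setCoord k y)
    have hθi : ∫ s in (y₀ k - q)..(y₀ k + q), θ (s - y₀ k) = 1 := by
      rw [intervalIntegral.integral_comp_sub_right]
      simpa using hθ.integral_eq
    have hθc : Continuous fun s => θ (s - y₀ k) := hθ.smooth.continuous.comp (by fun_prop)
    simp only [hg, lineAvg, setCoord_same, setCoord_setCoord]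
    rw [intervalIntegral.integral_sub (hcont.intervalIntegrable _ _)
      ((hθc.intervalIntegrable _ _).mul_const _), intervalIntegral.integral_mul_const,
      hθi, one_mul, sub_self]
  have huc : InCube y₀ q u := by
    intro y j hj
    by_cases hjk : j = k
    · subst hjk
      rcases le_total 0 (y j - y₀ j) with h0 | h0
      · rw [abs_of_nonneg h0] at hj
        have hi : ∀ a b, IntervalIntegrable (fun s => g (setCoord j y s)) volume a b := fun a b =>
          (hgcont y).intervalIntegrable a b
        have := intervalIntegral.integral_add_adjacent_intervals (hi (y₀ j - q) (y₀ j + q))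
          (hi (y₀ j + q) (y j))
        simp only [u]
        rw [← this, htotal, zero_add]
        -- Beyond the upper face the primitive is the full line integral, which is zero, plus an
        -- integral outside the cube.
        refine hzero y _ _ fun s hs => ?_
        rw [uIcc_of_le (by linarith)] at hs
        exact (by linarith [hs.1] : q ≤ s - y₀ j).trans (le_abs_self _)
      · rw [abs_of_nonpos h0] at hj
        refine hzero y _ _ fun s hs => ?_
        rw [uIcc_of_ge (by linarith)] at hs
        exact (by linarith [hs.2] : q ≤ -(s - y₀ j)).trans (neg_le_abs _)
    · have : ∀ s, g (setCoord k y s) = 0 := fun s => hgc _ j (by rwa [setCoord_of_ne hjk])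
      simp [u, this]
  refine ⟨u, hu, huc, fun y => ?_, fun y => ?_⟩
  · by_cases hy : q < |y k - y₀ k|
    · have hS0 : 0 ≤ S := (abs_nonneg _).trans (hS y)
      have hA0 : 0 ≤ A := (hθ.nonneg 0).trans (hθ.le 0)
      rw [huc y k hy, abs_zero]
      positivity
    · have hy' := abs_le.1 (not_lt.1 hy)
      have hS0 : 0 ≤ (1 + A * (2 * q)) * S := (abs_nonneg _).trans (hgS y)
      have := abs_integral_le (a := y₀ k - q) (b := y k) (by linarith)
        (fun s => hgS (setCoord k y s))
      have h2 : y k - (y₀ k - q) ≤ 2 * q := by linarith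
      calc |u y| ≤ (1 + A * (2 * q)) * S * (y k - (y₀ k - q)) := this
        _ ≤ (1 + A * (2 * q)) * S * (2 * q) := mul_le_mul_of_nonneg_left h2 hS0
        _ = _ := by ring
  · have h1 : HasDerivAt (fun t => u (setCoord k y t))
        (fderiv ℝ u y (EuclideanSpace.single k 1)) (y k) := by
      have hd := (hu.differentiable (by simp) (setCoord k y (y k))).hasFDerivAt
      have := hd.comp_hasDerivAt (y k) (hasDerivAt_setCoord k y (y k))
      rwa [setCoord_self] at this
    have h2 : HasDerivAt (fun t => u (setCoord k y t)) (g y) (y k) := by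
      have e : (fun t => u (setCoord k y t)) = fun t =>
          ∫ s in (y₀ k - q)..t, g (setCoord k y s) := by
        ext t
        simp only [u, setCoord_same, setCoord_setCoord]
      rw [e]
      have := intervalIntegral.integral_hasDerivAt_right
        ((hgcont y).intervalIntegrable (y₀ k - q) (y k))
        ((hgcont y).stronglyMeasurableAtFilter _ _) (hgcont y).continuousAt
      rwa [setCoord_self] at this
    exact h1.unique h2

/-- A function with profile θ in every coordinate is a multiple of the product of the profiles. The
coordinates are moved to y₀ one by one, and the identity is kept multiplied out because θ has zeros.
-/
theorem apply_mul_prod_eq_of_hasProfile (hp : ∀ j, HasProfile θ y₀ j h) (s : Finset (Fin m)) :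
    ∀ y : EuclideanSpace ℝ (Fin m), (∀ j ∉ s, y j = y₀ j) →
      h y * ∏ _j ∈ s, θ 0 = h y₀ * ∏ j ∈ s, θ (y j - y₀ j) := by
  classical
  induction s using Finset.induction_on with
  | empty =>
    intro y hy
    have : y = y₀ := by ext j; exact hy j (Finset.notMem_empty j)
    rw [this]
    simp
  | insert k s hk ih =>
    intro y hy
    have h1 := ih (setCoord k y (y₀ k)) fun j hj => by
      by_cases hjk : j = k
      · rw [hjk, setCoord_same]
      · rw [setCoord_of_ne hjk]
        exact hy j (by simp [hjk, hj])
    have h2 := hp k y (y₀ k)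
    rw [sub_self] at h2
    have h3 : ∏ j ∈ s, θ (setCoord k y (y₀ k) j - y₀ j) = ∏ j ∈ s, θ (y j - y₀ j) :=
      Finset.prod_congr rfl fun j hj => by rw [setCoord_of_ne (ne_of_mem_of_not_mem hj hk)]
    rw [h3] at h1
    rw [Finset.prod_insert hk, Finset.prod_insert hk, ← mul_assoc, ← h2]
    linear_combination θ (y k - y₀ k) * h1

/-- Induction on the averaged coordinates. Averaging the remainder over a new coordinate costs one
derivative term and keeps the profiles already acquired, since they pass through the integral. -/
theorem IsKernel.exists_partial_decomposition (hθ : IsKernel q A θ) (hq : 0 < q)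
    (y₀ : EuclideanSpace ℝ (Fin m)) (s : Finset (Fin m)) :
    ∃ B : ℝ, 0 ≤ B ∧ ∀ (h : EuclideanSpace ℝ (Fin m) → ℝ) (S : ℝ), ContDiff ℝ ∞ h →
      InCube y₀ q h → (∀ y, |h y| ≤ S) →
      ∃ (u : Fin m → EuclideanSpace ℝ (Fin m) → ℝ) (g : EuclideanSpace ℝ (Fin m) → ℝ),
        (∀ k, ContDiff ℝ ∞ (u k) ∧ InCube y₀ q (u k) ∧ ∀ y, |u k y| ≤ B * S) ∧
        ContDiff ℝ ∞ g ∧ InCube y₀ q g ∧ (∀ y, |g y| ≤ B * S) ∧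
        (∀ j ∈ s, HasProfile θ y₀ j g) ∧
        ∀ y, h y = ∑ k ∈ s, fderiv ℝ (u k) y (EuclideanSpace.single k 1) + g y := by
  classical
  have hA0 : 0 ≤ A := (hθ.nonneg 0).trans (hθ.le 0)
  induction s using Finset.induction_on with
  | empty =>
    refine ⟨1, zero_le_one, fun h S hh hc hS => ⟨fun _ _ => 0, h, fun k => ⟨contDiff_const,
      fun _ _ _ => rfl, fun y => ?_⟩, hh, hc, by simpa using hS, by simp, by simp⟩⟩
    simpa using (abs_nonneg _).trans (hS y)
  | insert k s hk ih =>
    obtain ⟨B, hB, ih⟩ := ih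
    have hB1 : 0 ≤ A * (2 * q * B) := by positivity
    have hB2 : 0 ≤ (1 + A * (2 * q)) * (2 * q) * B := by positivity
    -- The three summands bound the old primitives, the new remainder and the new primitive.
    refine ⟨B + A * (2 * q * B) + (1 + A * (2 * q)) * (2 * q) * B, by positivity,
      fun h S hh hc hS => ?_⟩
    have hS0 : 0 ≤ S := (abs_nonneg _).trans (hS y₀)
    obtain ⟨u, g, hu, hg, hgc, hgS, hgp, heq⟩ := ih h S hh hc hS
    obtain ⟨v, hv, hvc, hvS, hvd⟩ := hθ.exists_primitive (k := k) hq hg hgc hgS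
    refine ⟨Function.update u k v, lineAvg θ q y₀ k g, fun j => ?_, hθ.contDiff_lineAvg hg,
      hθ.inCube_lineAvg hgc, fun y => ?_, fun j hj => ?_, fun y => ?_⟩
    · by_cases hj : j = k
      · subst hj
        rw [Function.update_self]
        refine ⟨hv, hvc, fun y => (hvS y).trans ?_⟩
        nlinarith [mul_nonneg hB hS0, mul_nonneg hB1 hS0]
      · rw [Function.update_of_ne hj]
        refine ⟨(hu j).1, (hu j).2.1, fun y => ((hu j).2.2 y).trans ?_⟩
        nlinarith [mul_nonneg hB1 hS0, mul_nonneg hB2 hS0]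
    · refine (hθ.abs_lineAvg_le hq hgS y).trans ?_
      nlinarith [mul_nonneg hB hS0, mul_nonneg hB2 hS0]
    · by_cases hjk : j = k
      · rw [hjk]
        exact hasProfile_lineAvg
      · exact (hgp j ((Finset.mem_insert.1 hj).resolve_left hjk)).lineAvg hjk
    · rw [heq y, Finset.sum_insert hk, Function.update_self, hvd]
      have : ∑ j ∈ s, fderiv ℝ (Function.update u k v j) y (EuclideanSpace.single j 1) =
          ∑ j ∈ s, fderiv ℝ (u j) y (EuclideanSpace.single j 1) :=
        Finset.sum_congr rfl fun j hj => by
          rw [Function.update_of_ne (ne_of_mem_of_not_mem hj hk)]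
      rw [this]
      ring

/-- A function supported in a cube is a divergence plus a multiple of a fixed function, with
bounds. -/
theorem exists_divergence_decomposition (y₀ : EuclideanSpace ℝ (Fin m)) (hq : 0 < q) :
    ∃ (Θ : EuclideanSpace ℝ (Fin m) → ℝ) (B : ℝ), ContDiff ℝ ∞ Θ ∧ InCube y₀ q Θ ∧
      (∀ y, 0 ≤ Θ y) ∧ 0 < Θ y₀ ∧ 0 ≤ B ∧ ∀ (h : EuclideanSpace ℝ (Fin m) → ℝ) (S : ℝ),
        ContDiff ℝ ∞ h → InCube y₀ q h → (∀ y, |h y| ≤ S) →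
        ∃ (u : Fin m → EuclideanSpace ℝ (Fin m) → ℝ) (r : ℝ),
          (∀ k, ContDiff ℝ ∞ (u k) ∧ InCube y₀ q (u k) ∧ ∀ y, |u k y| ≤ B * S) ∧ |r| ≤ B * S ∧
          ∀ y, h y = ∑ k, fderiv ℝ (u k) y (EuclideanSpace.single k 1) + r * Θ y := by
  obtain ⟨A, θ, hθ⟩ := exists_isKernel hq
  obtain ⟨B, hB, hdec⟩ := hθ.exists_partial_decomposition hq y₀ Finset.univ
  have hP : 0 < ∏ _j : Fin m, θ 0 := Finset.prod_pos fun _ _ => hθ.pos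
  have hBP : 0 ≤ B / ∏ _j : Fin m, θ 0 := div_nonneg hB hP.le
  refine ⟨fun y => ∏ j, θ (y j - y₀ j), B + B / ∏ _j : Fin m, θ 0,
    contDiff_prod fun j _ => hθ.smooth.comp ((contDiff_coord j).sub contDiff_const),
    fun y k hk => Finset.prod_eq_zero (Finset.mem_univ k) (hθ.eq_zero _ hk),
    fun y => Finset.prod_nonneg fun j _ => hθ.nonneg _, by simpa using hP, add_nonneg hB hBP, ?_⟩
  intro h S hh hc hS
  have hS0 : 0 ≤ S := (abs_nonneg _).trans (hS y₀)
  obtain ⟨u, g, hu, hg, hgc, hgS, hgp, heq⟩ := hdec h S hh hc hS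
  -- Once all coordinates are averaged, the remainder is a multiple of the product of the profiles.
  -- Its value at y₀ gives the factor.
  refine ⟨u, g y₀ / ∏ _j : Fin m, θ 0, fun k => ⟨(hu k).1, (hu k).2.1, fun y =>
    ((hu k).2.2 y).trans ?_⟩, ?_, fun y => ?_⟩
  · nlinarith [mul_nonneg hBP hS0]
  · rw [abs_div, abs_of_pos hP]
    calc |g y₀| / ∏ _j : Fin m, θ 0 ≤ B * S / ∏ _j : Fin m, θ 0 := by gcongr; exact hgS y₀
      _ = B / (∏ _j : Fin m, θ 0) * S := by ring
      _ ≤ _ := by nlinarith [mul_nonneg hB hS0]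
  · rw [heq y, add_right_inj]
    have := apply_mul_prod_eq_of_hasProfile (fun j => hgp j (Finset.mem_univ j)) Finset.univ y
      (fun j hj => absurd (Finset.mem_univ j) hj)
    rw [div_mul_eq_mul_div, eq_div_iff hP.ne']
    exact this

end Averaging

/-! ### Finite sums of elementary functions and their transport. -/

section Decomposition

variable {m : ℕ} {M : Type*} [MetricSpace M] [ChartedSpace (EuclideanSpace ℝ (Fin m)) M]
  [IsManifold (𝓡 m) ∞ M] {ω' : Form (𝓡 m) M m}

theorem contMDiff_chartExtend_div_weight (hω' : ω'.IsVolumeForm) {c : M} {K R : ℝ}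
    (hbox : IsBox ω' c K R) {v : EuclideanSpace ℝ (Fin m) → ℝ} (hv : ContDiff ℝ ∞ v)
    (hs : tsupport v ⊆ Metric.ball (extChartAt (𝓡 m) c c) R) :
    ContMDiff (𝓡 m) 𝓘(ℝ, ℝ) ∞ (chartExtend c R fun y => v y / weight ω' c y) := by
  have hs' : tsupport (fun y => v y / weight ω' c y) ⊆ Metric.ball (extChartAt (𝓡 m) c c) R := by
    refine (closure_mono fun y hy => ?_ : tsupport (fun y => v y / weight ω' c y) ⊆ tsupport v).trans
      hs
    intro h
    exact hy (by simp only [h, zero_div])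
  refine contMDiff_chartExtend hbox.subset_target ?_ hs'
  refine contDiff_of_contDiffOn_of_tsupport_subset Metric.isOpen_ball ?_ hs'
  refine hv.contDiffOn.div ((contDiffOn_weight hω' c).mono hbox.subset_target) fun y hy => ?_
  linarith [hbox.half_le y hy]

theorem tsupport_fderiv_apply_subset {E : Type*} [NormedAddCommGroup E] [NormedSpace ℝ E]
    (u : E → ℝ) (v : E) : tsupport (fun y => fderiv ℝ u y v) ⊆ tsupport u :=
  closure_minimal (fun y hy => support_fderiv_subset ℝ fun h =>
    hy (by simp only [h, zero_apply])) (isClosed_tsupport u)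

theorem contMDiff_elemFun (hω' : ω'.IsVolumeForm) {c : M} {K R : ℝ}
    (hbox : IsBox ω' c K R) (k : Fin m) {u : EuclideanSpace ℝ (Fin m) → ℝ} (hu : ContDiff ℝ ∞ u)
    (hs : tsupport u ⊆ Metric.ball (extChartAt (𝓡 m) c c) R) :
    ContMDiff (𝓡 m) 𝓘(ℝ, ℝ) ∞ (elemFun ω' c R k u) :=
  contMDiff_chartExtend_div_weight hω' hbox
    ((hu.fderiv_right (m := ∞) (by simp)).clm_apply contDiff_const)
    ((tsupport_fderiv_apply_subset u _).trans hs)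

theorem elemFun_const_mul {u : EuclideanSpace ℝ (Fin m) → ℝ} (hu : ContDiff ℝ ∞ u) (c : M) (R : ℝ)
    (k : Fin m) (r : ℝ) (x : M) :
    elemFun ω' c R k (fun y => r * u y) x = r * elemFun ω' c R k u x := by
  by_cases hx : x ∈ chartBall m c R
  · rw [elemFun, elemFun, chartExtend_of_mem hx, chartExtend_of_mem hx,
      fderiv_const_mul (hu.differentiable (by simp) _), mul_div_assoc']
    rfl
  · rw [elemFun, elemFun, chartExtend_of_notMem hx, chartExtend_of_notMem hx, mul_zero]

/-- `h` is a finite sum of elementary functions `elemFun ω' c R k u`, and `B` is the sum of the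
bounds `K * sup |u|`, where `K` is the Lipschitz constant of the box. -/
inductive IsDec (ω' : Form (𝓡 m) M m) : (M → ℝ) → ℝ → Prop
  | zero : IsDec ω' (fun _ => 0) 0
  | add_elemFun {h : M → ℝ} {B : ℝ} {c : M} {K R : ℝ} {k : Fin m}
      {u : EuclideanSpace ℝ (Fin m) → ℝ} {s : ℝ} (hh : IsDec ω' h B) (hbox : IsBox ω' c K R)
      (hu : ContDiff ℝ ∞ u) (hsupp : tsupport u ⊆ Metric.ball (extChartAt (𝓡 m) c c) R)
      (hs : ∀ y, |u y| ≤ s) : IsDec ω' (fun x => h x + elemFun ω' c R k u x) (B + K * s)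

variable {h h' : M → ℝ} {B B' : ℝ}

theorem IsDec.congr (hh : IsDec ω' h B) (e : ∀ x, h x = h' x) (eB : B = B') : IsDec ω' h' B' := by
  rwa [← funext e, ← eB]

theorem IsDec.nonneg (hh : IsDec ω' h B) : 0 ≤ B := by
  induction hh with
  | zero => exact le_rfl
  | add_elemFun hh hbox hu hsupp hs ih =>
    exact add_nonneg ih (mul_nonneg hbox.K_pos.le ((abs_nonneg _).trans (hs 0)))

theorem IsDec.contMDiff (hω' : ω'.IsVolumeForm) (hh : IsDec ω' h B) :
    ContMDiff (𝓡 m) 𝓘(ℝ, ℝ) ∞ h := by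
  induction hh with
  | zero => exact contMDiff_const
  | add_elemFun hh hbox hu hsupp hs ih => exact ih.add (contMDiff_elemFun hω' hbox _ hu hsupp)

theorem IsDec.add (hh : IsDec ω' h B) (hh' : IsDec ω' h' B') :
    IsDec ω' (fun x => h x + h' x) (B + B') := by
  induction hh' with
  | zero => exact hh.congr (fun x => (add_zero _).symm) (add_zero _).symm
  | add_elemFun _ hbox hu hsupp hs ih =>
    exact (ih.add_elemFun hbox hu hsupp hs).congr (fun x => add_assoc _ _ _) (add_assoc _ _ _)

theorem IsDec.const_mul (hh : IsDec ω' h B) (r : ℝ) : IsDec ω' (fun x => r * h x) (|r| * B) := by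
  induction hh with
  | zero => exact IsDec.zero.congr (fun x => (mul_zero _).symm) (mul_zero _).symm
  | @add_elemFun h B c K R k u s _ hbox hu hsupp hs ih =>
    have h1 : tsupport (fun y => r * u y) ⊆ Metric.ball (extChartAt (𝓡 m) c c) R :=
      (tsupport_mul_subset_right (f := fun _ => r) (g := u)).trans hsupp
    refine (ih.add_elemFun (k := k) (s := |r| * s) hbox (contDiff_const.mul hu) h1 fun y => ?_).congr
      (fun x => ?_) (by ring)
    · rw [abs_mul]
      exact mul_le_mul_of_nonneg_left (hs y) (abs_nonneg r)
    · rw [elemFun_const_mul hu]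
      ring

theorem IsDec.sum {ι : Type*} (s : Finset ι) {g : ι → M → ℝ} {b : ι → ℝ}
    (hg : ∀ i ∈ s, IsDec ω' (g i) (b i)) :
    IsDec ω' (fun x => ∑ i ∈ s, g i x) (∑ i ∈ s, b i) := by
  classical
  induction s using Finset.induction_on with
  | empty => exact IsDec.zero
  | insert i s hi ih =>
    refine ((hg i (Finset.mem_insert_self i s)).add
      (ih fun j hj => hg j (Finset.mem_insert_of_mem hj))).congr (fun x => ?_) ?_
    · rw [Finset.sum_insert hi]
    · rw [Finset.sum_insert hi]

theorem IsDec.mass_eq_zero [CompactSpace M] (hω' : ω'.IsVolumeForm) (hh : IsDec ω' h B) :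
    mass (baseBasis m) ω' h = 0 := by
  induction hh with
  | zero => simpa using mass_const_mul (baseBasis m) ω' 0 (fun _ => 0)
  | @add_elemFun h B c K R k u s hh hbox hu hsupp hs ih =>
    have h1 := (contMDiff_elemFun hω' hbox k hu hsupp).continuous
    rw [mass_add (baseBasis m) (continuousOn_inChart_baseBasis hω')
      (hh.contMDiff hω').continuous h1,
      ih, mass_elemFun hω' hbox _ hu hsupp h1, add_zero]

/-- Adding a small multiple of a decomposed function. -/
theorem IsDec.exists_transports [CompactSpace M] (hω' : ω'.IsVolumeForm) (hh : IsDec ω' h B) :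
    ∃ A : ℝ, (∀ x, |h x| ≤ A) ∧ ∀ (a : M → ℝ) (ρ : ℝ → ℝ) (r κ ε : ℝ),
      ContMDiff (𝓡 m) 𝓘(ℝ, ℝ) ∞ a → ContDiff ℝ ∞ ρ → (∀ z ≤ 0, ρ z = 0) → (∀ z, |ρ z| ≤ r) →
      0 < κ → κ ≤ 1 → 0 ≤ ε → (∀ x z, κ + r * (ε * A) ≤ 1 + ρ z * a x) →
      Transports ω' (fun p => 1 + ρ p.2 * a p.1) (fun p => 1 + ρ p.2 * (a p.1 + ε * h p.1))
        (2 * r / κ * (ε * B)) := by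
  induction hh with
  | zero =>
    refine ⟨0, by simp, fun a ρ r κ ε _ _ _ _ _ _ _ _ => ?_⟩
    simpa using Transports.refl ω' fun p => 1 + ρ p.2 * a p.1
  | @add_elemFun h B c K R k u s hh hbox hu hsupp hs ih =>
    obtain ⟨A, hA, ih⟩ := ih
    have hcont := (contMDiff_elemFun hω' hbox k hu hsupp).continuous
    obtain ⟨A₁, hA₁⟩ := isCompact_univ.exists_bound_of_continuousOn hcont.continuousOn
    have hA₁' : ∀ x, |elemFun ω' c R k u x| ≤ A₁ := fun x => hA₁ x (mem_univ x)
    -- Sums of sup norms bound all partial sums at once, so every intermediate density stays at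
    -- least κ. This A involves derivatives of the u's, but it limits only ε and does not enter the
    -- displacement.
    refine ⟨A + A₁, fun x => (abs_add_le _ _).trans (add_le_add (hA x) (hA₁' x)), ?_⟩
    intro a ρ r κ ε ha hρ hρ0 hr hκ hκ1 hε hlow
    have hr0 : 0 ≤ r := (abs_nonneg _).trans (hr 0)
    have hA0 : 0 ≤ A := (abs_nonneg _).trans (hA c)
    have hA₁0 : 0 ≤ A₁ := (abs_nonneg _).trans (hA₁' c)
    have hs0 : 0 ≤ s := (abs_nonneg _).trans (hs 0)
    have hstep : ∀ (g : M → ℝ) (G : ℝ), (∀ x, |g x| ≤ G) →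
        ∀ x z, |ρ z * (ε * g x)| ≤ r * (ε * G) := by
      intro g G hg x z
      rw [abs_mul, abs_mul, abs_of_nonneg hε]
      exact mul_le_mul (hr z) (mul_le_mul_of_nonneg_left (hg x) hε)
        (mul_nonneg hε (abs_nonneg _)) hr0
    have h1 : Transports ω' (fun p => 1 + ρ p.2 * a p.1)
        (fun p => 1 + ρ p.2 * (a p.1 + ε * h p.1)) (2 * r / κ * (ε * B)) := by
      refine ih a ρ r κ ε ha hρ hρ0 hr hκ hκ1 hε fun x z => le_trans ?_ (hlow x z)
      have : 0 ≤ r * (ε * A₁) := by positivity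
      linarith
    have hsupp' : tsupport (fun y => ε * u y) ⊆ Metric.ball (extChartAt (𝓡 m) c c) R :=
      (tsupport_mul_subset_right (f := fun _ => ε) (g := u)).trans hsupp
    have hmid : ContMDiff (𝓡 m) 𝓘(ℝ, ℝ) ∞ fun x => a x + ε * h x :=
      ha.add (contMDiff_const.mul (hh.contMDiff hω'))
    have h2 : Transports ω' (fun p => 1 + ρ p.2 * (a p.1 + ε * h p.1))
        (fun p => 1 + ρ p.2 * (a p.1 + ε * h p.1 + elemFun ω' c R k (fun y => ε * u y) p.1))
        (K * (2 * (r * (ε * s)) / κ)) := by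
      refine transports_elemFun hω' hbox k (contDiff_const.mul hu) hsupp' hmid hρ hρ0 hκ hκ1
        (fun x z => ?_) (fun x z => ?_) (fun y z => ?_)
      · have h3 := (abs_le.1 (hstep h A hA x z)).1
        have : 0 ≤ r * (ε * A₁) := by positivity
        linarith [hlow x z]
      · rw [elemFun_const_mul hu]
        have h3 := (abs_le.1 (hstep h A hA x z)).1
        have h4 := (abs_le.1 (hstep _ A₁ hA₁' x z)).1
        linarith [hlow x z]
      · rw [abs_mul, abs_mul, abs_of_nonneg hε]
        exact mul_le_mul (hr z) (mul_le_mul_of_nonneg_left (hs y) hε)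
          (mul_nonneg hε (abs_nonneg _)) hr0
    simp only [elemFun_const_mul hu] at h2
    have h3 := (h1.trans h2).mono (le_of_eq (by ring :
      2 * r / κ * (ε * B) + K * (2 * (r * (ε * s)) / κ) = 2 * r / κ * (ε * (B + K * s))))
    simpa only [mul_add, add_assoc] using h3

/-- Adding a decomposed function in many small steps. -/
theorem IsDec.transports [CompactSpace M] (hω' : ω'.IsVolumeForm) (hh : IsDec ω' h B) {ρ : ℝ → ℝ}
    {r κ : ℝ} (hρ : ContDiff ℝ ∞ ρ) (hρ0 : ∀ z ≤ 0, ρ z = 0) (hr : ∀ z, |ρ z| ≤ r) (hκ : 0 < κ)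
    (hκ1 : 2 * κ ≤ 1) (hlow : ∀ x z, 2 * κ ≤ 1 + ρ z * h x) :
    Transports ω' (fun _ => 1) (fun p => 1 + ρ p.2 * h p.1) (2 * r / κ * B) := by
  obtain ⟨A, hA, hstep⟩ := hh.exists_transports hω'
  -- N is large enough that the excursions within a round of size 1 / N cost at most κ.
  obtain ⟨N, hN⟩ := exists_nat_gt (r * A / κ)
  rcases isEmpty_or_nonempty M with hM | ⟨⟨x₀⟩⟩
  · have : (fun p : Cyl M => 1 + ρ p.2 * h p.1) = fun _ => 1 := by
      ext p
      exact hM.elim p.1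
    rw [this]
    refine (Transports.refl ω' _).mono ?_
    have := hh.nonneg
    have hr0 : 0 ≤ r := (abs_nonneg _).trans (hr 0)
    positivity
  have hr0 : 0 ≤ r := (abs_nonneg _).trans (hr 0)
  have hA0 : 0 ≤ A := (abs_nonneg _).trans (hA x₀)
  have hN0 : (0 : ℝ) < N := lt_of_le_of_lt (by positivity) hN
  have hsmall : r * (1 / N * A) ≤ κ := by
    rw [div_lt_iff₀ hκ] at hN
    rw [mul_comm (1 / (N : ℝ)), ← mul_assoc, mul_one_div, div_le_iff₀ hN0]
    linarith
  have key : ∀ j : ℕ, j ≤ N → Transports ω' (fun _ => 1)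
      (fun p => 1 + ρ p.2 * (j * (1 / N) * h p.1)) (2 * r / κ * (j * (1 / N) * B)) := by
    intro j
    induction j with
    | zero =>
      intro _
      simpa using Transports.refl ω' fun _ : Cyl M => (1 : ℝ)
    | succ j ih =>
      intro hj
      have hj1 : (j : ℝ) * (1 / N) ≤ 1 := by
        rw [mul_one_div, div_le_one hN0]
        exact_mod_cast (Nat.le_succ j).trans hj
      have hj0 : 0 ≤ (j : ℝ) * (1 / N) := by positivity
      -- The density before a round is a convex combination of 1 and 1 + ρh, hence at least 2κ. The
      -- round may therefore use the bound κ.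
      have h1 := hstep (fun x => j * (1 / N) * h x) ρ r κ (1 / N)
        (contMDiff_const.mul (hh.contMDiff hω')) hρ hρ0 hr hκ (by linarith) (by positivity)
        fun x z => by nlinarith [hlow x z]
      have h2 := ((ih ((Nat.le_succ j).trans hj)).trans h1)
      refine cast ?_ h2
      congr 1
      · ext p
        push_cast
        ring
      · push_cast
        ring
  have h1 := key N le_rfl
  rw [mul_one_div_cancel hN0.ne'] at h1
  simpa using h1

end Decomposition

theorem mem_ball_of_coord_le {m : ℕ} {y y₀ : EuclideanSpace ℝ (Fin m)} {R : ℝ} (hR : 0 < R)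
    (h : ∀ k, |y k - y₀ k| ≤ R / (m + 1)) : y ∈ Metric.ball y₀ R := by
  rw [Metric.mem_ball, EuclideanSpace.dist_eq, Real.sqrt_lt' hR]
  have h1 : ∑ k, dist (y k) (y₀ k) ^ 2 ≤ ∑ _k : Fin m, (R / (m + 1)) ^ 2 :=
    Finset.sum_le_sum fun k _ => pow_le_pow_left₀ dist_nonneg (h k) 2
  refine h1.trans_lt ?_
  rw [Finset.sum_const, Finset.card_univ, Fintype.card_fin, nsmul_eq_mul, div_pow, mul_div_assoc',
    div_lt_iff₀ (by positivity)]
  have : (m : ℝ) < (m + 1) ^ 2 := by nlinarith [Nat.cast_nonneg (α := ℝ) m]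
  nlinarith [sq_pos_of_pos hR]

theorem isClosed_cube {m : ℕ} (y₀ : EuclideanSpace ℝ (Fin m)) (q : ℝ) :
    IsClosed {y : EuclideanSpace ℝ (Fin m) | ∀ k, |y k - y₀ k| ≤ q} := by
  simp only [ofPred_forall]
  exact isClosed_iInter fun k =>
    isClosed_le (((contDiff_coord k).continuous.sub continuous_const).abs) continuous_const

theorem InCube.tsupport_subset {m : ℕ} {y₀ : EuclideanSpace ℝ (Fin m)} {q : ℝ}
    {h : EuclideanSpace ℝ (Fin m) → ℝ} (hh : InCube y₀ q h) :
    tsupport h ⊆ {y | ∀ k, |y k - y₀ k| ≤ q} :=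
  closure_minimal (fun y hy k => not_lt.1 fun hk => hy (hh y k hk)) (isClosed_cube y₀ q)

/-! ### Global decomposition of functions of integral zero. -/

section Decomposition

variable {m : ℕ} {M : Type*} [MetricSpace M] [ChartedSpace (EuclideanSpace ℝ (Fin m)) M]
  [IsManifold (𝓡 m) ∞ M] {ω' : Form (𝓡 m) M m}

/-- Every function supported in `U` decomposes, up to a multiple of `e`, with bounds that are
linear in its supremum. -/
def ReducesTo (ω' : Form (𝓡 m) M m) (e : M → ℝ) (U : Set M) (B : ℝ) : Prop :=
  ∀ (h : M → ℝ) (S : ℝ), ContMDiff (𝓡 m) 𝓘(ℝ, ℝ) ∞ h → (∀ x ∉ U, h x = 0) → (∀ x, |h x| ≤ S) →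
    ∃ r B', |r| ≤ B * S ∧ B' ≤ B * S ∧ IsDec ω' (fun x => h x - r * e x) B'

/-- Multiplying by the weight turns h into a function on a cube, to which the Euclidean divergence
decomposition applies. Dividing by the weight again gives elementary functions, and e comes from the
fixed bump Θ. -/
theorem exists_reducesTo_of_isBox (hω' : ω'.IsVolumeForm) {c : M} {K R : ℝ}
    (hbox : IsBox ω' c K R) :
    ∃ (U : Set M) (e : M → ℝ) (B : ℝ), IsOpen U ∧ c ∈ U ∧ 0 ≤ B ∧
      ContMDiff (𝓡 m) 𝓘(ℝ, ℝ) ∞ e ∧ (∀ x, 0 ≤ e x) ∧ 0 < e c ∧ ReducesTo ω' e U B := by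
  set y₀ := extChartAt (𝓡 m) c c with hy₀
  -- With this half-edge the closed cube lies in the open ball, also for m = 0.
  set q := R / (m + 1) with hq
  have hR := hbox.R_pos
  have hq0 : 0 < q := by positivity
  have hcube : {y : EuclideanSpace ℝ (Fin m) | ∀ k, |y k - y₀ k| ≤ q} ⊆ Metric.ball y₀ R :=
    fun y hy => mem_ball_of_coord_le hR hy
  obtain ⟨Θ, B, hΘ, hΘc, hΘ0, hΘpos, hB, hdec⟩ := exists_divergence_decomposition y₀ hq0
  obtain ⟨β, hβ, hβ0, hβ1, hβK, hβs⟩ := exists_bump hR (isClosed_cube y₀ q) hcube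
  have hw : ∀ y ∈ Metric.ball y₀ R, 0 < weight ω' c y := fun y hy => by
    linarith [hbox.half_le y hy]
  have hK := hbox.K_pos
  refine ⟨(extChartAt (𝓡 m) c).source ∩ extChartAt (𝓡 m) c ⁻¹' {y | ∀ k, |y k - y₀ k| < q},
    chartExtend c R fun y => Θ y / weight ω' c y, 2 * B + m * (K * (B * 2)), ?_, ?_, by positivity,
    contMDiff_chartExtend_div_weight hω' hbox hΘ (hΘc.tsupport_subset.trans hcube), fun x => ?_, ?_,
    ?_⟩
  · refine isOpen_extChartAt_preimage' c ?_
    simp only [ofPred_forall]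
    exact isOpen_iInter_of_finite fun k =>
      isOpen_lt (((contDiff_coord k).continuous.sub continuous_const).abs) continuous_const
  · exact ⟨mem_extChartAt_source c, fun k => by simpa [hy₀] using hq0⟩
  · by_cases hx : x ∈ chartBall m c R
    · rw [chartExtend_of_mem hx]
      exact div_nonneg (hΘ0 _) (hw _ hx.2).le
    · rw [chartExtend_of_notMem hx]
  · rw [chartExtend_of_mem (mem_chartBall_self c hR)]
    exact div_pos hΘpos (hw _ (Metric.mem_ball_self hR))
  intro h S hh hU hS
  have hS0 : 0 ≤ S := (abs_nonneg _).trans (hS c)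
  have hout : ∀ x ∈ chartBall m c R, ¬ (∀ k, |extChartAt (𝓡 m) c x k - y₀ k| ≤ q) → h x = 0 :=
    fun x _ hx => hU x fun hxU => hx fun k => (hxU.2 k).le
  let v : EuclideanSpace ℝ (Fin m) → ℝ := fun y =>
    β y * (h ((extChartAt (𝓡 m) c).symm y) * weight ω' c y)
  have hβ' : ∀ y ∉ Metric.ball y₀ R, β y = 0 := fun y hy => by
    by_contra hne
    exact hy (hβs (subset_tsupport _ hne))
  have hv : ContDiff ℝ ∞ v := by
    refine contDiff_mul_of_tsupport_subset Metric.isOpen_ball hβ hβs ?_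
    refine ContDiffOn.mul ?_ ((contDiffOn_weight hω' c).mono hbox.subset_target)
    rw [← contMDiffOn_iff_contDiffOn]
    exact hh.comp_contMDiffOn ((contMDiffOn_extChartAt_symm c).mono hbox.subset_target)
  have hvc : InCube y₀ q v := by
    intro y k hk
    by_cases hy : y ∈ Metric.ball y₀ R
    · have : h ((extChartAt (𝓡 m) c).symm y) = 0 := by
        refine hout _ (symm_mem_chartBall hbox.subset_target hy) fun hall => ?_
        rw [(extChartAt (𝓡 m) c).right_inv (hbox.subset_target hy)] at hall
        exact hk.not_ge (hall k)
      simp only [v, this, zero_mul, mul_zero]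
    · simp only [v, hβ' y hy, zero_mul]
  have hvS : ∀ y, |v y| ≤ 2 * S := by
    intro y
    by_cases hy : y ∈ Metric.ball y₀ R
    · simp only [v]
      rw [abs_mul, abs_mul, abs_of_nonneg (hβ0 y), abs_of_pos (hw y hy)]
      calc β y * (|h ((extChartAt (𝓡 m) c).symm y)| * weight ω' c y) ≤ 1 * (S * 2) := by
            refine mul_le_mul (hβ1 y) (mul_le_mul (hS _) (hbox.le_two y hy) (hw y hy).le hS0)
              (mul_nonneg (abs_nonneg _) (hw y hy).le) zero_le_one
        _ = 2 * S := by ring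
    · simp only [v, hβ' y hy, zero_mul, abs_zero]
      positivity
  -- The factor 2 is the upper bound of the weight on the box.
  obtain ⟨u, r, hu, hr, heq⟩ := hdec v (2 * S) hv hvc hvS
  refine ⟨r, ∑ _k : Fin m, K * (B * (2 * S)), hr.trans ?_, ?_, ?_⟩
  · have : 0 ≤ m * (K * (B * 2)) * S := by positivity
    linarith
  · rw [Finset.sum_const, Finset.card_univ, Fintype.card_fin, nsmul_eq_mul]
    have : 0 ≤ B * S := by positivity
    linarith
  · have h1 : IsDec ω' (fun x => ∑ k, elemFun ω' c R k (u k) x) (∑ _k : Fin m, K * (B * (2 * S))) :=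
      IsDec.sum Finset.univ fun k _ =>
        (IsDec.zero.add_elemFun hbox (hu k).1 ((hu k).2.1.tsupport_subset.trans hcube)
          (hu k).2.2).congr (fun x => zero_add _) (zero_add _)
    refine h1.congr (fun x => ?_) rfl
    by_cases hx : x ∈ chartBall m c R
    · have hwx := hw _ hx.2
      have h2 : v (extChartAt (𝓡 m) c x) = h x * weight ω' c (extChartAt (𝓡 m) c x) := by
        simp only [v]
        rw [(extChartAt (𝓡 m) c).left_inv hx.1]
        by_cases hall : ∀ k, |extChartAt (𝓡 m) c x k - y₀ k| ≤ q
        · rw [hβK _ hall, one_mul]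
        · rw [hout x hx hall, zero_mul, mul_zero]
      have h3 := heq (extChartAt (𝓡 m) c x)
      rw [h2] at h3
      simp only [elemFun, chartExtend_of_mem hx]
      rw [← Finset.sum_div, eq_sub_iff_add_eq, mul_div_assoc', ← add_div, ← h3,
        mul_div_cancel_right₀ _ hwx.ne']
    · simp only [elemFun, chartExtend_of_notMem hx, Finset.sum_const_zero, mul_zero, sub_zero]
      exact (hU x fun hxU => hx ⟨hxU.1, hcube fun k => (hxU.2 k).le⟩).symm

variable [CompactSpace M]

theorem mass_eq_of_isDec_sub (hω' : ω'.IsVolumeForm) {h e : M → ℝ} {r B : ℝ}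
    (he : Continuous e) (hd : IsDec ω' (fun x => h x - r * e x) B) :
    mass (baseBasis m) ω' h = r * mass (baseBasis m) ω' e := by
  have hre : Continuous fun x => r * e x := continuous_const.mul he
  have h1 := mass_add (baseBasis m) (continuousOn_inChart_baseBasis hω')
    (hd.contMDiff hω').continuous hre
  rw [hd.mass_eq_zero hω', mass_const_mul, zero_add] at h1
  simpa using h1

/-- A bump g supported in U ∩ V reduces both to r e and to r' e'. Its mass is positive and
decomposed functions have mass zero, so r ≠ 0. Hence e is equivalent to (r' / r) e' modulo
decomposed functions, and e' can replace e on U. -/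
theorem ReducesTo.change (hω' : ω'.IsVolumeForm) {e e' : M → ℝ} {U V : Set M} {B B' : ℝ} {y : M}
    (hU : ReducesTo ω' e U B) (hV : ReducesTo ω' e' V B') (hUo : IsOpen U) (hVo : IsOpen V)
    (hB : 0 ≤ B) (he : Continuous e) (hyU : y ∈ U) (hyV : y ∈ V) :
    ∃ B'', 0 ≤ B'' ∧ ReducesTo ω' e' U B'' := by
  obtain ⟨g, hgs, hg, hg0⟩ := (hUo.inter hVo).exists_contMDiff_support_eq (𝓡 m) (n := ⊤)
  have hgout : ∀ x, x ∉ U ∩ V → g x = 0 := fun x hx => by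
    rw [← hgs] at hx
    simpa using hx
  obtain ⟨G, hG⟩ := isCompact_univ.exists_bound_of_continuousOn hg.continuous.continuousOn
  have hG' : ∀ x, |g x| ≤ G := fun x => hG x (mem_univ x)
  obtain ⟨r, b, -, -, hr⟩ := hU g G hg (fun x hx => hgout x fun h => hx h.1) hG'
  obtain ⟨r', b', -, -, hr'⟩ := hV g G hg (fun x hx => hgout x fun h => hx h.2) hG'
  have hgy : 0 < g y := by
    refine lt_of_le_of_ne (hg0 y) (Ne.symm ?_)
    have : y ∈ Function.support g := hgs ▸ ⟨hyU, hyV⟩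
    exact this
  have hr0 : r ≠ 0 := by
    intro h0
    have := mass_pos hω' hg.continuous hg0 hgy
    rw [mass_eq_of_isDec_sub hω' he hr, h0, zero_mul] at this
    exact this.false
  have hb := hr.nonneg
  have hb' := hr'.nonneg
  have hC : 0 ≤ B * |r' / r| := by positivity
  have hD : 0 ≤ B / |r| * (b + b') := by positivity
  -- The identity used is h - t(r'/r)e' = (h - te) + (t/r)((g - r'e') - (g - re)). The numbers r,
  -- r', b, b' belong to the fixed bump g, so the bound stays linear in S.
  refine ⟨B + B * |r' / r| + B / |r| * (b + b'), by positivity, fun h S hh hout hS => ?_⟩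
  have hS0 : 0 ≤ S := (abs_nonneg _).trans (hS y)
  obtain ⟨t, b'', ht, hb'', hd⟩ := hU h S hh hout hS
  refine ⟨t * (r' / r), b'' + |t / r| * (b' + |(-1 : ℝ)| * b), ?_, ?_,
    (hd.add ((hr'.add (hr.const_mul (-1))).const_mul (t / r))).congr (fun x => ?_) rfl⟩
  · rw [abs_mul]
    have : |t| * |r' / r| ≤ B * S * |r' / r| := by gcongr
    nlinarith [mul_nonneg hB hS0, mul_nonneg hD hS0]
  · rw [abs_neg, abs_one, one_mul, abs_div]
    have : |t| / |r| * (b' + b) ≤ B * S / |r| * (b' + b) := by gcongr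
    have e : B * S / |r| * (b' + b) = B / |r| * (b + b') * S := by ring
    nlinarith [mul_nonneg hC hS0]
  · field_simp
    ring

variable [ConnectedSpace M] [Bundle.RiemannianBundle (fun x : M => TangentSpace (𝓡 m) x)]
  [IsContMDiffRiemannianBundle (𝓡 m) ∞ (EuclideanSpace ℝ (Fin m))
    (fun x : M => TangentSpace (𝓡 m) x)]
  [IsRiemannianManifold (𝓡 m) M]

/-- The points with a neighbourhood reducing to one fixed e form an open set, which is closed by
`ReducesTo.change`. Connectedness makes it all of M. -/
theorem exists_forall_reducesTo (hω' : ω'.IsVolumeForm) :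
    ∃ e : M → ℝ, ContMDiff (𝓡 m) 𝓘(ℝ, ℝ) ∞ e ∧ 0 < mass (baseBasis m) ω' e ∧
      ∀ x : M, ∃ (U : Set M) (B : ℝ), IsOpen U ∧ x ∈ U ∧ 0 ≤ B ∧ ReducesTo ω' e U B := by
  have hloc : ∀ c : M, ∃ (U : Set M) (e : M → ℝ) (B : ℝ), IsOpen U ∧ c ∈ U ∧ 0 ≤ B ∧
      ContMDiff (𝓡 m) 𝓘(ℝ, ℝ) ∞ e ∧ (∀ x, 0 ≤ e x) ∧ 0 < e c ∧ ReducesTo ω' e U B := fun c => by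
    obtain ⟨K, R, hbox⟩ := exists_isBox hω' c
    exact exists_reducesTo_of_isBox hω' hbox
  obtain ⟨x₀⟩ : Nonempty M := inferInstance
  obtain ⟨U₀, e, B₀, hU₀, hx₀, hB₀, he, he0, hepos, hred⟩ := hloc x₀
  refine ⟨e, he, mass_pos hω' he.continuous he0 hepos, ?_⟩
  let T : Set M := {x | ∃ (U : Set M) (B : ℝ), IsOpen U ∧ x ∈ U ∧ 0 ≤ B ∧ ReducesTo ω' e U B}
  have hT : T = univ := by
    refine IsClopen.eq_univ ⟨?_, ?_⟩ ⟨x₀, U₀, B₀, hU₀, hx₀, hB₀, hred⟩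
    · refine isClosed_of_closure_subset fun x hx => ?_
      obtain ⟨U, e', B, hU, hxU, hB, he', -, -, hredU⟩ := hloc x
      obtain ⟨y, hyU, V, B', hV, hyV, -, hredV⟩ := mem_closure_iff.1 hx U hU hxU
      obtain ⟨B'', hB'', h⟩ := hredU.change hω' hredV hU hV hB he'.continuous hyU hyV
      exact ⟨U, B'', hU, hxU, hB'', h⟩
    · rw [isOpen_iff_mem_nhds]
      rintro x ⟨U, B, hU, hxU, hB, h⟩
      exact mem_of_superset (hU.mem_nhds hxU) fun y hy => ⟨U, B, hU, hy, hB, h⟩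
  intro x
  have : x ∈ T := hT ▸ mem_univ x
  exact this

/-- A function of integral zero on a closed connected manifold is a sum of elementary functions,
with linear bounds. -/
theorem exists_isDec (hω' : ω'.IsVolumeForm) :
    ∃ B : ℝ, 0 ≤ B ∧ ∀ (h : M → ℝ) (S : ℝ), ContMDiff (𝓡 m) 𝓘(ℝ, ℝ) ∞ h → (∀ x, |h x| ≤ S) →
      mass (baseBasis m) ω' h = 0 → ∃ B' ≤ B * S, IsDec ω' h B' := by
  obtain ⟨e, he, hepos, hred⟩ := exists_forall_reducesTo (M := M) hω'
  choose U B hU hxU hB hred using hred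
  obtain ⟨f, hf⟩ := SmoothPartitionOfUnity.exists_isSubordinate (𝓡 m) isClosed_univ U hU
    fun x _ => mem_iUnion.2 ⟨x, hxU x⟩
  have hfin : {i : M | ∃ x, f i x ≠ 0}.Finite := f.locallyFinite.finite_nonempty_of_compact
  have hsum : ∀ x, ∑ i ∈ hfin.toFinset, f i x = 1 := fun x => by
    rw [← f.sum_eq_one (mem_univ x)]
    refine (finsum_eq_sum_of_support_subset _ fun i hi => ?_).symm
    rw [Finite.coe_toFinset]
    exact ⟨_, hi⟩
  refine ⟨∑ i ∈ hfin.toFinset, B i, Finset.sum_nonneg fun i _ => hB i, fun h S hh hS hmass => ?_⟩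
  have hpiece : ∀ i, ∃ r B', |r| ≤ B i * S ∧ B' ≤ B i * S ∧
      IsDec ω' (fun x => f i x * h x - r * e x) B' := by
    intro i
    refine hred i (fun x => f i x * h x) S ((f i).contMDiff.mul hh) (fun x hx => ?_) fun x => ?_
    · have : f i x = 0 := by
        by_contra hne
        exact hx (hf i (subset_tsupport _ hne))
      rw [this, zero_mul]
    · rw [abs_mul, abs_of_nonneg (f.nonneg i x)]
      calc f i x * |h x| ≤ 1 * |h x| := mul_le_mul_of_nonneg_right (f.le_one i x) (abs_nonneg _)
        _ ≤ S := by rw [one_mul]; exact hS x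
  choose r b hr hb hd using hpiece
  have hdec : IsDec ω' (fun x => h x - (∑ i ∈ hfin.toFinset, r i) * e x)
      (∑ i ∈ hfin.toFinset, b i) :=
    (IsDec.sum hfin.toFinset fun i _ => hd i).congr (fun x => by
      rw [Finset.sum_sub_distrib, ← Finset.sum_mul, ← Finset.sum_mul, hsum, one_mul]) rfl
  -- Taking masses: the total coefficient of e times the positive mass of e equals the mass of h,
  -- which is zero.
  have hr0 : ∑ i ∈ hfin.toFinset, r i = 0 := by
    have := mass_eq_of_isDec_sub hω' he.continuous hdec
    rw [hmass] at this
    exact (mul_eq_zero.1 this.symm).resolve_right hepos.ne'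
  refine ⟨_, ?_, hdec.congr (fun x => by rw [hr0, zero_mul, sub_zero]) rfl⟩
  rw [Finset.sum_mul]
  exact Finset.sum_le_sum fun i _ => hb i

end Decomposition

/-- A smooth step reaching 1 at height ε = 1 - 1/r has integral at least 1/r over [-1, 1], so
normalizing it keeps it below r. Bounds r arbitrarily close to 1 matter when h is close to -1. -/
theorem exists_profile {r : ℝ} (hr : 1 < r) : ∃ ρ : ℝ → ℝ, ContDiff ℝ ∞ ρ ∧ (∀ z ≤ 0, ρ z = 0) ∧
    (∀ z, 0 ≤ ρ z) ∧ (∀ z, ρ z ≤ r) ∧ ∫ z in (-1 : ℝ)..1, ρ z = 1 := by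
  set ε : ℝ := 1 - r⁻¹ with hε
  have hr0 : 0 < r := by linarith
  have hri : 0 < r⁻¹ := by positivity
  have hε0 : 0 < ε := by
    have : r⁻¹ < 1 := inv_lt_one_of_one_lt₀ hr
    linarith
  have hε1 : ε ≤ 1 := by linarith
  let σ : ℝ → ℝ := fun z => Real.smoothTransition (z / ε)
  have hσ : ContDiff ℝ ∞ σ := Real.smoothTransition.contDiff.comp (contDiff_id.div_const ε)
  have hσ0 : ∀ z ≤ 0, σ z = 0 := fun z hz =>
    Real.smoothTransition.zero_of_nonpos (div_nonpos_of_nonpos_of_nonneg hz hε0.le)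
  have hσ1 : ∀ z, ε ≤ z → σ z = 1 := fun z hz =>
    Real.smoothTransition.one_of_one_le ((one_le_div hε0).2 hz)
  have hi : ∀ a b, IntervalIntegrable σ volume a b := fun a b => hσ.continuous.intervalIntegrable a b
  have hJ : r⁻¹ ≤ ∫ z in (-1 : ℝ)..1, σ z := by
    rw [← intervalIntegral.integral_add_adjacent_intervals (hi (-1) ε) (hi ε 1)]
    have h1 : 0 ≤ ∫ z in (-1 : ℝ)..ε, σ z :=
      intervalIntegral.integral_nonneg (by linarith) fun z _ => Real.smoothTransition.nonneg _
    have h2 : ∫ z in ε..1, σ z = ∫ _z in ε..1, (1 : ℝ) :=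
      intervalIntegral.integral_congr fun z hz => by
        rw [uIcc_of_le hε1] at hz
        exact hσ1 z hz.1
    rw [h2, intervalIntegral.integral_const, smul_eq_mul, mul_one]
    linarith
  set J := ∫ z in (-1 : ℝ)..1, σ z with hJdef
  have hJ0 : 0 < J := hri.trans_le hJ
  refine ⟨fun z => σ z / J, hσ.div_const J, fun z hz => by simp only [hσ0 z hz, zero_div],
    fun z => div_nonneg (Real.smoothTransition.nonneg _) hJ0.le, fun z => ?_, ?_⟩
  · rw [div_le_iff₀ hJ0]
    calc σ z ≤ 1 := Real.smoothTransition.le_one _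
      _ = r * r⁻¹ := (mul_inv_cancel₀ hr0.ne').symm
      _ ≤ r * J := mul_le_mul_of_nonneg_left hJ hr0.le
  · rw [intervalIntegral.integral_div, ← hJdef, div_self hJ0.ne']

/-- This is where the factor δ enters: the bound is by the length of the support and not of the
interval of integration. -/
theorem abs_intervalIntegral_le_of_support {f : ℝ → ℝ} {a b C δ : ℝ} (hf : Continuous f)
    (hC : ∀ s, |f s| ≤ C) (hδ : 0 ≤ δ) (h0 : ∀ s ∈ Icc a b, s < 0 → f s = 0)
    (h1 : ∀ s ∈ Icc a b, δ < s → f s = 0) (hab : a ≤ b) : |∫ s in a..b, f s| ≤ C * δ := by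
  have hC0 : 0 ≤ C := (abs_nonneg _).trans (hC 0)
  have h2 : ∀ s ∈ Icc a b, |f s| ≤ (Icc 0 δ).indicator (fun _ => C) s := by
    intro s hsab
    by_cases hs : s ∈ Icc 0 δ
    · rw [indicator_of_mem hs]
      exact hC s
    · rw [indicator_of_notMem hs]
      rcases lt_or_ge s 0 with h | h
      · rw [h0 s hsab h, abs_zero]
      · rw [h1 s hsab (not_le.1 fun h' => hs ⟨h, h'⟩), abs_zero]
  have hint : Integrable ((Icc 0 δ).indicator fun _ : ℝ => C) :=
    (integrable_indicator_iff measurableSet_Icc).2 (integrableOn_const (by simp))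
  calc |∫ s in a..b, f s| ≤ ∫ s in a..b, |f s| :=
        intervalIntegral.norm_integral_le_integral_norm (f := f) hab
    _ ≤ ∫ s in a..b, (Icc 0 δ).indicator (fun _ => C) s :=
        intervalIntegral.integral_mono_on hab (hf.abs.intervalIntegrable _ _)
          hint.intervalIntegrable h2
    _ ≤ ∫ s, (Icc 0 δ).indicator (fun _ => C) s := by
        rw [intervalIntegral.integral_of_le hab]
        exact setIntegral_le_integral hint (Eventually.of_forall fun s =>
          indicator_nonneg (fun _ _ => hC0) s)
    _ = C * δ := by
        rw [integral_indicator measurableSet_Icc, setIntegral_const]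
        simp [hδ, mul_comm]

/-! ### Transport of the constant density to a given one. -/

section FibreIntegral

variable {m : ℕ} {M : Type*} [MetricSpace M] [ChartedSpace (EuclideanSpace ℝ (Fin m)) M]

theorem contMDiff_fibreInt [IsManifold (𝓡 m) ∞ M] {a : Cyl M → ℝ}
    (ha : ContMDiff (cylModel m) 𝓘(ℝ, ℝ) ∞ a) :
    ContMDiff (𝓡 m) 𝓘(ℝ, ℝ) ∞ fun x => fibreInt a x 1 := by
  intro c
  obtain ⟨r, hr, hball⟩ := Metric.isOpen_iff.1 (isOpen_extChartAt_target (I := 𝓡 m) c) _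
    (mem_extChartAt_target c)
  have h1 := contDiffOn_fibreInt ha c Metric.isOpen_ball (convex_ball (extChartAt (𝓡 m) c c) r) hball
  have h2 : ContDiffOn ℝ ∞ (fun y => fibreInt a ((extChartAt (𝓡 m) c).symm y) 1)
      (Metric.ball (extChartAt (𝓡 m) c c) r) :=
    h1.comp (f := fun y => (y, (1 : ℝ))) (contDiff_id.prodMk contDiff_const).contDiffOn
      fun y hy => ⟨hy, by norm_num⟩
  have h3 : ContMDiffOn (𝓡 m) 𝓘(ℝ, ℝ) ∞
      ((fun y => fibreInt a ((extChartAt (𝓡 m) c).symm y) 1) ∘ extChartAt (𝓡 m) c)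
      (chartBall m c r) := by
    refine h2.contMDiffOn.comp ((contMDiffOn_extChartAt (I := 𝓡 m) (x := c)).mono fun x hx => ?_)
      fun x hx => hx.2
    rw [← extChartAt_source (𝓡 m)]
    exact hx.1
  refine ((h3.congr fun x hx => ?_).contMDiffAt
    ((isOpen_chartBall c r).mem_nhds (mem_chartBall_self c hr)))
  rw [Function.comp_apply, (extChartAt (𝓡 m) c).left_inv hx.1]

theorem fibreInt_add {M : Type*} [TopologicalSpace M] {a b : Cyl M → ℝ} (ha : Continuous a)
    (hb : Continuous b) (x : M) (t : ℝ) :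
    fibreInt (fun p => a p + b p) x t = fibreInt a x t + fibreInt b x t := by
  have h : ∀ c : Cyl M → ℝ, Continuous c → Continuous (extendHeight c x) := fun c hc =>
    hc.comp (continuous_const.prodMk continuous_projIcc)
  exact intervalIntegral.integral_add ((h a ha).intervalIntegrable _ _)
    ((h b hb).intervalIntegrable _ _)

theorem fibreInt_one {M : Type*} (x : M) (t : ℝ) : fibreInt (fun _ => 1) x t = t + 1 := by
  simp [fibreInt, extendHeight]

theorem fibreInt_height {M : Type*} (ρ : ℝ → ℝ) (x : M) {t : ℝ} (ht : t ∈ Icc (-1 : ℝ) 1) :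
    fibreInt (fun p => ρ p.2) x t = ∫ z in (-1 : ℝ)..t, ρ z := by
  refine intervalIntegral.integral_congr fun s hs => ?_
  rw [uIcc_of_le ht.1] at hs
  simp only [extendHeight]
  rw [projIcc_of_mem neg_one_le_one_real ⟨hs.1, hs.2.trans ht.2⟩]

variable [IsManifold (𝓡 m) ∞ M] [CompactSpace M] [ConnectedSpace M]
  [Bundle.RiemannianBundle (fun x : M => TangentSpace (𝓡 m) x)]
  [IsContMDiffRiemannianBundle (𝓡 m) ∞ (EuclideanSpace ℝ (Fin m))
    (fun x : M => TangentSpace (𝓡 m) x)]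
  [IsRiemannianManifold (𝓡 m) M] {ω' : Form (𝓡 m) M m}

/-- The constant density is transported to a density with the same total mass and equal to it below
the height zero, and the displacement is linear in the size of the deviation. -/
theorem exists_transports_density (hω' : ω'.IsVolumeForm) :
    ∃ B : ℝ, 0 ≤ B ∧ ∀ (a : Cyl M → ℝ) (S r κ : ℝ),
      ContMDiff (cylModel m) 𝓘(ℝ, ℝ) ∞ a → (∀ p, 0 < a p) →
      (∀ p : Cyl M, (p.2 : ℝ) ≤ 0 → a p = 1) →
      mass (cylBasis m) (wedgeDz ω') (fun p => a p - 1) = 0 →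
      (∀ x, ∀ t ∈ Icc (-1 : ℝ) 1, |fibreInt (fun p => a p - 1) x t| ≤ S) →
      1 < r → 0 < κ → 2 * κ ≤ 1 → (∀ x, -fibreInt (fun p => a p - 1) x 1 * r ≤ 1 - 2 * κ) →
      Transports ω' (fun _ => 1) a (2 * r / κ * (B * S) + 2 * S / (2 * κ)) := by
  obtain ⟨B, hB, hdec⟩ := exists_isDec (M := M) hω'
  obtain ⟨κ₀, hκ₀, hfib⟩ := exists_mass_eq_fibre (M := M) hω'
  refine ⟨B, hB, fun a S r κ ha hapos ha0 hmass hS hr hκ hκ1 hlow => ?_⟩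
  have hd : ContMDiff (cylModel m) 𝓘(ℝ, ℝ) ∞ fun p => a p - 1 := ha.sub contMDiff_const
  set h : M → ℝ := fun x => fibreInt (fun p => a p - 1) x 1 with hh
  have hhs : ContMDiff (𝓡 m) 𝓘(ℝ, ℝ) ∞ h := contMDiff_fibreInt hd
  have hhS : ∀ x, |h x| ≤ S := fun x => hS x 1 (by norm_num)
  have hmass' : mass (baseBasis m) ω' h = 0 := by
    have := hfib _ hd.continuous fun p hp => by simp only [ha0 p hp, sub_self]
    rw [hmass] at this
    exact (mul_eq_zero.1 this.symm).resolve_left hκ₀.ne'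
  obtain ⟨B', hB', hdech⟩ := hdec h S hhs hhS hmass'
  obtain ⟨ρ, hρ, hρ0, hρnn, hρr, hρint⟩ := exists_profile hr
  have hr0 : 0 < r := by linarith
  -- Only negative values of h matter. For these the worst case is ρ = r, covered by the hypothesis
  -- on r and κ.
  have hlow' : ∀ x z, 2 * κ ≤ 1 + ρ z * h x := by
    intro x z
    have h1 := hlow x
    rcases le_total 0 (h x) with h0 | h0
    · linarith [mul_nonneg (hρnn z) h0]
    · have : r * h x ≤ ρ z * h x := mul_le_mul_of_nonpos_right (hρr z) h0
      linarith
  have h1 := hdech.transports hω' hρ hρ0 (fun z => by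
    rw [abs_of_nonneg (hρnn z)]; exact hρr z) hκ hκ1 hlow'
  have hb : ContMDiff (cylModel m) 𝓘(ℝ, ℝ) ∞ fun p : Cyl M => 1 + ρ p.2 * h p.1 :=
    contMDiff_const.add ((hρ.contMDiff.comp (contMDiff_subtypeVal_Icc.comp contMDiff_snd)).mul
      (hhs.comp contMDiff_fst))
  have hρh : Continuous fun p : Cyl M => h p.1 * ρ p.2 :=
    (hhs.continuous.comp continuous_fst).mul
      (hρ.continuous.comp (continuous_subtype_val.comp continuous_snd))
  have hfa : ∀ x t, fibreInt a x t = t + 1 + fibreInt (fun p => a p - 1) x t := by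
    intro x t
    have := fibreInt_add (continuous_const (y := (1 : ℝ))) hd.continuous x t
    rw [fibreInt_one] at this
    rw [← this]
    congr 1
    ext p
    ring
  have hfb : ∀ x, ∀ t ∈ Icc (-1 : ℝ) 1, fibreInt (fun p : Cyl M => 1 + ρ p.2 * h p.1) x t =
      t + 1 + h x * ∫ z in (-1 : ℝ)..t, ρ z := by
    intro x t ht
    have := fibreInt_add (continuous_const (y := (1 : ℝ))) hρh x t
    rw [fibreInt_one, fibreInt_mul_left h (fun p => ρ p.2), fibreInt_height ρ x ht] at this
    rw [← this]
    congr 1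
    ext p
    ring
  have : Nonempty (Cyl M) := ⟨(Classical.arbitrary M, endPt)⟩
  obtain ⟨p₀, -, hp₀⟩ := isCompact_univ.exists_isMinOn univ_nonempty ha.continuous.continuousOn
  have hmin : ∀ p, a p₀ ≤ a p := fun p => hp₀ (mem_univ p)
  have h2 : Transports ω' (fun p => 1 + ρ p.2 * h p.1) a (2 * S / (2 * κ)) := by
    -- The minimum of a enters only the qualitative bound; the displacement uses the bound 2κ of the
    -- intermediate density.
    refine transports_vertical hb ha (κ := min (2 * κ) (a p₀)) (lt_min (by linarith) (hapos p₀))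
      (fun p => (min_le_left _ _).trans (hlow' _ _)) (fun p => (min_le_right _ _).trans (hmin p))
      (fun x => ?_) (fun p hp => ?_) (by linarith) (fun p => hlow' _ _) fun p => ?_
    · rw [hfb x 1 (by norm_num), hfa, hρint, mul_one]
    · rw [hρ0 _ hp, ha0 p hp, zero_mul, add_zero]
    -- The difference of the partial fibre integrals is h ∫ρ minus a partial integral of `a - 1`,
    -- each at most S in absolute value.
    · rw [hfb p.1 p.2 p.2.2, hfa]
      have hρt0 : 0 ≤ ∫ z in (-1 : ℝ)..p.2, ρ z :=
        intervalIntegral.integral_nonneg p.2.2.1 fun z _ => hρnn z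
      have hρt1 : ∫ z in (-1 : ℝ)..p.2, ρ z ≤ 1 := by
        refine le_trans ?_ hρint.le
        exact intervalIntegral.integral_mono_interval le_rfl p.2.2.1 p.2.2.2
          (Eventually.of_forall hρnn) (hρ.continuous.intervalIntegrable _ _)
      have h3 : |h p.1 * ∫ z in (-1 : ℝ)..p.2, ρ z| ≤ S * 1 := by
        rw [abs_mul, abs_of_nonneg hρt0]
        exact mul_le_mul (hhS _) hρt1 hρt0 ((abs_nonneg _).trans (hhS p.1))
      have h4 := hS p.1 p.2 p.2.2
      rw [abs_le] at *
      constructor <;> linarith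
  refine (h1.trans h2).mono ?_
  gcongr

end FibreIntegral

/-! ### Regularity, positivity and mass of the density. -/

section Density

variable {m : ℕ} {M : Type*} [MetricSpace M] [ChartedSpace (EuclideanSpace ℝ (Fin m)) M]
  [IsManifold (𝓡 m) ∞ M] {ω' : Form (𝓡 m) M m}

/-- The function χ is not assumed smooth; the density is smooth as a quotient of the coefficients of
two smooth forms, the denominator having no zeros. -/
theorem contMDiff_density (hω' : ω'.IsVolumeForm) {Ω : Form (cylModel m) (Cyl M) (m + 1)}
    (hΩ : Ω.IsSmooth) {a : Cyl M → ℝ} (h : ∀ p, Ω p = a p • wedgeDz ω' p) :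
    ContMDiff (cylModel m) 𝓘(ℝ, ℝ) ∞ a := by
  intro p
  obtain ⟨ε, z₀, hε, hφ, -⟩ := extChartAt_Icc_spec p.2
  have hε0 : ε ≠ 0 := left_ne_zero_of_mul (hε ▸ one_ne_zero)
  set U := (chartAt (ModelProd (EuclideanSpace ℝ (Fin m)) (EuclideanHalfSpace 1)) p).source with hU
  have h1 : ContMDiffOn (cylModel m) 𝓘(ℝ, ℝ) ∞ (fun q => Ω.inChart p q (cylBasis m)) U :=
    (ContinuousAlternatingMap.apply ℝ (EuclideanSpace ℝ (Fin m) × EuclideanSpace ℝ (Fin 1)) ℝ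
      (cylBasis m)).contMDiff.comp_contMDiffOn (hΩ p)
  have h2 : ContMDiffOn (cylModel m) 𝓘(ℝ, ℝ) ∞ (fun q : Cyl M => ε * coeff ω' p.1 q.1) U :=
    contMDiffOn_const.mul ((contMDiffOn_coeff hω' p.1).comp contMDiffOn_fst
      fun q hq => (mem_cyl_chart_source.1 hq).1)
  have h3 : ∀ q ∈ U, ε * coeff ω' p.1 q.1 ≠ 0 := fun q hq =>
    mul_ne_zero hε0 (coeff_ne_zero hω' (mem_cyl_chart_source.1 hq).1)
  refine ((h1.div₀ h2 h3).congr fun q hq => ?_).contMDiffAt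
    ((chartAt _ p).open_source.mem_nhds (mem_chart_source _ p))
  have h4 : Ω.inChart p q (cylBasis m) = a q * (wedgeDz ω').inChart p q (cylBasis m) := by
    rw [Form.inChart, h]
    rfl
  rw [wedgeDz_inChart_cylBasis ω' hφ hε hq] at h4
  rw [Pi.div_apply, eq_div_iff (h3 q hq)]
  exact h4.symm

end Density

/-- For C ≥ 1 the bound on χ does not give positivity. A sign change along a fibre would produce a
zero, by the intermediate value theorem. -/
theorem pos_of_ne_zero_of_pos_bottom {M : Type*} [TopologicalSpace M] {a : Cyl M → ℝ}
    (ha : Continuous a) (hne : ∀ p, a p ≠ 0) (hb : ∀ p : Cyl M, (p.2 : ℝ) < 0 → a p = 1)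
    (p : Cyl M) : 0 < a p := by
  by_contra! hle
  have hcont : Continuous fun t : Icc (-1 : ℝ) 1 => a (p.1, t) :=
    ha.comp (continuous_const.prodMk continuous_id)
  have h1 : a (p.1, ⟨-1, by norm_num⟩) = 1 := hb _ (by norm_num)
  have : PreconnectedSpace (Icc (-1 : ℝ) 1) := Subtype.preconnectedSpace isPreconnected_Icc
  obtain ⟨t, ht⟩ := mem_range_of_exists_le_of_exists_ge hcont ⟨p.2, hle⟩
    ⟨⟨-1, by norm_num⟩, by rw [h1]; exact zero_le_one⟩
  exact hne _ ht

/-- The support of χ may touch height 0, which is reached by continuity from below. -/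
theorem eq_one_of_nonpos {M : Type*} [TopologicalSpace M] {a : Cyl M → ℝ} (ha : Continuous a)
    (hb : ∀ p : Cyl M, (p.2 : ℝ) < 0 → a p = 1) (p : Cyl M) (hp : (p.2 : ℝ) ≤ 0) : a p = 1 := by
  have hcont : Continuous fun t : ℝ => a (p.1, projIcc (-1) 1 neg_one_le_one_real t) :=
    ha.comp (continuous_const.prodMk continuous_projIcc)
  have hcl : closure (Iio (0 : ℝ)) ⊆ {t | a (p.1, projIcc (-1) 1 neg_one_le_one_real t) = 1} := by
    refine closure_minimal (fun t ht => hb _ ?_) (isClosed_eq hcont continuous_const)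
    rw [coe_projIcc]
    exact max_lt (by norm_num) ((min_le_right _ _).trans_lt ht)
  rw [closure_Iio] at hcl
  have h := hcl hp
  rwa [mem_ofPred_eq, projIcc_val] at h

theorem mass_sub_one_eq_zero {m : ℕ} {M : Type*} [MetricSpace M] [CompactSpace M]
    [ChartedSpace (EuclideanSpace ℝ (Fin m)) M] [IsManifold (𝓡 m) ∞ M] {ω' : Form (𝓡 m) M m}
    (hω' : ω'.IsVolumeForm) {a : Cyl M → ℝ} (ha : Continuous a)
    (h : Form.integral (cylBasis m) (wedgeDz ω') (wedgeDz ω') =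
      Form.integral (cylBasis m) (wedgeDz ω') fun p => a p • wedgeDz ω' p) :
    mass (cylBasis m) (wedgeDz ω') (fun p => a p - 1) = 0 := by
  have h1 : mass (cylBasis m) (wedgeDz ω') (fun _ => 1) =
      Form.integral (cylBasis m) (wedgeDz ω') (wedgeDz ω') := by
    rw [mass]
    congr 1
    funext p
    exact one_smul ℝ _
  have hc : Continuous fun p => a p - 1 := ha.sub continuous_const
  have h2 := mass_add (cylBasis m) (continuousOn_wedgeDz_inChart hω') hc
    (continuous_const (y := (1 : ℝ)))
  simp only [sub_add_cancel] at h2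
  rw [h1, h] at h2
  exact right_eq_add.1 h2

theorem cylDist_le {M : Type*} [MetricSpace M] {p q : Cyl M} {r : ℝ} (h1 : dist p.1 q.1 ≤ r)
    (h2 : dist p.2 q.2 ≤ r) : cylDist p q ≤ 2 * r := by
  have hr : 0 ≤ r := dist_nonneg.trans h1
  refine Real.sqrt_le_iff.2 ⟨by positivity, ?_⟩
  nlinarith [pow_le_pow_left₀ dist_nonneg h1 2, pow_le_pow_left₀ dist_nonneg h2 2]

/-! ### Choice of the constants and the final displacement bound. -/

section Displacement

variable {m : ℕ} {M : Type*} [MetricSpace M] [ChartedSpace (EuclideanSpace ℝ (Fin m)) M]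
  [IsManifold (𝓡 m) ∞ M] [CompactSpace M] {ω' : Form (𝓡 m) M m}

theorem fibreInt_sub_one {M : Type*} [TopologicalSpace M] {a : Cyl M → ℝ} (ha : Continuous a)
    (x : M) (t : ℝ) :
    fibreInt (fun p => a p - 1) x t = fibreInt a x t - (t + 1) := by
  have h := fibreInt_add (continuous_const (y := (1 : ℝ))) (ha.sub continuous_const) x t
    (b := fun p => a p - 1)
  rw [fibreInt_one] at h
  rw [eq_sub_iff_add_eq', ← h]
  congr 1
  ext p
  ring

/-- Below height 0 the integrand is zero, and over [0, 1] the integral of a positive function minus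
1 exceeds -1. -/
theorem neg_one_lt_fibreInt_sub_one {a : Cyl M → ℝ} (ha : Continuous a) (hpos : ∀ p, 0 < a p)
    (ha0 : ∀ p : Cyl M, (p.2 : ℝ) ≤ 0 → a p = 1) (x : M) :
    -1 < fibreInt (fun p => a p - 1) x 1 := by
  have : Nonempty (Cyl M) := ⟨(x, endPt)⟩
  obtain ⟨p₀, -, hp₀⟩ := isCompact_univ.exists_isMinOn univ_nonempty ha.continuousOn
  have hmono := strictMono_fibreInt ha (hpos p₀) (fun p => hp₀ (mem_univ p)) x
  have h0 : fibreInt a x 0 = 1 := by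
    have : fibreInt a x 0 = fibreInt (fun _ => 1) x 0 := by
      refine intervalIntegral.integral_congr fun s hs => ha0 _ ?_
      rw [uIcc_of_le (by norm_num)] at hs
      simp only [coe_projIcc]
      exact max_le (by norm_num) ((min_le_right _ _).trans hs.2)
    rw [this, fibreInt_one, zero_add]
  have h1 := hmono zero_lt_one
  rw [fibreInt_sub_one ha]
  linarith

theorem abs_fibreInt_le {M : Type*} [MetricSpace M] {g : Cyl M → ℝ} {C δ : ℝ} (hg : Continuous g)
    (hC : ∀ p, |g p| ≤ C) (hδ : 0 < δ) (h0 : ∀ p : Cyl M, (p.2 : ℝ) ≤ 0 → g p = 0)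
    (h1 : ∀ p : Cyl M, δ < (p.2 : ℝ) → g p = 0) (x : M) {t : ℝ} (ht : t ∈ Icc (-1 : ℝ) 1) :
    |fibreInt g x t| ≤ C * δ := by
  have hproj : ∀ s ∈ Icc (-1) t, projIcc (-1) 1 neg_one_le_one_real s = s := fun s hs => by
    rw [projIcc_of_mem neg_one_le_one_real ⟨hs.1, hs.2.trans ht.2⟩]
  refine abs_intervalIntegral_le_of_support (continuous_extendHeight hg x) (fun s => hC _) hδ.le
    (fun s hs hs0 => h0 _ ?_) (fun s hs hs1 => h1 _ ?_) ht.1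
  · exact (hproj s hs).trans_le hs0.le
  · exact hs1.trans_eq (hproj s hs).symm

variable [ConnectedSpace M] [Bundle.RiemannianBundle (fun x : M => TangentSpace (𝓡 m) x)]
  [IsContMDiffRiemannianBundle (𝓡 m) ∞ (EuclideanSpace ℝ (Fin m))
    (fun x : M => TangentSpace (𝓡 m) x)]
  [IsRiemannianManifold (𝓡 m) M]

/-- The quantitative construction is needed only when δ(4C + 1) ≤ 1. Otherwise δ is bounded below,
any diffeomorphism with the right pullback will do, and the diameter bounds its displacement. -/
theorem exists_diffeomorph_of_density (hω' : ω'.IsVolumeForm) {C : ℝ} (hC0 : 0 ≤ C) :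
    ∃ D : ℝ, ∀ δ : ℝ, 0 < δ → ∀ a : Cyl M → ℝ,
      ContMDiff (cylModel m) 𝓘(ℝ, ℝ) ∞ a → (∀ p, 0 < a p) →
      (∀ p : Cyl M, (p.2 : ℝ) ≤ 0 → a p = 1) → (∀ p : Cyl M, δ < (p.2 : ℝ) → a p = 1) →
      (∀ p, |a p - 1| ≤ C) → mass (cylBasis m) (wedgeDz ω') (fun p => a p - 1) = 0 →
      ∃ f : Diffeomorph (cylModel m) (cylModel m) (Cyl M) (Cyl M) ∞,
        (∀ p : Cyl M, (p.2 : ℝ) ≤ 0 → f p = p) ∧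
        (∀ p, Form.pullback f (fun q => a q • wedgeDz ω' q) p = (1 : ℝ) • wedgeDz ω' p) ∧
        ∀ p, cylDist p (f p) ≤ D * δ := by
  obtain ⟨B, hB, hmain⟩ := exists_transports_density (M := M) hω'
  set d : ℝ := Metric.diam (univ : Set M) + 2 with hd
  have hd0 : 0 ≤ d := by positivity
  refine ⟨2 * (16 * B + 4) * C + 2 * d * (4 * C + 1), fun δ hδ a ha hpos ha0 ha1 haC hmass => ?_⟩
  have hcont : Continuous fun p => a p - 1 := ha.continuous.sub continuous_const
  have hS : ∀ x, ∀ t ∈ Icc (-1 : ℝ) 1, |fibreInt (fun p => a p - 1) x t| ≤ C * δ :=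
    fun x t ht => abs_fibreInt_le hcont haC hδ (fun p hp => by simp only [ha0 p hp, sub_self])
      (fun p hp => by simp only [ha1 p hp, sub_self]) x ht
  rcases le_or_gt (δ * (4 * C + 1)) 1 with hsmall | hlarge
  · have hCδ : C * δ ≤ 1 / 4 := by nlinarith
    -- Here |h| ≤ 1/4, so ρ ≤ 2 leaves 1 + ρh ≥ 1/2 = 2κ. The displacement becomes (16B + 4)Cδ in
    -- each factor, and the product distance at most doubles it.
    obtain ⟨f, hf, hpull, hdist⟩ := hmain a (C * δ) 2 (1 / 4) ha hpos ha0 hmass hS (by norm_num)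
      (by norm_num) (by norm_num) fun x => by
        have := (abs_le.1 (hS x 1 (by norm_num))).1
        linarith
    refine ⟨f, hf, hpull, fun p => (cylDist_le (hdist p).1 (hdist p).2).trans ?_⟩
    have h1 : 0 ≤ 2 * d * (4 * C + 1) * δ := by positivity
    have h2 : 2 * (2 * 2 / (1 / 4) * (B * (C * δ)) + 2 * (C * δ) / (2 * (1 / 4))) =
        2 * (16 * B + 4) * C * δ := by ring
    rw [h2]
    linarith
  · obtain ⟨x₀, -, hx₀⟩ := isCompact_univ.exists_isMinOn univ_nonempty
      (contMDiff_fibreInt (ha.sub contMDiff_const) (M := M)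
        (a := fun p => a p - 1)).continuous.continuousOn
    set l : ℝ := max (-fibreInt (fun p => a p - 1) x₀ 1) 0 with hl
    have hl0 : 0 ≤ l := le_max_right _ _
    have hl1 : l < 1 := max_lt (by
      linarith [neg_one_lt_fibreInt_sub_one ha.continuous hpos ha0 x₀]) zero_lt_one
    have hle : ∀ x, -fibreInt (fun p => a p - 1) x 1 ≤ l := fun x =>
      (neg_le_neg (hx₀ (mem_univ x))).trans (le_max_left _ _)
    -- Since -h ≤ l < 1, the value r = 2 / (1 + l) exceeds 1 and satisfies l r = 1 - 2κ with 2κ = (1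
    -- - l) / (1 + l). As κ may be arbitrarily small, the displacement bound is discarded.
    obtain ⟨f, hf, hpull, -⟩ := hmain a (C * δ) (2 / (1 + l)) ((1 - l) / (1 + l) / 2) ha hpos ha0
      hmass hS (by rw [lt_div_iff₀ (by linarith)]; linarith)
      (div_pos (div_pos (by linarith) (by linarith)) two_pos)
      (by
        rw [mul_div_cancel₀ _ two_ne_zero, div_le_one (by linarith)]
        linarith)
      fun x => by
        have h1 : -fibreInt (fun p => a p - 1) x 1 * (2 / (1 + l)) ≤ l * (2 / (1 + l)) :=
          mul_le_mul_of_nonneg_right (hle x) (div_nonneg zero_le_two (by linarith))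
        have h2 : l * (2 / (1 + l)) = 1 - 2 * ((1 - l) / (1 + l) / 2) := by
          field_simp
          ring
        linarith
    refine ⟨f, hf, hpull, fun p => ?_⟩
    have h1 : dist p.1 (f p).1 ≤ d := by
      have := Metric.dist_le_diam_of_mem (isCompact_univ (X := M)).isBounded (mem_univ p.1)
        (mem_univ (f p).1)
      linarith
    have h2 : dist p.2 (f p).2 ≤ d := by
      rw [Subtype.dist_eq, Real.dist_eq]
      have hdiam : 0 ≤ Metric.diam (univ : Set M) := Metric.diam_nonneg
      rw [abs_le]
      constructor <;> linarith [p.2.2.1, p.2.2.2, (f p).2.2.1, (f p).2.2.2]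
    refine (cylDist_le h1 h2).trans ?_
    have h3 : 0 ≤ 2 * (16 * B + 4) * C * δ := by positivity
    nlinarith [mul_le_mul_of_nonneg_left hlarge.le hd0]

end Displacement

end VolumeAdjust

end

/-! ### The theorem: reduction to the density of Ω. -/

theorem mainTheorem7 {m : ℕ} {M : Type*} [MetricSpace M] [CompactSpace M] [ConnectedSpace M]
    [ChartedSpace (EuclideanSpace ℝ (Fin m)) M] [IsManifold (𝓡 m) ∞ M]
    [Bundle.RiemannianBundle (fun x : M => TangentSpace (𝓡 m) x)]
    [IsContMDiffRiemannianBundle (𝓡 m) ∞ (EuclideanSpace ℝ (Fin m))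
      (fun x : M => TangentSpace (𝓡 m) x)]
    [IsRiemannianManifold (𝓡 m) M]
    (ω' : VolumeAdjust.Form (𝓡 m) M m) (hω' : ω'.IsVolumeForm) (C : ℝ) :
    ∃ D : ℝ, ∀ δ : ℝ, 0 < δ →
      ∀ (Ω : VolumeAdjust.Form (VolumeAdjust.cylModel m) (VolumeAdjust.Cyl M) (m + 1))
        (χ : VolumeAdjust.Cyl M → ℝ),
        Ω.IsVolumeForm →
        ((∀ p, Ω p = (1 + χ p) • VolumeAdjust.wedgeDz ω' p) ∨
          (C < 1 ∧ ∀ p, VolumeAdjust.wedgeDz ω' p = (1 + χ p) • Ω p)) →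
        VolumeAdjust.Form.integral (VolumeAdjust.cylBasis m) (VolumeAdjust.wedgeDz ω')
            (VolumeAdjust.wedgeDz ω') =
          VolumeAdjust.Form.integral (VolumeAdjust.cylBasis m) (VolumeAdjust.wedgeDz ω') Ω →
        (∀ p, |χ p| ≤ C) →
        (tsupport χ ⊆ {p | 0 ≤ (p.2 : ℝ) ∧ (p.2 : ℝ) ≤ δ}) →
        ∃ f : Diffeomorph (VolumeAdjust.cylModel m) (VolumeAdjust.cylModel m)
            (VolumeAdjust.Cyl M) (VolumeAdjust.Cyl M) ∞,
          (∀ p : VolumeAdjust.Cyl M, (p.2 : ℝ) ≤ 0 → f p = p) ∧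
          Ω.pullback f = VolumeAdjust.wedgeDz ω' ∧
          ∀ p, VolumeAdjust.cylDist p (f p) ≤ D * δ := by
  -- In the second alternative |a - 1| = |χ| / (1 + χ) ≤ C / (1 - C). For C ≥ 1 that quotient
  -- carries no information, but then only the bound C of the first alternative is needed. The outer
  -- maximum with 0 covers negative C.
  have hQ : 0 ≤ max (max C (C / (1 - C))) 0 := le_max_right _ _
  obtain ⟨D, hD⟩ := VolumeAdjust.exists_diffeomorph_of_density (M := M) hω' hQ
  refine ⟨D, fun δ hδ Ω χ hΩ halt hint hχ hsupp => ?_⟩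
  have hχ0 : ∀ p : VolumeAdjust.Cyl M, ¬ (0 ≤ (p.2 : ℝ) ∧ (p.2 : ℝ) ≤ δ) → χ p = 0 := fun p hp =>
    image_eq_zero_of_notMem_tsupport fun h => hp (hsupp h)
  obtain ⟨a, haΩ, haC, haχ⟩ : ∃ a : VolumeAdjust.Cyl M → ℝ,
      (∀ p, Ω p = a p • VolumeAdjust.wedgeDz ω' p) ∧
      (∀ p, |a p - 1| ≤ max (max C (C / (1 - C))) 0) ∧ ∀ p, χ p = 0 → a p = 1 := by
    rcases halt with h | ⟨hC, h⟩
    · refine ⟨fun p => 1 + χ p, h, fun p => ?_, fun p hp => by simp [hp]⟩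
      rw [add_sub_cancel_left]
      exact (hχ p).trans ((le_max_left _ _).trans (le_max_left _ _))
    · have hlow : ∀ p, 1 - C ≤ 1 + χ p := fun p => by linarith [(abs_le.1 (hχ p)).1]
      have hpos : ∀ p, 0 < 1 + χ p := fun p => by linarith [hlow p]
      refine ⟨fun p => (1 + χ p)⁻¹, fun p => ?_, fun p => ?_, fun p hp => by simp [hp]⟩
      · rw [h p, smul_smul, inv_mul_cancel₀ (hpos p).ne', one_smul]
      · have e : (1 + χ p)⁻¹ - 1 = -χ p / (1 + χ p) := by
          have := (hpos p).ne'
          field_simp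
          ring
        rw [e, abs_div, abs_neg, abs_of_pos (hpos p)]
        refine le_trans ?_ ((le_max_right _ _).trans (le_max_left _ _))
        exact div_le_div₀ ((abs_nonneg _).trans (hχ p)) (hχ p) (by linarith) (hlow p)
  have hasm := VolumeAdjust.contMDiff_density hω' hΩ.smooth haΩ
  have hane : ∀ p, a p ≠ 0 := fun p h0 => hΩ.ne_zero p (by rw [haΩ p, h0, zero_smul])
  have hneg : ∀ p : VolumeAdjust.Cyl M, (p.2 : ℝ) < 0 → a p = 1 := fun p hp =>
    haχ p (hχ0 p fun h => by linarith [h.1])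
  have hlow : ∀ p : VolumeAdjust.Cyl M, (p.2 : ℝ) ≤ 0 → a p = 1 :=
    VolumeAdjust.eq_one_of_nonpos hasm.continuous hneg
  have hpos := VolumeAdjust.pos_of_ne_zero_of_pos_bottom hasm.continuous hane hneg
  have hΩa : Ω = fun p => a p • VolumeAdjust.wedgeDz ω' p := funext haΩ
  obtain ⟨f, hf, hpull, hdist⟩ := hD δ hδ a hasm hpos hlow
    (fun p hp => haχ p (hχ0 p fun h => by linarith [h.2])) haC
    (VolumeAdjust.mass_sub_one_eq_zero hω' hasm.continuous (hΩa ▸ hint))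
  refine ⟨f, hf, ?_, hdist⟩
  rw [hΩa]
  funext p
  exact (hpull p).trans (one_smul ℝ _)
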